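/- **Conventions.** Let $q\in\mathbb C$ be nonzero and not a root of unity, with $q^4+3+q^{-4}\ne 0$, and fix a square root $q^{1/2}$. In any algebra put $[X,Y]_x=XY-x^{-1}YX$. For scalars $a,b,c,d,\bar c,\bar d,x$ let $AW(a,b,c,d,\bar c,\bar d,x)$ be the unital $\mathbb C$-algebra with generators $W_0,W_1,W_2$ and relations $$[W_0,W_1]_x=aW_2,\qquad [W_1,W_2]_x=bW_1+cW_0+d,\qquad [W_2,W_0]_x=bW_0+\bar cW_1+\bar d .$$ **Quantum affine algebra.** $U_q(a_2^{(2)})$ is generated by $e_i,f_i,k_i^{\pm1}$ ($i=0,1$; $k_i=q_i^{h_i/2}$), with $(a_{ij})=\begin{pmatrix}2&-1\\-4&2\end{pmatrix}$, $q_0=q^4$, $q_1=q$, and relations $k_ik_i^{-1}=k_i^{-1}k_i=1$, $k_ik_j=k_jk_i$, $k_ie_jk_i^{-1}=q_i^{a_{ij}/2}e_j$, $k_if_jk_i^{-1}=q_i^{-a_{ij}/2}f_j$, $[e_i,f_j]=\delta_{ij}\frac{k_i^2-k_i^{-2}}{q_i-q_i^{-1}}$ and the $q$-Serre relations $\sum_{m=0}^{1-a_{ij}}(-1)^m\binom{1-a_{ij}}{m}_{q_i}x_i^{1-a_{ij}-m}x_jx_i^m=0$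 for $i\ne j$ and $x=e$, $x=f$. With $E_{ij}$ the matrix units, its 3-dimensional representation $\pi_u$ ($u\in\mathbb C^*$), normalized by $s_0,s_1\in\mathbb C^*$, is $$e_0\mapsto us_0E_{31},\quad f_0\mapsto u^{-1}s_0^{-1}E_{13},\quad k_0\mapsto\mathrm{diag}(q^{-2},1,q^2),$$ $$e_1\mapsto s_1(E_{12}+E_{23}),\quad f_1\mapsto (q+q^{-1})s_1^{-1}(E_{21}+E_{32}),\quad k_1\mapsto\mathrm{diag}(q,1,q^{-1}).$$ **Generalized $q$-Onsager algebra.** Let $c_0,\bar c_0,c_1,\bar c_1\in\mathbb C^*$ and put $$\rho=c_0\bar c_0,\quad \bar\rho=(q+q^{-1})^2(q^4+3+q^{-4})c_1\bar c_1,\quad \tilde\rho=-\Big(\tfrac{(q^2+q^{-2})\bar\rho}{q^4+3+q^{-4}}\Big)^2,\quad w=\tfrac{(q^2-1+q^{-2})(q^4+2q^2+4+2q^{-2}+q^{-4})}{q^4+3+q^{-4}} .$$ $O_q(a_2^{(2)})$ is generated by $A_0,A_1$ with relations $[A_0,[A_0,A_1]_{q^4}]_{q^{-4}}=\rho A_1$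 and $$\big[A_1,\,[A_1,[A_1,[A_1,[A_1,A_0]_{q^4}]_{q^{-4}}]_{q^2}]_{q^{-2}}-\bar\rho(A_1^2A_0-wA_1A_0A_1+A_0A_1^2)-\tilde\rho A_0\big]=0 .$$ The coaction is $\delta(A_i)=(c_ie_ik_i+\bar c_if_ik_i)\otimes1+k_i^2\otimes A_i\in U_q(a_2^{(2)})\otimes O_q(a_2^{(2)})$, extended multiplicatively to all noncommutative polynomials in $A_0,A_1$. Put $\mu=c_0\bar c_0$, $\bar\mu=(q+q^{-1})^2(q^2+q^{-2})^2c_1\bar c_1$, let $C\in\mathbb C$ and $\mathcal A=AW(1,0,-q^{-4}\bar\mu,C,-q^{-4}\mu,0,q^4)$. Let $\Pi:O_q(a_2^{(2)})\to\mathcal A$ be the homomorphism $A_i\mapsto W_i$ $(i=0,1)$, and let $$Q=q^{-8}\mu W_1^2-q^4W_2^2+\bar\mu W_0^2+(q^4-q^{-4})W_0W_1W_2-(q^4+1)CW_0 .$$ **The $K$-matrix.** Let $\alpha,\beta,s_0,s_1$ satisfy $\alpha^2=\mu$, $\beta^2\bar\mu(q+q^{-1})=q^8$, $s_0^2=q^4\bar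 c_0/c_0$, $s_1^2=q(q+q^{-1})\bar c_1/c_1$, with roots chosen compatibly: $\alpha s_0=q^2\bar c_0$ and $\beta c_1s_1(q+q^{-1})(q^2+q^{-2})=q^{9/2}$. Write $g=q^4-q^{-4}$ and, for $u\ne0$, $u^2\neq1$, $$h=\frac{\alpha q^4(q^3u-q^{-3}u^{-1})}{\beta(q+q^{-1})g}-\beta C,$$ $$h_1=\frac{\beta g\,Q}{\alpha(u-u^{-1})}+\frac{u\beta C(q-q^{-1})(q^2+q^{-2})}{u-u^{-1}}+\frac{q^4u\alpha(q^3u-q^{-3}u^{-1})}{\beta(u-u^{-1})(q+q^{-1})^2(q^2+q^{-2})},$$ $$h_2=\frac{\beta g\,Q}{\alpha(u-u^{-1})}+\frac{\beta C(uq-u^{-1}q^{-1})(q^2+q^{-2})}{u-u^{-1}}+\frac{q^4\alpha(qu-q^{-1}u^{-1})(q^3u-q^{-3}u^{-1})}{\beta(u-u^{-1})(q+q^{-1})g},$$ $$h_3=\frac{\beta g\,Q}{\alpha(u-u^{-1})}+\frac{\beta C(q-q^{-1})(q^2+q^{-2})}{u(u-u^{-1})}+\frac{q^4\alpha(q^3u-q^{-3}u^{-1})}{u\beta(u-u^{-1})(q+q^{-1})^2(q^2+q^{-2})}.$$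 Let $K(u)=K^{(1)}(u)+K^{(2)}(u)\in\mathrm{Mat}_3(\mathcal A)$, where $$K^{(1)}=\begin{pmatrix}h_1&0&h\\0&h_2&0\\h&0&h_3\end{pmatrix}$$ and $K^{(2)}$ has the entries $$K^{(2)}_{11}=\alpha\beta guW_1^2+\tfrac{q}{\beta(q+q^{-1})}W_0,\quad K^{(2)}_{22}=-\tfrac{q^4}{\beta}W_0,\quad K^{(2)}_{33}=-\tfrac{\alpha\beta g}{q^8u}W_1^2+\tfrac{q^7}{\beta(q+q^{-1})}W_0,$$ $$K^{(2)}_{12}=q^{-7/2}[W_1,W_0]_{q^{-4}}+q^{7/2}\alpha uW_1,\qquad K^{(2)}_{21}=q^{-7/2}[W_0,W_1]_{q^{-4}}+q^{7/2}\alpha uW_1,$$ $$K^{(2)}_{23}=q^{7/2}[W_0,W_1]_{q^4}+q^{-7/2}\alpha u^{-1}W_1,\qquad K^{(2)}_{32}=q^{7/2}[W_1,W_0]_{q^4}+q^{-7/2}\alpha u^{-1}W_1,$$ $$K^{(2)}_{13}=\beta[[W_0,W_1]_{q^4},W_1]_{q^4},\qquad K^{(2)}_{31}=\beta[W_1,[W_1,W_0]_{q^4}]_{q^4}.$$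 **$R$-matrix.** Let $R^{(x)}$ act on $\mathbb C^3\otimes\mathbb C^3$ (basis $v_1\otimes v_1,v_1\otimes v_2,\dots,v_3\otimes v_3$) as the upper triangular $9\times 9$ matrix with diagonal $(x^2,1,x^{-2},1,1,1,x^{-2},1,x^2)$ and, with $t=x^2-x^{-2}$, the off-diagonal entries $t$ at $(2,4),(6,8)$, $x^{-1}t$ at $(3,5),(5,7)$, and $x^{-1}t(x-x^{-1})$ at $(3,7)$, all others being zero. With $P$ the permutation operator and $X_{21}=PX_{12}P$, the Izergin–Korepin matrix is $$R_{12}(u)=(u-1)q^3R^{(q)}_{21}+(1-u^{-1})q^{-3}R^{(q^{-1})}_{12}+q^{-5}(q^4-1)(q^6+1)P .$$ Put $R'_{12}(u)=R_{21}(u)$ and $R'_{21}(u)=R_{12}(u)$. **Theorem.** The element $Q$ is central in $\mathcal A$. For every $u\in\mathbb C^*$ with $u^2\ne1$: 1. the entries of $K(u)$ lie in the span of the monomials $W_0^{i_0}W_1^{i_1}W_2^{i_2}$ with $i_0+i_1+i_2<4$; 2. for every noncommutative polynomial $y$ in $A_0,A_1$, $$K(u)\,(\pi_u\otimes\Pi)(\delta(y))=(\pi_{u^{-1}}\otimes\Pi)(\delta(y))\,K(u);\qquad(*)$$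 3. $K(u)$ is unique up to a scalar: if $K'\in\mathrm{Mat}_3(\mathcal A)$ satisfies $(*)$ for all $y$ and its entries are $\mathbb C$-linear combinations of the monomials in 1, then $K'=zK(u)$ with $z\in\mathbb C$; if its entries are combinations of these monomials with coefficients in $\mathbb C[Q]$, then $K'=f(Q)K(u)$ for some polynomial $f$ over $\mathbb C$; 4. $K(u)^{-1}\propto K(u^{-1})$: there is a polynomial $\chi$ over $\mathbb C$ such that $\chi(Q)$ is nonzero and not a zero divisor in $\mathcal A$ and $K(u)K(u^{-1})=K(u^{-1})K(u)=\chi(Q)\cdot 1$. Moreover, for all $u,v\in\mathbb C^*$ with $u^2\neq1$, $v^2\ne1$, with $K_1=K\otimes 1$, $K_2=1\otimes K$, $$R'_{12}(u/v)\,K_1(u)\,R'_{21}(uv)\,K_2(v)=K_2(v)\,R'_{12}(uv)\,K_1(u)\,R'_{21}(u/v).$$ -/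

import Mathlib

open scoped TensorProduct Kronecker Matrix

noncomputable section

namespace DynK

/-- The bracket `[X, Y]_x = X Y - x⁻¹ Y X`. -/
def qbr {A : Type*} [Ring A] [Algebra ℂ A] (x : ℂ) (X Y : A) : A :=
  X * Y - x⁻¹ • (Y * X)

/-! ## The Askey-Wilson (Zhedanov) algebra -/

/-- Defining relations of the Askey-Wilson algebra `AW(a, b, c, d, c', d', x)`. -/
inductive AWRel (a b c d c' d' x : ℂ) :
    FreeAlgebra ℂ (Fin 3) → FreeAlgebra ℂ (Fin 3) → Prop
  | rel01 : AWRel a b c d c' d' x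
      (qbr x (FreeAlgebra.ι ℂ 0) (FreeAlgebra.ι ℂ 1)) (a • FreeAlgebra.ι ℂ 2)
  | rel12 : AWRel a b c d c' d' x
      (qbr x (FreeAlgebra.ι ℂ 1) (FreeAlgebra.ι ℂ 2))
      (b • FreeAlgebra.ι ℂ 1 + c • FreeAlgebra.ι ℂ 0 + d • 1)
  | rel20 : AWRel a b c d c' d' x
      (qbr x (FreeAlgebra.ι ℂ 2) (FreeAlgebra.ι ℂ 0))
      (b • FreeAlgebra.ι ℂ 0 + c' • FreeAlgebra.ι ℂ 1 + d' • 1)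

/-- The Askey-Wilson algebra `AW(a, b, c, d, c', d', x)`, by generators and relations. -/
def AW (a b c d c' d' x : ℂ) : Type := RingQuot (AWRel a b c d c' d' x)

instance (a b c d c' d' x : ℂ) : Ring (AW a b c d c' d' x) :=
  inferInstanceAs (Ring (RingQuot (AWRel a b c d c' d' x)))

instance (a b c d c' d' x : ℂ) : Algebra ℂ (AW a b c d c' d' x) :=
  inferInstanceAs (Algebra ℂ (RingQuot (AWRel a b c d c' d' x)))

/-- The generators `W₀, W₁, W₂`. -/
def AW.W {a b c d c' d' x : ℂ} (i : Fin 3) : AW a b c d c' d' x :=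
  RingQuot.mkAlgHom ℂ (AWRel a b c d c' d' x) (FreeAlgebra.ι ℂ i)

section
variable {a b c d c' d' x : ℂ}

theorem map_qbr {A B : Type*} [Ring A] [Algebra ℂ A] [Ring B] [Algebra ℂ B] (g : A →ₐ[ℂ] B)
    (t : ℂ) (X Y : A) : g (qbr t X Y) = qbr t (g X) (g Y) := by
  simp [qbr]

theorem AW.rel01 : qbr x (AW.W 0 : AW a b c d c' d' x) (AW.W 1) = a • AW.W 2 := by
  have h := RingQuot.mkAlgHom_rel ℂ (AWRel.rel01 (a := a) (b := b) (c := c) (d := d)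
    (c' := c') (d' := d') (x := x))
  simp only [map_qbr, map_smul] at h
  exact h

theorem AW.rel12 : qbr x (AW.W 1 : AW a b c d c' d' x) (AW.W 2)
    = b • AW.W 1 + c • AW.W 0 + d • 1 := by
  have h := RingQuot.mkAlgHom_rel ℂ (AWRel.rel12 (a := a) (b := b) (c := c) (d := d)
    (c' := c') (d' := d') (x := x))
  simp only [map_qbr, map_add, map_smul, map_one] at h
  exact h

theorem AW.rel20 : qbr x (AW.W 2 : AW a b c d c' d' x) (AW.W 0)
    = b • AW.W 0 + c' • AW.W 1 + d' • 1 := by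
  have h := RingQuot.mkAlgHom_rel ℂ (AWRel.rel20 (a := a) (b := b) (c := c) (d := d)
    (c' := c') (d' := d') (x := x))
  simp only [map_qbr, map_add, map_smul, map_one] at h
  exact h

end

/-- The Casimir element of the Askey-Wilson algebra
(for the bracket `[X, Y]_x = X Y - x⁻¹ Y X`). -/
def AW.casimir (a b c d c' d' x : ℂ) : AW a b c d c' d' x :=
  (c * x) • AW.W 0 ^ 2 + (c' * x⁻¹) • AW.W 1 ^ 2 + (a * x) • AW.W 2 ^ 2
    + b • (AW.W 0 * AW.W 1 + AW.W 1 * AW.W 0)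
    - (x - x⁻¹) • (AW.W 0 * AW.W 1 * AW.W 2)
    + (d * (x + 1)) • AW.W 0 + (d' * (1 + x⁻¹)) • AW.W 1

/-- The algebra `AW(1, 0, -q⁻⁴ μ', C, -q⁻⁴ μ, 0, q⁴)`. -/
abbrev AWA22 (q μ μ' C : ℂ) : Type :=
  AW 1 0 (-(q ^ (-4 : ℤ) * μ')) C (-(q ^ (-4 : ℤ) * μ)) 0 (q ^ 4)

/-- The Casimir element `Q` of `AW(1, 0, -q⁻⁴ μ', C, -q⁻⁴ μ, 0, q⁴)`, with the normalization
used in the `K`-matrix. -/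
def casQ (q μ μ' C : ℂ) : AWA22 q μ μ' C := - AW.casimir _ _ _ _ _ _ _

/-! ## The quantum affine algebra `U_q(a_2^{(2)})` -/

/-- The generators `e_i`, `f_i`, `k_i = q_i^{h_i/2}` and `k_i⁻¹ = q_i^{-h_i/2}`, `i = 0, 1`. -/
inductive UqGen
  | e (i : Fin 2)
  | f (i : Fin 2)
  | k (i : Fin 2)
  | kinv (i : Fin 2)

/-- The generalized Cartan matrix of `a_2^{(2)}`. -/
def cartan : Matrix (Fin 2) (Fin 2) ℤ := !![2, -1; -4, 2]

/-- The symmetrizing integers `d_i`; `q_i = q ^ d_i`. -/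
def dd : Fin 2 → ℕ := ![4, 1]

/-- `d_i a_{ij} / 2`, so that `q_i^{a_{ij}/2} = q ^ (halfForm i j)`. -/
def halfForm : Matrix (Fin 2) (Fin 2) ℤ := !![4, -2; -2, 1]

theorem two_mul_halfForm (i j : Fin 2) : 2 * halfForm i j = (dd i : ℤ) * cartan i j := by
  fin_cases i <;> fin_cases j <;> simp [halfForm, dd, cartan]

/-- `[n]_x = (x ^ n - x ^ (-n)) / (x - x⁻¹)`. -/
def qInt (x : ℂ) (n : ℕ) : ℂ := (x ^ n - x⁻¹ ^ n) / (x - x⁻¹)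

def qFactorial (x : ℂ) (n : ℕ) : ℂ := ∏ m ∈ Finset.Icc 1 n, qInt x m

/-- The symmetric `x`-binomial coefficient. -/
def qBinom (x : ℂ) (n m : ℕ) : ℂ :=
  qFactorial x n / (qFactorial x m * qFactorial x (n - m))

/-- The left-hand side of the `q`-Serre relation of degree `N = 1 - a_{ij}`. -/
def serre {A : Type*} [Ring A] [Algebra ℂ A] (x : ℂ) (N : ℕ) (X Y : A) : A :=
  ∑ m ∈ Finset.range (N + 1), ((-1) ^ m * qBinom x N m) • (X ^ (N - m) * Y * X ^ m)

/-- The free generators of the presentation of `U_q(a_2^{(2)})`. -/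
abbrev genE (i : Fin 2) : FreeAlgebra ℂ UqGen := FreeAlgebra.ι ℂ (UqGen.e i)
abbrev genF (i : Fin 2) : FreeAlgebra ℂ UqGen := FreeAlgebra.ι ℂ (UqGen.f i)
abbrev genK (i : Fin 2) : FreeAlgebra ℂ UqGen := FreeAlgebra.ι ℂ (UqGen.k i)
abbrev genKinv (i : Fin 2) : FreeAlgebra ℂ UqGen := FreeAlgebra.ι ℂ (UqGen.kinv i)

/-- Defining relations of `U_q(a_2^{(2)})`. -/
inductive UqRel (q : ℂ) : FreeAlgebra ℂ UqGen → FreeAlgebra ℂ UqGen → Prop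
  | k_kinv (i : Fin 2) : UqRel q (genK i * genKinv i) 1
  | kinv_k (i : Fin 2) : UqRel q (genKinv i * genK i) 1
  | k_k (i j : Fin 2) : UqRel q (genK i * genK j) (genK j * genK i)
  | k_e (i j : Fin 2) : UqRel q (genK i * genE j * genKinv i) (q ^ halfForm i j • genE j)
  | k_f (i j : Fin 2) : UqRel q (genK i * genF j * genKinv i) (q ^ (-halfForm i j) • genF j)
  | e_f_same (i : Fin 2) : UqRel q (genE i * genF i - genF i * genE i)
      ((q ^ dd i - (q ^ dd i)⁻¹)⁻¹ • (genK i ^ 2 - genKinv i ^ 2))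
  | e_f_ne (i j : Fin 2) (h : i ≠ j) : UqRel q (genE i * genF j - genF j * genE i) 0
  | serre_e (i j : Fin 2) (h : i ≠ j) :
      UqRel q (serre (q ^ dd i) (1 - cartan i j).toNat (genE i) (genE j)) 0
  | serre_f (i j : Fin 2) (h : i ≠ j) :
      UqRel q (serre (q ^ dd i) (1 - cartan i j).toNat (genF i) (genF j)) 0

/-- The quantum affine algebra `U_q(a_2^{(2)})`. -/
def Uq (q : ℂ) : Type := RingQuot (UqRel q)

instance (q : ℂ) : Ring (Uq q) := inferInstanceAs (Ring (RingQuot (UqRel q)))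

instance (q : ℂ) : Algebra ℂ (Uq q) := inferInstanceAs (Algebra ℂ (RingQuot (UqRel q)))

/-- The generators of `U_q(a_2^{(2)})`. -/
def Uq.gen {q : ℂ} (g : UqGen) : Uq q := RingQuot.mkAlgHom ℂ (UqRel q) (FreeAlgebra.ι ℂ g)

/-- The images of the generators in the 3-dimensional representation `π_u`. -/
def repGen (q s₀ s₁ u : ℂ) : UqGen → Matrix (Fin 3) (Fin 3) ℂ
  | .e 0 => !![0, 0, 0; 0, 0, 0; u * s₀, 0, 0]
  | .e 1 => !![0, s₁, 0; 0, 0, s₁; 0, 0, 0]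
  | .f 0 => !![0, 0, u⁻¹ * s₀⁻¹; 0, 0, 0; 0, 0, 0]
  | .f 1 => !![0, 0, 0; (q + q⁻¹) * s₁⁻¹, 0, 0; 0, (q + q⁻¹) * s₁⁻¹, 0]
  | .k 0 => !![q ^ (-2 : ℤ), 0, 0; 0, 1, 0; 0, 0, q ^ 2]
  | .k 1 => !![q, 0, 0; 0, 1, 0; 0, 0, q⁻¹]
  | .kinv 0 => !![q ^ 2, 0, 0; 0, 1, 0; 0, 0, q ^ (-2 : ℤ)]
  | .kinv 1 => !![q⁻¹, 0, 0; 0, 1, 0; 0, 0, q]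

theorem serre_zero_of_cube {A : Type*} [Ring A] [Algebra ℂ A] (x : ℂ) {X Y : A}
    (h : X ^ 3 = 0) : serre x 5 X Y = 0 := by
  refine Finset.sum_eq_zero fun m hm => ?_
  have hm' : m < 6 := Finset.mem_range.1 hm
  rcases Nat.lt_or_ge m 3 with h3 | h3
  · rw [pow_eq_zero_of_le (by omega : 3 ≤ 5 - m) h]; simp
  · rw [pow_eq_zero_of_le h3 h]; simp

theorem serre_zero_of_sq {A : Type*} [Ring A] [Algebra ℂ A] (x : ℂ) {X Y : A}
    (h : X ^ 2 = 0) (h' : X * Y * X = 0) : serre x 2 X Y = 0 := by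
  simp [serre, Finset.sum_range_succ, h, h']

theorem map_serre {A B : Type*} [Ring A] [Algebra ℂ A] [Ring B] [Algebra ℂ B] (g : A →ₐ[ℂ] B)
    (x : ℂ) (N : ℕ) (X Y : A) : g (serre x N X Y) = serre x N (g X) (g Y) := by
  simp [serre, map_sum]

theorem vec3_zero : (![0, 0, 0] : Fin 3 → ℂ) = 0 := by
  ext i; fin_cases i <;> rfl

theorem repGen_rel {q s₀ s₁ u : ℂ} (hq0 : q ≠ 0) (hq : ∀ n : ℕ, 0 < n → q ^ n ≠ 1)
    (hs₀ : s₀ ≠ 0) (hs₁ : s₁ ≠ 0) (hu : u ≠ 0) ⦃x y : FreeAlgebra ℂ UqGen⦄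
    (h : UqRel q x y) :
    FreeAlgebra.lift ℂ (repGen q s₀ s₁ u) x = FreeAlgebra.lift ℂ (repGen q s₀ s₁ u) y := by
  have hn : ∀ n : ℕ, 0 < n → q ^ n - (q ^ n)⁻¹ ≠ 0 := by
    intro n hn h
    have h0 : q ^ n ≠ 0 := pow_ne_zero _ hq0
    have h1 : q ^ n * q ^ n = 1 := by
      rw [sub_eq_zero] at h
      nth_rewrite 2 [h]
      exact mul_inv_cancel₀ h0
    exact hq (n + n) (by omega) (by rw [pow_add, h1])
  have h1 : q - q⁻¹ ≠ 0 := by simpa using hn 1 one_pos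
  have h4 : q ^ 4 - (q ^ 4)⁻¹ ≠ 0 := hn 4 (by norm_num)
  cases h with
  | k_kinv i =>
    simp only [map_mul, map_one, FreeAlgebra.lift_ι_apply, genK, genKinv]
    fin_cases i <;> ext a b <;> fin_cases a <;> fin_cases b <;> simp [repGen, hq0]
  | kinv_k i =>
    simp only [map_mul, map_one, FreeAlgebra.lift_ι_apply, genK, genKinv]
    fin_cases i <;> ext a b <;> fin_cases a <;> fin_cases b <;> simp [repGen, hq0]
  | k_k i j =>
    simp only [map_mul, FreeAlgebra.lift_ι_apply, genK]
    fin_cases i <;> fin_cases j <;> simp [repGen, mul_comm]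
  | k_e i j =>
    simp only [map_mul, map_smul, FreeAlgebra.lift_ι_apply, genK, genKinv, genE]
    fin_cases i <;> fin_cases j <;> simp [repGen, halfForm, vec3_zero] <;> field_simp
  | k_f i j =>
    simp only [map_mul, map_smul, FreeAlgebra.lift_ι_apply, genK, genKinv, genF]
    fin_cases i <;> fin_cases j <;> simp [repGen, halfForm, vec3_zero] <;> field_simp
  | e_f_same i =>
    simp only [map_mul, map_sub, map_smul, map_pow, FreeAlgebra.lift_ι_apply, genK, genKinv,
      genE, genF]
    fin_cases i
    · simp only [repGen, dd, pow_two]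
      simp
      constructor <;> rw [eq_inv_mul_iff_mul_eq₀ h4] <;> field_simp <;> ring
    · simp only [repGen, dd, pow_two]
      simp
      refine ⟨?_, ?_, ?_⟩
      · rw [eq_inv_mul_iff_mul_eq₀ h1]; field_simp; ring
      · field_simp; ring
      · rw [eq_inv_mul_iff_mul_eq₀ h1]; field_simp; ring
  | e_f_ne i j h =>
    simp only [map_mul, map_sub, map_zero, FreeAlgebra.lift_ι_apply, genE, genF]
    fin_cases i <;> fin_cases j <;> (first | exact absurd rfl h | skip) <;>
      (ext a b; fin_cases a <;> fin_cases b <;> simp [repGen])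
  | serre_e i j h =>
    simp only [map_serre, map_zero, FreeAlgebra.lift_ι_apply, genE]
    fin_cases i <;> fin_cases j <;> (first | exact absurd rfl h | skip)
    · exact serre_zero_of_sq _ (by ext a b; fin_cases a <;> fin_cases b <;> simp [repGen, pow_two])
        (by ext a b; fin_cases a <;> fin_cases b <;> simp [repGen])
    · exact serre_zero_of_cube _ (by ext a b; fin_cases a <;> fin_cases b <;> simp [repGen, pow_succ])
  | serre_f i j h =>
    simp only [map_serre, map_zero, FreeAlgebra.lift_ι_apply, genF]
    fin_cases i <;> fin_cases j <;> (first | exact absurd rfl h | skip)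
    · exact serre_zero_of_sq _ (by ext a b; fin_cases a <;> fin_cases b <;> simp [repGen, pow_two])
        (by ext a b; fin_cases a <;> fin_cases b <;> simp [repGen])
    · exact serre_zero_of_cube _ (by ext a b; fin_cases a <;> fin_cases b <;> simp [repGen, pow_succ])

/-- The 3-dimensional representation `π_u` of `U_q(a_2^{(2)})`. -/
def fundRep {q s₀ s₁ u : ℂ} (hq0 : q ≠ 0) (hq : ∀ n : ℕ, 0 < n → q ^ n ≠ 1)
    (hs₀ : s₀ ≠ 0) (hs₁ : s₁ ≠ 0) (hu : u ≠ 0) : Uq q →ₐ[ℂ] Matrix (Fin 3) (Fin 3) ℂ :=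
  RingQuot.liftAlgHom ℂ ⟨FreeAlgebra.lift ℂ (repGen q s₀ s₁ u), repGen_rel hq0 hq hs₀ hs₁ hu⟩

theorem fundRep_gen {q s₀ s₁ u : ℂ} (hq0 : q ≠ 0) (hq : ∀ n : ℕ, 0 < n → q ^ n ≠ 1)
    (hs₀ : s₀ ≠ 0) (hs₁ : s₁ ≠ 0) (hu : u ≠ 0) (g : UqGen) :
    fundRep hq0 hq hs₀ hs₁ hu (Uq.gen g) = repGen q s₀ s₁ u g :=
  (RingQuot.liftAlgHom_mkAlgHom_apply _ _ _ _).trans (FreeAlgebra.lift_ι_apply _ _)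

/-! ## The generalized `q`-Onsager algebra `O_q(a_2^{(2)})` -/

/-- The constant `w` of the second relation. -/
def onsagerW (q : ℂ) : ℂ :=
  (q ^ 2 - 1 + q ^ (-2 : ℤ)) * (q ^ 4 + 2 * q ^ 2 + 4 + 2 * q ^ (-2 : ℤ) + q ^ (-4 : ℤ))
    / (q ^ 4 + 3 + q ^ (-4 : ℤ))

/-- The element whose commutator with `A₁` vanishes by the second relation of
`O_q(a_2^{(2)})`. -/
def onsagerX {A : Type*} [Ring A] [Algebra ℂ A] (q ρ' ρt : ℂ) (A₀ A₁ : A) : A :=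
  qbr (q ^ (-2 : ℤ)) A₁ (qbr (q ^ 2) A₁ (qbr (q ^ (-4 : ℤ)) A₁ (qbr (q ^ 4) A₁ A₀)))
    - ρ' • (A₁ * A₁ * A₀ - onsagerW q • (A₁ * A₀ * A₁) + A₀ * A₁ * A₁) - ρt • A₀

/-- Defining relations of `O_q(a_2^{(2)})` with parameters `ρ, ρ', ρt`. -/
inductive OqRel (q ρ ρ' ρt : ℂ) : FreeAlgebra ℂ (Fin 2) → FreeAlgebra ℂ (Fin 2) → Prop
  | rel0 : OqRel q ρ ρ' ρt
      (qbr (q ^ (-4 : ℤ)) (FreeAlgebra.ι ℂ 0)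
        (qbr (q ^ 4) (FreeAlgebra.ι ℂ 0) (FreeAlgebra.ι ℂ 1)) - ρ • FreeAlgebra.ι ℂ 1) 0
  | rel1 : OqRel q ρ ρ' ρt
      (FreeAlgebra.ι ℂ 1 * onsagerX q ρ' ρt (FreeAlgebra.ι ℂ 0) (FreeAlgebra.ι ℂ 1)
        - onsagerX q ρ' ρt (FreeAlgebra.ι ℂ 0) (FreeAlgebra.ι ℂ 1) * FreeAlgebra.ι ℂ 1) 0

/-- `ρ' = (q + q⁻¹)² (q⁴ + 3 + q⁻⁴) c₁ c₁'`. -/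
def rhoBar (q c₁ c₁' : ℂ) : ℂ :=
  (q + q⁻¹) ^ 2 * (q ^ 4 + 3 + q ^ (-4 : ℤ)) * (c₁ * c₁')

/-- `ρt = -((q² + q⁻²) ρ' / (q⁴ + 3 + q⁻⁴))²`. -/
def rhoTilde (q c₁ c₁' : ℂ) : ℂ :=
  -((q ^ 2 + q ^ (-2 : ℤ)) * rhoBar q c₁ c₁' / (q ^ 4 + 3 + q ^ (-4 : ℤ))) ^ 2

/-- The generalized `q`-Onsager algebra `O_q(a_2^{(2)})` attached to
`c₀, c₀', c₁, c₁'` (where `c_i'` stands for `c̄_i`). -/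
def Oq (q c₀ c₀' c₁ c₁' : ℂ) : Type :=
  RingQuot (OqRel q (c₀ * c₀') (rhoBar q c₁ c₁') (rhoTilde q c₁ c₁'))

instance (q c₀ c₀' c₁ c₁' : ℂ) : Ring (Oq q c₀ c₀' c₁ c₁') :=
  inferInstanceAs (Ring (RingQuot (OqRel q (c₀ * c₀') (rhoBar q c₁ c₁') (rhoTilde q c₁ c₁'))))

instance (q c₀ c₀' c₁ c₁' : ℂ) : Algebra ℂ (Oq q c₀ c₀' c₁ c₁') :=
  inferInstanceAs
    (Algebra ℂ (RingQuot (OqRel q (c₀ * c₀') (rhoBar q c₁ c₁') (rhoTilde q c₁ c₁'))))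

/-- The generators `A₀, A₁` of `O_q(a_2^{(2)})`. -/
def Oq.gen {q c₀ c₀' c₁ c₁' : ℂ} (i : Fin 2) : Oq q c₀ c₀' c₁ c₁' :=
  RingQuot.mkAlgHom ℂ _ (FreeAlgebra.ι ℂ i)

/-- The parameter `μ'` of the Askey-Wilson algebra, determined by
`ρ' = (q⁴ + 3 + q⁻⁴) μ' / (q² + q⁻²)²`. -/
def muBar (q c₁ c₁' : ℂ) : ℂ :=
  (q + q⁻¹) ^ 2 * (q ^ 2 + q ^ (-2 : ℤ)) ^ 2 * (c₁ * c₁')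

theorem map_onsagerX {A B : Type*} [Ring A] [Algebra ℂ A] [Ring B] [Algebra ℂ B]
    (g : A →ₐ[ℂ] B) (q ρ' ρt : ℂ) (X Y : A) :
    g (onsagerX q ρ' ρt X Y) = onsagerX q ρ' ρt (g X) (g Y) := by
  simp [onsagerX, map_qbr]

theorem onsager_rel0 {A : Type*} [Ring A] [Algebra ℂ A] {q ρ : ℂ} (hq0 : q ≠ 0) {X Y Z : A}
    (h1 : qbr (q ^ 4) X Y = Z) (h2 : qbr (q ^ 4) Z X = -(q ^ (-4 : ℤ) * ρ) • Y) :
    qbr (q ^ (-4 : ℤ)) X (qbr (q ^ 4) X Y) - ρ • Y = 0 := by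
  have h3 : qbr (q ^ (-4 : ℤ)) X Z = (-(q ^ 4)) • qbr (q ^ 4) Z X := by
    have : (q ^ (-4 : ℤ))⁻¹ = q ^ 4 := by rw [← zpow_neg]; norm_cast
    simp only [qbr, this, smul_sub, smul_smul, neg_mul, neg_smul]
    rw [mul_inv_cancel₀ (pow_ne_zero _ hq0)]
    simp only [one_smul]; abel
  have h4 : -(q ^ 4) * -(q ^ (-4 : ℤ) * ρ) = ρ := by
    have : q ^ (-4 : ℤ) = (q ^ 4)⁻¹ := by rw [zpow_neg]; norm_cast
    rw [this]; field_simp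
  rw [h1, h3, h2, smul_smul, h4, sub_self]

theorem onsager_rel1 {A : Type*} [Ring A] [Algebra ℂ A] {q m C : ℂ} (hq0 : q ≠ 0)
    (hq3 : q ^ 4 + 3 + q ^ (-4 : ℤ) ≠ 0) (n : ℂ) (hm : m = (q ^ 2 + q ^ (-2 : ℤ)) ^ 2 * n)
    {X Y Z : A} (h1 : qbr (q ^ 4) X Y = Z)
    (h2 : qbr (q ^ 4) Y Z = -(q ^ (-4 : ℤ) * m) • X + C • 1) :
    Y * onsagerX q ((q ^ 4 + 3 + q ^ (-4 : ℤ)) * n) (-((q ^ 2 + q ^ (-2 : ℤ)) * n) ^ 2) X Y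
      - onsagerX q ((q ^ 4 + 3 + q ^ (-4 : ℤ)) * n) (-((q ^ 2 + q ^ (-2 : ℤ)) * n) ^ 2) X Y * Y
      = 0 := by
  have hz : ∀ k : ℕ, q ^ (-(k : ℤ)) = (q ^ k)⁻¹ := fun k => by rw [zpow_neg]; norm_cast
  have z4 : q ^ (-4 : ℤ) = (q ^ 4)⁻¹ := hz 4
  have z2 : q ^ (-2 : ℤ) = (q ^ 2)⁻¹ := hz 2
  have i4 : (q ^ (-4 : ℤ))⁻¹ = q ^ 4 := by rw [z4, inv_inv]
  have i2 : (q ^ (-2 : ℤ))⁻¹ = q ^ 2 := by rw [z2, inv_inv]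
  have key : Y * (Y * X) = (q ^ 4 + (q ^ 4)⁻¹) • (Y * (X * Y)) - X * (Y * Y)
      + m • X - (q ^ 4 * C) • 1 := by
    rw [← h1] at h2
    simp only [qbr, z4, mul_sub, sub_mul, smul_sub, smul_smul, mul_smul_comm,
      smul_mul_assoc, mul_assoc] at h2
    linear_combination (norm := skip) (-(q ^ 4)) • h2
    match_scalars <;> field_simp <;> ring
  have hF : qbr (q ^ (-4 : ℤ)) Y (qbr (q ^ 4) Y X) = m • X - (q ^ 4 * C) • 1 := by
    simp only [qbr, i4, mul_sub, sub_mul, mul_smul_comm, smul_mul_assoc, mul_assoc, key]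
    match_scalars <;> field_simp <;> ring
  have hX : onsagerX q ((q ^ 4 + 3 + q ^ (-4 : ℤ)) * n) (-((q ^ 2 + q ^ (-2 : ℤ)) * n) ^ 2) X Y
      = (-(q ^ 4 * C * (2 - q ^ 2 - (q ^ 2)⁻¹))) • (Y * Y) + (q ^ 4 * C * n) • 1 := by
    rw [onsagerX, hF]
    simp only [qbr, i2, mul_sub, sub_mul, mul_smul_comm, smul_mul_assoc, mul_assoc, key, mul_one,
      one_mul, hm]
    have hw : (q ^ 4 + 3 + q ^ (-4 : ℤ)) * onsagerW q = (q ^ 2 - 1 + q ^ (-2 : ℤ)) *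
        (q ^ 4 + 2 * q ^ 2 + 4 + 2 * q ^ (-2 : ℤ) + q ^ (-4 : ℤ)) := mul_div_cancel₀ _ hq3
    generalize onsagerW q = w at hw ⊢
    simp only [z4, z2] at hw ⊢
    match_scalars
    · field_simp at hw ⊢
      linear_combination n * q ^ 2 * hw
    all_goals field_simp
    all_goals ring
  rw [hX]
  simp only [mul_add, add_mul, mul_smul_comm, smul_mul_assoc, mul_assoc, mul_one, one_mul, sub_self]

theorem evalHom_rel {q c₀ c₀' c₁ c₁' : ℂ} (C : ℂ) (hq0 : q ≠ 0)
    (hq3 : q ^ 4 + 3 + q ^ (-4 : ℤ) ≠ 0) ⦃x y : FreeAlgebra ℂ (Fin 2)⦄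
    (h : OqRel q (c₀ * c₀') (rhoBar q c₁ c₁') (rhoTilde q c₁ c₁') x y) :
    FreeAlgebra.lift ℂ (![AW.W 0, AW.W 1] : Fin 2 → AWA22 q (c₀ * c₀') (muBar q c₁ c₁') C) x
      = FreeAlgebra.lift ℂ (![AW.W 0, AW.W 1] : Fin 2 → AWA22 q _ _ C) y := by
  cases h with
  | rel0 =>
    simp only [map_sub, map_smul, map_zero, map_qbr, FreeAlgebra.lift_ι_apply]
    refine onsager_rel0 (Z := AW.W 2) hq0 ?_ ?_
    · exact AW.rel01.trans (one_smul _ _)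
    · exact AW.rel20.trans (by simp)
  | rel1 =>
    simp only [map_sub, map_mul, map_onsagerX, map_zero, FreeAlgebra.lift_ι_apply]
    have hb : rhoBar q c₁ c₁' = (q ^ 4 + 3 + q ^ (-4 : ℤ)) * ((q + q⁻¹) ^ 2 * (c₁ * c₁')) := by
      rw [rhoBar]; ring
    have ht : rhoTilde q c₁ c₁'
        = -((q ^ 2 + q ^ (-2 : ℤ)) * ((q + q⁻¹) ^ 2 * (c₁ * c₁'))) ^ 2 := by
      rw [rhoTilde, hb]
      rw [mul_left_comm, mul_div_cancel_left₀ _ hq3]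
    rw [hb, ht]
    refine onsager_rel1 (m := muBar q c₁ c₁') (C := C) (Z := AW.W 2) hq0 hq3 _ ?_ ?_ ?_
    · rw [muBar]; ring
    · exact AW.rel01.trans (one_smul _ _)
    · exact AW.rel12.trans (by simp)

/-- The evaluation homomorphism `Π`, `A_i ↦ W_i`. -/
def evalHom {q c₀ c₀' c₁ c₁' : ℂ} (C : ℂ) (hq0 : q ≠ 0)
    (hq3 : q ^ 4 + 3 + q ^ (-4 : ℤ) ≠ 0) :
    Oq q c₀ c₀' c₁ c₁' →ₐ[ℂ] AWA22 q (c₀ * c₀') (muBar q c₁ c₁') C :=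
  RingQuot.liftAlgHom ℂ
    ⟨FreeAlgebra.lift ℂ (![AW.W 0, AW.W 1] : Fin 2 → AWA22 q (c₀ * c₀') (muBar q c₁ c₁') C),
      evalHom_rel C hq0 hq3⟩

theorem evalHom_gen {q c₀ c₀' c₁ c₁' : ℂ} (C : ℂ) (hq0 : q ≠ 0)
    (hq3 : q ^ 4 + 3 + q ^ (-4 : ℤ) ≠ 0) (i : Fin 2) :
    evalHom (c₀ := c₀) (c₀' := c₀') (c₁ := c₁) (c₁' := c₁') C hq0 hq3 (Oq.gen i)
      = ![AW.W 0, AW.W 1] i :=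
  (RingQuot.liftAlgHom_mkAlgHom_apply _ _ _ _).trans (FreeAlgebra.lift_ι_apply _ _)

/-- The coaction `δ(A_i) = (c_i e_i q_i^{h_i/2} + c_i' f_i q_i^{h_i/2}) ⊗ 1 + q_i^{h_i} ⊗ A_i`,
extended multiplicatively to all noncommutative polynomials in `A₀, A₁`. -/
def coaction (q c₀ c₀' c₁ c₁' : ℂ) :
    FreeAlgebra ℂ (Fin 2) →ₐ[ℂ] Uq q ⊗[ℂ] Oq q c₀ c₀' c₁ c₁' :=
  FreeAlgebra.lift ℂ fun i =>
    ((![c₀, c₁] i) • (Uq.gen (.e i) * Uq.gen (.k i))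
      + (![c₀', c₁'] i) • (Uq.gen (.f i) * Uq.gen (.k i))) ⊗ₜ[ℂ] 1
    + (Uq.gen (.k i) ^ 2) ⊗ₜ[ℂ] Oq.gen i

theorem tensorRep_commute {U O B : Type*} [Ring U] [Algebra ℂ U] [Ring O] [Algebra ℂ O] [Ring B]
    [Algebra ℂ B] (π : U →ₐ[ℂ] Matrix (Fin 3) (Fin 3) ℂ) (Φ : O →ₐ[ℂ] B) (x : U) (y : O) :
    Commute (((Algebra.ofId ℂ B).mapMatrix.comp π) x)
      (((Matrix.scalarAlgHom (Fin 3) ℂ).comp Φ) y) := by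
  ext i j
  simp [Matrix.scalarAlgHom, Matrix.mul_diagonal, Algebra.ofId_apply, Algebra.commutes]

/-- The homomorphism `π ⊗ Φ : U ⊗ O → Mat₃(ℂ) ⊗ B = Mat₃(B)`, `x ⊗ y ↦ π(x) Φ(y)`. -/
def tensorRep {U O B : Type*} [Ring U] [Algebra ℂ U] [Ring O] [Algebra ℂ O] [Ring B]
    [Algebra ℂ B] (π : U →ₐ[ℂ] Matrix (Fin 3) (Fin 3) ℂ) (Φ : O →ₐ[ℂ] B) :
    U ⊗[ℂ] O →ₐ[ℂ] Matrix (Fin 3) (Fin 3) B :=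
  Algebra.TensorProduct.lift ((Algebra.ofId ℂ B).mapMatrix.comp π)
    ((Matrix.scalarAlgHom (Fin 3) ℂ).comp Φ) (tensorRep_commute π Φ)

theorem tensorRep_tmul {U O B : Type*} [Ring U] [Algebra ℂ U] [Ring O] [Algebra ℂ O] [Ring B]
    [Algebra ℂ B] (π : U →ₐ[ℂ] Matrix (Fin 3) (Fin 3) ℂ) (Φ : O →ₐ[ℂ] B) (x : U) (y : O)
    (i j : Fin 3) : tensorRep π Φ (x ⊗ₜ[ℂ] y) i j = (π x i j) • Φ y := by
  simp [tensorRep, Matrix.scalarAlgHom, Matrix.mul_diagonal, Algebra.ofId_apply,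
    Algebra.smul_def]

/-! ## The dynamical `K`-matrix -/

section KMatrix

variable (q r α β μ μ' C u : ℂ)

/-- The coefficient `h(u, C)`. -/
def hOff : ℂ :=
  α * q ^ 4 * (q ^ 3 * u - q ^ (-3 : ℤ) * u⁻¹) / (β * (q + q⁻¹) * (q ^ 4 - q ^ (-4 : ℤ)))
    - β * C

/-- The term of `h₁`, `h₂`, `h₃` that contains the Casimir element. -/
def hCas : AWA22 q μ μ' C :=
  (β * (q ^ 4 - q ^ (-4 : ℤ)) / (α * (u - u⁻¹))) • casQ q μ μ' C

def h₁ : AWA22 q μ μ' C :=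
  hCas q α β μ μ' C u + algebraMap ℂ _
    (u * β * C * (q - q⁻¹) * (q ^ 2 + q ^ (-2 : ℤ)) / (u - u⁻¹)
      + q ^ 4 * u * α * (q ^ 3 * u - q ^ (-3 : ℤ) * u⁻¹)
        / (β * (u - u⁻¹) * (q + q⁻¹) ^ 2 * (q ^ 2 + q ^ (-2 : ℤ))))

def h₂ : AWA22 q μ μ' C :=
  hCas q α β μ μ' C u + algebraMap ℂ _
    (β * C * (u * q - u⁻¹ * q⁻¹) * (q ^ 2 + q ^ (-2 : ℤ)) / (u - u⁻¹)
      + q ^ 4 * α * (q * u - q⁻¹ * u⁻¹) * (q ^ 3 * u - q ^ (-3 : ℤ) * u⁻¹)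
        / (β * (u - u⁻¹) * (q + q⁻¹) * (q ^ 4 - q ^ (-4 : ℤ))))

def h₃ : AWA22 q μ μ' C :=
  hCas q α β μ μ' C u + algebraMap ℂ _
    (β * C * (q - q⁻¹) * (q ^ 2 + q ^ (-2 : ℤ)) / (u * (u - u⁻¹))
      + q ^ 4 * α * (q ^ 3 * u - q ^ (-3 : ℤ) * u⁻¹)
        / (u * β * (u - u⁻¹) * (q + q⁻¹) ^ 2 * (q ^ 2 + q ^ (-2 : ℤ))))

/-- The matrix `K⁽¹⁾(u)`. -/
def kOne : Matrix (Fin 3) (Fin 3) (AWA22 q μ μ' C) :=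
  !![h₁ q α β μ μ' C u, 0, algebraMap ℂ _ (hOff q α β C u);
     0, h₂ q α β μ μ' C u, 0;
     algebraMap ℂ _ (hOff q α β C u), 0, h₃ q α β μ μ' C u]

/-- The matrix `K⁽²⁾(u)`; here `r = q^{1/2}` and `g = q⁴ - q⁻⁴`. -/
def kTwo : Matrix (Fin 3) (Fin 3) (AWA22 q μ μ' C) :=
  let W₀ : AWA22 q μ μ' C := AW.W 0
  let W₁ : AWA22 q μ μ' C := AW.W 1
  let g : ℂ := q ^ 4 - q ^ (-4 : ℤ)
  !![(α * β * g * u) • W₁ ^ 2 + (q / (β * (q + q⁻¹))) • W₀,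
     r ^ (-7 : ℤ) • qbr (q ^ (-4 : ℤ)) W₁ W₀ + (r ^ 7 * α * u) • W₁,
     β • qbr (q ^ 4) (qbr (q ^ 4) W₀ W₁) W₁;
     r ^ (-7 : ℤ) • qbr (q ^ (-4 : ℤ)) W₀ W₁ + (r ^ 7 * α * u) • W₁,
     -((q ^ 4 / β) • W₀),
     r ^ 7 • qbr (q ^ 4) W₀ W₁ + (r ^ (-7 : ℤ) * α * u⁻¹) • W₁;
     β • qbr (q ^ 4) W₁ (qbr (q ^ 4) W₁ W₀),
     r ^ 7 • qbr (q ^ 4) W₁ W₀ + (r ^ (-7 : ℤ) * α * u⁻¹) • W₁,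
     -((α * β * (g / (q ^ 8 * u))) • W₁ ^ 2) + (q ^ 7 / (β * (q + q⁻¹))) • W₀]

/-- The dynamical `K`-matrix `K(u) = K⁽¹⁾(u) + K⁽²⁾(u)`. -/
def kMatrix : Matrix (Fin 3) (Fin 3) (AWA22 q μ μ' C) :=
  kOne q α β μ μ' C u + kTwo q r α β μ μ' C u

/-- The span of the monomials `W₀^{i₀} W₁^{i₁} W₂^{i₂}` of degree below `4`. -/
def lowDegree : Submodule ℂ (AWA22 q μ μ' C) :=
  Submodule.span ℂ {x | ∃ i₀ i₁ i₂ : ℕ, i₀ + i₁ + i₂ < 4 ∧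
    x = AW.W 0 ^ i₀ * AW.W 1 ^ i₁ * AW.W 2 ^ i₂}

/-- The combinations of the monomials `W₀^{i₀} W₁^{i₁} W₂^{i₂}` of degree below `4` with
coefficients that are polynomials in the Casimir element `Q`. -/
def lowDegreeQ : Submodule ℂ (AWA22 q μ μ' C) :=
  Submodule.span ℂ {x | ∃ n i₀ i₁ i₂ : ℕ, i₀ + i₁ + i₂ < 4 ∧
    x = casQ q μ μ' C ^ n * (AW.W 0 ^ i₀ * AW.W 1 ^ i₁ * AW.W 2 ^ i₂)}

end KMatrix

/-! ## The Izergin-Korepin `R`-matrix and the reflection equation -/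

/-- The spin-one `R`-matrix `R^{(x)}` of `U_x(a_1)`; the basis vectors of `ℂ³ ⊗ ℂ³` are in
lexicographic order. -/
def spinOneR (x : ℂ) : Matrix (Fin 3 × Fin 3) (Fin 3 × Fin 3) ℂ :=
  let t : ℂ := x ^ 2 - x ^ (-2 : ℤ)
  (!![x ^ 2, 0, 0, 0, 0, 0, 0, 0, 0;
      0, 1, 0, t, 0, 0, 0, 0, 0;
      0, 0, x ^ (-2 : ℤ), 0, x⁻¹ * t, 0, x⁻¹ * t * (x - x⁻¹), 0, 0;
      0, 0, 0, 1, 0, 0, 0, 0, 0;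
      0, 0, 0, 0, 1, 0, x⁻¹ * t, 0, 0;
      0, 0, 0, 0, 0, 1, 0, t, 0;
      0, 0, 0, 0, 0, 0, x ^ (-2 : ℤ), 0, 0;
      0, 0, 0, 0, 0, 0, 0, 1, 0;
      0, 0, 0, 0, 0, 0, 0, 0, x ^ 2] : Matrix (Fin 9) (Fin 9) ℂ).submatrix
    finProdFinEquiv finProdFinEquiv

/-- `R₂₁ = P R₁₂ P`, with `P` the permutation of the two tensor factors. -/
def flip (R : Matrix (Fin 3 × Fin 3) (Fin 3 × Fin 3) ℂ) :
    Matrix (Fin 3 × Fin 3) (Fin 3 × Fin 3) ℂ :=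
  R.submatrix Prod.swap Prod.swap

/-- The permutation matrix `P`, `P (v ⊗ w) = w ⊗ v`. -/
def permP : Matrix (Fin 3 × Fin 3) (Fin 3 × Fin 3) ℂ :=
  (1 : Matrix (Fin 3 × Fin 3) (Fin 3 × Fin 3) ℂ).submatrix Prod.swap id

/-- The Izergin-Korepin `R`-matrix `R₁₂(u)`. -/
def ikR (q u : ℂ) : Matrix (Fin 3 × Fin 3) (Fin 3 × Fin 3) ℂ :=
  ((u - 1) * q ^ 3) • flip (spinOneR q) + ((1 - u⁻¹) * q ^ (-3 : ℤ)) • spinOneR q⁻¹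
    + (q ^ (-5 : ℤ) * (q ^ 4 - 1) * (q ^ 6 + 1)) • permP

/-- `R'₁₂(u) = R₂₁(u)`, with entries viewed in a `ℂ`-algebra `B`. -/
def ikR'₁₂ (B : Type*) [Ring B] [Algebra ℂ B] (q u : ℂ) :
    Matrix (Fin 3 × Fin 3) (Fin 3 × Fin 3) B :=
  (flip (ikR q u)).map (algebraMap ℂ B)

/-- `R'₂₁(u) = R₁₂(u)`, with entries viewed in a `ℂ`-algebra `B`. -/
def ikR'₂₁ (B : Type*) [Ring B] [Algebra ℂ B] (q u : ℂ) :
    Matrix (Fin 3 × Fin 3) (Fin 3 × Fin 3) B :=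
  (flip (flip (ikR q u))).map (algebraMap ℂ B)

/-- `K₁ = K ⊗ 1`. -/
def inFirst {B : Type*} [Ring B] (K : Matrix (Fin 3) (Fin 3) B) :
    Matrix (Fin 3 × Fin 3) (Fin 3 × Fin 3) B := K ⊗ₖ (1 : Matrix (Fin 3) (Fin 3) B)

/-- `K₂ = 1 ⊗ K`. -/
def inSecond {B : Type*} [Ring B] (K : Matrix (Fin 3) (Fin 3) B) :
    Matrix (Fin 3 × Fin 3) (Fin 3 × Fin 3) B := (1 : Matrix (Fin 3) (Fin 3) B) ⊗ₖ K

end DynK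

end

/-! ### Rescaled Askey-Wilson relations and centrality of the Casimir element. -/

noncomputable section

namespace DynK

/-! Rescale `W₀, W₁, W₂` to `x, y, z` so that the structure constants become polynomials in `q` and
one parameter `κ`, and rescale `Q` to the element `T = casT`. The equation `(*)` for all
noncommutative polynomials then amounts to two matrix equations, one for each generator `A_i`, with
matrices `onsM0` and `onsM1`. That `K(u)` solves them and has entries of low degree are finite
computations (`kHat_mul_onsM1`, `kFull_mul_onsM0`, `kFull_mem_span`): the relations reorder words
and the cyclic forms of `T` remove the cubic words `xyz`, `yzx`, `zxy`.

Uniqueness rests on symbols. Give `x` and `T` degree 0, and `y` and `z` degree 1. Since `T`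
expresses `z²` through other words, the part of degree `N > 0` is spanned, modulo lower degree, by
`y ^ N` and `z * y ^ (N - 1)` with coefficients that are polynomials in `T` and `x`. The algebra
acts on functions from `ℤ` to polynomials in one variable: `x` is diagonal with eigenvalues `E m`,
`y` and `z` shift by one in both directions, and `T` is multiplication by the variable
(`normRel_rep`, `casT_rep`). The coefficient of the highest shift is the symbol, of the form `P(E m)
+ Q(E m) q⁻² V m`. It determines `P` and `Q` (`symPQ_eq_zero`), so the action is faithful and
nonzero polynomials in `T` are regular.

In an intertwiner of degree `N` the equation for `onsM1` forces the symbol of the entry `(i, j)` to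
be a constant times `(wt i / wt j) ^ m`. The odd powers `q ^ (±2m)` are not symbols. The equation
for `onsM0` then kills all symbols in positive degree unless `N = 2`, and for `N = 2` it kills them
as soon as one of the two outer diagonal symbols vanishes (`sym_eq_zero`). So, after subtraction of
a suitable `f(T) K(u)`, an intertwiner has degree at most one, hence is a scalar matrix, hence zero
because `u² ≠ 1` (`exists_eq_aeval_mul_kFull`). The same argument applied to `K(u) K(u⁻¹) - χ(T)`
shows that a single entry of this product has to be computed (`kFull_mul_kFull_inv`). That `f` is
constant when the entries are combinations of monomials of degree below 4 follows from a second
grading, in which the variable has weight 2 and the position `m` has weight `m`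
(`aeval_const_of_mem_span`).

For the reflection equation, let `E` be the difference of the two sides. Because `R` intertwines the
coaction with its opposite, `E` intertwines two tensor product representations
(`reflDiff_mul_tensL`). Hence the scalar vectors killed by `E` are stable under the scalar parts of
the action on weight vectors (`kerMat_step`), and for generic `u, v` the vector `v₃ ⊗ v₃` generates
everything (`eq_zero_of_col_eq_zero`). So one column suffices. Six of its entries are checked
directly (the `refl_col` identities) and the other three follow from unitarity of `R`. Finally `(u²
- 1) K(u)` is polynomial in `u`, which removes the genericity assumption (`reflDiff_kFull`). -/

/-- The defining relations of the algebra `AWA22` for suitably rescaled generators. -/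
structure NormRel {A : Type*} [Ring A] {F : Type*} [Field F] [Algebra F A] (q κ : F)
    (x y z : A) : Prop where
  yx : y * x = q ^ 4 • (x * y) - (q ^ 4 * (q ^ 8 - 1)) • z
  xz : x * z = q ^ 4 • (z * x) + (q ^ 4 * (q ^ 8 - 1)) • y
  zy : z * y = q ^ 4 • (y * z) + (q ^ 4 * (q ^ 8 - 1) * (q ^ 2 + 1)) • x
    - (q ^ 4 * (q ^ 8 - 1) * (q ^ 2 + 1) * κ) • 1

/-- The rescaled Casimir element. -/
def casT {A : Type*} [Ring A] {F : Type*} [Field F] [Algebra F A] (q κ : F) (x y z : A) : A :=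
  x * (y * z) + y * y - q ^ 8 • (z * z) + (q ^ 8 * (q ^ 2 + 1)) • (x * x)
    - ((q ^ 2 + 1) * (q ^ 4 + 1) * q ^ 4 * κ) • x

section
variable {A : Type*} [Ring A] {F : Type*} [Field F] [Algebra F A] {q κ : F} {x y z : A}

namespace NormRel

theorem yx_assoc (h : NormRel q κ x y z) (w : A) :
    y * (x * w) = q ^ 4 • (x * (y * w)) - (q ^ 4 * (q ^ 8 - 1)) • (z * w) := by
  rw [← mul_assoc, h.yx]; simp only [sub_mul, smul_mul_assoc, mul_assoc]

theorem xz_assoc (h : NormRel q κ x y z) (w : A) :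
    x * (z * w) = q ^ 4 • (z * (x * w)) + (q ^ 4 * (q ^ 8 - 1)) • (y * w) := by
  rw [← mul_assoc, h.xz]; simp only [add_mul, smul_mul_assoc, mul_assoc]

theorem zy_assoc (h : NormRel q κ x y z) (w : A) :
    z * (y * w) = q ^ 4 • (y * (z * w)) + (q ^ 4 * (q ^ 8 - 1) * (q ^ 2 + 1)) • (x * w)
      - (q ^ 4 * (q ^ 8 - 1) * (q ^ 2 + 1) * κ) • w := by
  rw [← mul_assoc, h.zy]
  simp only [sub_mul, add_mul, smul_mul_assoc, mul_assoc, one_mul]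

/-- The quadratic relations are oriented cyclically (`yx → xy`, `xz → zx`, `zy → yz`), so they leave
`xyz`, `yzx` and `zxy` untouched. This rule and its two rotations trade these words for the Casimir
element. -/
theorem x_mul_yz (q κ : F) (x y z : A) :
    x * (y * z) = casT q κ x y z - y * y + q ^ 8 • (z * z) - (q ^ 8 * (q ^ 2 + 1)) • (x * x)
      + ((q ^ 2 + 1) * (q ^ 4 + 1) * q ^ 4 * κ) • x := by
  rw [casT]; abel

theorem y_mul_zx (h : NormRel q κ x y z) (hq : q ≠ 0) :
    y * (z * x) = casT q κ x y z - q ^ 8 • (y * y) + z * z - (q ^ 8 * (q ^ 2 + 1)) • (x * x)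
      + ((q ^ 2 + 1) * (q ^ 4 + 1) * q ^ 4 * κ) • x := by
  -- After multiplication by `q ^ 4` the factor `z * x` can be turned back into `x * z`, which leads
  -- to the word `x * (y * z)`.
  have e : q ^ 4 • (z * x) = x * z - (q ^ 4 * (q ^ 8 - 1)) • y := by rw [h.xz]; abel
  refine smul_right_injective A (pow_ne_zero 4 hq) ?_
  have e' : q ^ 4 • (y * (z * x)) = y * (x * z) - (q ^ 4 * (q ^ 8 - 1)) • (y * y) := by
    rw [← mul_smul_comm, e, mul_sub, mul_smul_comm]
  beta_reduce
  rw [e', h.yx_assoc, x_mul_yz q κ]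
  match_scalars <;> ring

theorem z_mul_xy (h : NormRel q κ x y z) (hq : q ≠ 0) :
    z * (x * y) = casT q κ x y z - q ^ 8 • (y * y) + q ^ 8 • (z * z) - (q ^ 2 + 1) • (x * x)
      + ((q ^ 2 + 1) * (q ^ 4 + 1) * κ) • x := by
  have e : q ^ 4 • (z * x) = x * z - (q ^ 4 * (q ^ 8 - 1)) • y := by rw [h.xz]; abel
  refine smul_right_injective A (pow_ne_zero 4 hq) ?_
  have e' : q ^ 4 • (z * (x * y)) = x * (z * y) - (q ^ 4 * (q ^ 8 - 1)) • (y * y) := by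
    rw [← mul_assoc, ← smul_mul_assoc, e, sub_mul, smul_mul_assoc, mul_assoc]
  beta_reduce
  rw [e', h.zy]
  simp only [mul_add, mul_sub, mul_smul_comm, x_mul_yz q κ, mul_one]
  match_scalars <;> ring

/-- Choosing different cyclic forms of the Casimir element on the two sides makes both products
contain the same quartic word `xyzx`; what remains has lower degree and follows from the quadratic
relations. For `z` and `y` the common words are `zxyz` and `yzxy`. -/
theorem casT_mul_x (h : NormRel q κ x y z) (hq : q ≠ 0) :
    casT q κ x y z * x = x * casT q κ x y z := by
  have e := congrArg (x * ·) (h.y_mul_zx hq)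
  simp only [mul_add, mul_sub, mul_smul_comm] at e
  have e' : x * casT q κ x y z = x * (y * (z * x)) + q ^ 8 • (x * (y * y)) - x * (z * z)
      + (q ^ 8 * (q ^ 2 + 1)) • (x * (x * x))
      - ((q ^ 2 + 1) * (q ^ 4 + 1) * q ^ 4 * κ) • (x * x) := by
    rw [e]; match_scalars <;> ring
  rw [e', casT]
  simp only [mul_add, mul_sub, add_mul, sub_mul, smul_mul_assoc, mul_smul_comm, mul_assoc,
    h.yx, h.xz, h.zy, h.yx_assoc, h.xz_assoc, h.zy_assoc, mul_one]
  match_scalars <;> ring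

theorem casT_mul_z (h : NormRel q κ x y z) (hq : q ≠ 0) :
    casT q κ x y z * z = z * casT q κ x y z := by
  have e := congrArg (· * z) (h.z_mul_xy hq)
  simp only [add_mul, sub_mul, smul_mul_assoc, mul_assoc] at e
  have e' : casT q κ x y z * z = z * (x * (y * z)) + q ^ 8 • (y * (y * z))
      - q ^ 8 • (z * (z * z)) + (q ^ 2 + 1) • (x * (x * z))
      - ((q ^ 2 + 1) * (q ^ 4 + 1) * κ) • (x * z) := by
    rw [e]; match_scalars <;> ring
  rw [e', casT]
  simp only [mul_add, mul_sub, add_mul, sub_mul, smul_mul_assoc, mul_smul_comm, mul_assoc,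
    h.yx, h.xz, h.zy, h.yx_assoc, h.xz_assoc, h.zy_assoc, mul_one]
  match_scalars <;> ring

theorem casT_mul_y (h : NormRel q κ x y z) (hq : q ≠ 0) :
    casT q κ x y z * y = y * casT q κ x y z := by
  have e1 : casT q κ x y z * y = y * (z * (x * y)) + q ^ 8 • (y * (y * y)) - z * (z * y)
      + (q ^ 8 * (q ^ 2 + 1)) • (x * (x * y))
      - ((q ^ 2 + 1) * (q ^ 4 + 1) * q ^ 4 * κ) • (x * y) := by
    have e := congrArg (· * y) (h.y_mul_zx hq)
    simp only [add_mul, sub_mul, smul_mul_assoc, mul_assoc] at e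
    rw [e]; match_scalars <;> ring
  have e2 : y * casT q κ x y z = y * (z * (x * y)) + q ^ 8 • (y * (y * y))
      - q ^ 8 • (y * (z * z)) + (q ^ 2 + 1) • (y * (x * x))
      - ((q ^ 2 + 1) * (q ^ 4 + 1) * κ) • (y * x) := by
    have e := congrArg (y * ·) (h.z_mul_xy hq)
    simp only [mul_add, mul_sub, mul_smul_comm] at e
    rw [e]; match_scalars <;> ring
  rw [e1, e2]
  simp only [mul_add, mul_sub, add_mul, sub_mul, smul_mul_assoc, mul_smul_comm, mul_assoc,
    h.yx, h.xz, h.zy, h.yx_assoc, h.xz_assoc, h.zy_assoc, mul_one]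
  match_scalars <;> ring

theorem x_mul_casT_mul (h : NormRel q κ x y z) (hq : q ≠ 0) (w : A) :
    x * (casT q κ x y z * w) = casT q κ x y z * (x * w) := by
  rw [← mul_assoc, ← mul_assoc, h.casT_mul_x hq]

theorem y_mul_casT_mul (h : NormRel q κ x y z) (hq : q ≠ 0) (w : A) :
    y * (casT q κ x y z * w) = casT q κ x y z * (y * w) := by
  rw [← mul_assoc, ← mul_assoc, h.casT_mul_y hq]

theorem z_mul_casT_mul (h : NormRel q κ x y z) (hq : q ≠ 0) (w : A) :
    z * (casT q κ x y z * w) = casT q κ x y z * (z * w) := by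
  rw [← mul_assoc, ← mul_assoc, h.casT_mul_z hq]

end NormRel
end
end DynK

end

/-! ### The shape of the rescaled matrix `K(u)`. -/

noncomputable section

namespace DynK

/-- Coefficients of the entries of a matrix of the shape of the `K`-matrix. -/
structure KCoef (F : Type*) where
  (t₀ a₁ b₁ c₁ a₂ c₂ a₃ b₃ c₃ d₁ d₂ e₁ e₂ e₃ f₁ f₂ f₃ g₁ g₂ m₁ m₂ m₃ m₄ n₁ n₂ n₃ : F)

/-- The coefficients of the rescaled `K`-matrix, up to a central summand `α T + γ`. -/
def kCoef {F : Type*} [Field F] (q κ u α γ : F) : KCoef F where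
  t₀ := α
  a₁ := γ
  b₁ := q ^ 14 * u ^ 2
  c₁ := q ^ 13 * (q ^ 2 + 1) * u
  a₂ := γ + q ^ 13 * (q ^ 2 + 1) * ((q ^ 4 + 1) * κ * u + q ^ 11 * u ^ 2 - q ^ 5)
  c₂ := -(q ^ 15 * (q ^ 2 + 1) ^ 2 * u)
  a₃ := γ - q ^ 13 * (q ^ 4 - 1) * ((q ^ 4 + 1) * κ * u + q ^ 11 * u ^ 2 - q ^ 5)
  b₃ := -q ^ 6
  c₃ := q ^ 19 * (q ^ 2 + 1) * u
  d₁ := q ^ 19 * (q ^ 2 + 1) * u ^ 2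
  d₂ := -(q ^ 14 * (q ^ 2 + 1) * u)
  e₁ := q ^ 12 * u
  e₂ := q ^ 20 * (q ^ 2 + 1) * u
  e₃ := q ^ 16 * (q ^ 2 + 1) * (q ^ 9 * u ^ 2 - q ^ 3 - (q ^ 4 + 1) * κ * u)
  f₁ := q ^ 19 * (q ^ 2 + 1) * u ^ 2
  f₂ := q ^ 10 * (q ^ 2 + 1) * u
  f₃ := -(q ^ 6 * (q ^ 2 + 1) * u)
  g₁ := q ^ 17 * (q ^ 2 + 1) * u
  g₂ := q ^ 12 * (q ^ 2 + 1)
  m₁ := u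
  m₂ := -(q ^ 4 * u)
  m₃ := q ^ 12 * (q ^ 2 + 1) * u
  m₄ := (q ^ 2 + 1) * (q ^ 25 * u ^ 2 - q ^ 19 - q ^ 12 * (q ^ 4 + 1) * κ * u)
  n₁ := q ^ 9 * (q ^ 2 + 1) * u
  n₂ := -(q ^ 13 * (q ^ 2 + 1) * u)
  n₃ := q ^ 12 * (q ^ 2 + 1)

section
variable {F : Type*} [Field F] (q κ u α γ : F)

/-- These projections allow the coefficients to stay opaque while products in the algebra are
expanded; they are unfolded only in the resulting scalar identities. -/
theorem kCoef_t₀ : (kCoef q κ u α γ).t₀ = α := rfl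
theorem kCoef_a₁ : (kCoef q κ u α γ).a₁ = γ := rfl
theorem kCoef_b₁ : (kCoef q κ u α γ).b₁ = q ^ 14 * u ^ 2 := rfl
theorem kCoef_c₁ : (kCoef q κ u α γ).c₁ = q ^ 13 * (q ^ 2 + 1) * u := rfl
theorem kCoef_a₂ : (kCoef q κ u α γ).a₂ = γ + q ^ 13 * (q ^ 2 + 1) * ((q ^ 4 + 1) * κ * u + q ^ 11 * u ^ 2 - q ^ 5) := rfl
theorem kCoef_c₂ : (kCoef q κ u α γ).c₂ = -(q ^ 15 * (q ^ 2 + 1) ^ 2 * u) := rfl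
theorem kCoef_a₃ : (kCoef q κ u α γ).a₃ = γ - q ^ 13 * (q ^ 4 - 1) * ((q ^ 4 + 1) * κ * u + q ^ 11 * u ^ 2 - q ^ 5) := rfl
theorem kCoef_b₃ : (kCoef q κ u α γ).b₃ = -q ^ 6 := rfl
theorem kCoef_c₃ : (kCoef q κ u α γ).c₃ = q ^ 19 * (q ^ 2 + 1) * u := rfl
theorem kCoef_d₁ : (kCoef q κ u α γ).d₁ = q ^ 19 * (q ^ 2 + 1) * u ^ 2 := rfl
theorem kCoef_d₂ : (kCoef q κ u α γ).d₂ = -(q ^ 14 * (q ^ 2 + 1) * u) := rfl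
theorem kCoef_e₁ : (kCoef q κ u α γ).e₁ = q ^ 12 * u := rfl
theorem kCoef_e₂ : (kCoef q κ u α γ).e₂ = q ^ 20 * (q ^ 2 + 1) * u := rfl
theorem kCoef_e₃ : (kCoef q κ u α γ).e₃ = q ^ 16 * (q ^ 2 + 1) * (q ^ 9 * u ^ 2 - q ^ 3 - (q ^ 4 + 1) * κ * u) := rfl
theorem kCoef_f₁ : (kCoef q κ u α γ).f₁ = q ^ 19 * (q ^ 2 + 1) * u ^ 2 := rfl
theorem kCoef_f₂ : (kCoef q κ u α γ).f₂ = q ^ 10 * (q ^ 2 + 1) * u := rfl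
theorem kCoef_f₃ : (kCoef q κ u α γ).f₃ = -(q ^ 6 * (q ^ 2 + 1) * u) := rfl
theorem kCoef_g₁ : (kCoef q κ u α γ).g₁ = q ^ 17 * (q ^ 2 + 1) * u := rfl
theorem kCoef_g₂ : (kCoef q κ u α γ).g₂ = q ^ 12 * (q ^ 2 + 1) := rfl
theorem kCoef_m₁ : (kCoef q κ u α γ).m₁ = u := rfl
theorem kCoef_m₂ : (kCoef q κ u α γ).m₂ = -(q ^ 4 * u) := rfl
theorem kCoef_m₃ : (kCoef q κ u α γ).m₃ = q ^ 12 * (q ^ 2 + 1) * u := rfl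
theorem kCoef_m₄ : (kCoef q κ u α γ).m₄ = (q ^ 2 + 1) * (q ^ 25 * u ^ 2 - q ^ 19 - q ^ 12 * (q ^ 4 + 1) * κ * u) := rfl
theorem kCoef_n₁ : (kCoef q κ u α γ).n₁ = q ^ 9 * (q ^ 2 + 1) * u := rfl
theorem kCoef_n₂ : (kCoef q κ u α γ).n₂ = -(q ^ 13 * (q ^ 2 + 1) * u) := rfl
theorem kCoef_n₃ : (kCoef q κ u α γ).n₃ = q ^ 12 * (q ^ 2 + 1) := rfl

end

section
variable {A : Type*} [Ring A] {F : Type*} [Field F] [Algebra F A]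

/-- A matrix of the shape of the `K`-matrix. -/
def kShape (t : KCoef F) (T x y z : A) : Matrix (Fin 3) (Fin 3) A :=
  !![t.t₀ • T + t.a₁ • 1 + t.b₁ • (y * y) + t.c₁ • x,
     t.d₁ • y + t.d₂ • z,
     t.e₁ • (y * z) + t.e₂ • x + t.e₃ • 1;
     t.f₁ • y + t.f₂ • z + t.f₃ • (y * x),
     t.t₀ • T + t.a₂ • 1 + t.c₂ • x,
     t.g₁ • z + t.g₂ • y;
     t.m₁ • (y * (y * x)) + t.m₂ • (y * z) + t.m₃ • x + t.m₄ • 1,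
     t.n₁ • (y * x) + t.n₂ • z + t.n₃ • y,
     t.t₀ • T + t.a₃ • 1 + t.b₃ • (y * y) + t.c₃ • x]

/-- The rescaled `K`-matrix, up to a central summand `α T + γ`. -/
def kHat (q κ u α γ : F) (x y z : A) : Matrix (Fin 3) (Fin 3) A :=
  kShape (kCoef q κ u α γ) (casT q κ x y z) x y z

section
variable (t : KCoef F) (T x y z : A)

theorem kShape_00 : kShape t T x y z 0 0 =
    t.t₀ • T + t.a₁ • 1 + t.b₁ • (y * y) + t.c₁ • x := rfl
theorem kShape_01 : kShape t T x y z 0 1 =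
    t.d₁ • y + t.d₂ • z := rfl
theorem kShape_02 : kShape t T x y z 0 2 =
    t.e₁ • (y * z) + t.e₂ • x + t.e₃ • 1 := rfl
theorem kShape_10 : kShape t T x y z 1 0 =
    t.f₁ • y + t.f₂ • z + t.f₃ • (y * x) := rfl
theorem kShape_11 : kShape t T x y z 1 1 =
    t.t₀ • T + t.a₂ • 1 + t.c₂ • x := rfl
theorem kShape_12 : kShape t T x y z 1 2 =
    t.g₁ • z + t.g₂ • y := rfl
theorem kShape_20 : kShape t T x y z 2 0 =
    t.m₁ • (y * (y * x)) + t.m₂ • (y * z) + t.m₃ • x + t.m₄ • 1 := rfl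
theorem kShape_21 : kShape t T x y z 2 1 =
    t.n₁ • (y * x) + t.n₂ • z + t.n₃ • y := rfl
theorem kShape_22 : kShape t T x y z 2 2 =
    t.t₀ • T + t.a₃ • 1 + t.b₃ • (y * y) + t.c₃ • x := rfl

end

end
end DynK

end

/-! ### Upper half of the distinguished column of the reflection equation. -/

noncomputable section

namespace DynK

section
variable {F : Type*} [Field F]

/-! The distinct entries of the Izergin-Korepin matrix. -/

def rA (q a b : F) : F := (q ^ 6 * a + b) * (q ^ 4 * a - b)
def rB (q a b : F) : F := q ^ 2 * (q ^ 6 * a + b) * (a - b)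
def rG (q a b : F) : F := (q ^ 6 * a + b) * (q ^ 4 - 1)
def rD (q a b : F) : F := q ^ 4 * (q ^ 2 * a + b) * (a - b)
def rE (q a b : F) : F := q * (q ^ 4 - 1) * (a - b)
def rP (q a b : F) : F := (q ^ 4 - 1) * (q ^ 6 * a + q ^ 2 * a - q ^ 2 * b + b)
def rS (q a b : F) : F := (q ^ 4 - 1) * (q ^ 6 * a - q ^ 4 * a + q ^ 4 * b + b)
def rH (q a b : F) : F :=
  q ^ 8 * a ^ 2 + (q ^ 10 - q ^ 8 - q ^ 6 + q ^ 4 + q ^ 2 - 1) * a * b - q ^ 2 * b ^ 2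

/-- The Izergin-Korepin matrix `q ^ 5 * a * b * R₁₂(a / b)`: the `(i, j)` row as a matrix in the
column indices. -/
def rEnt (q a b : F) : Fin 3 → Fin 3 → Matrix (Fin 3) (Fin 3) F :=
  ![![!![rA q a b, 0, 0; 0, 0, 0; 0, 0, 0],
      !![0, rB q a b, 0; b * rG q a b, 0, 0; 0, 0, 0],
      !![0, 0, rD q a b; 0, -b * rE q a b, 0; b * rP q a b, 0, 0]],
    ![!![0, a * rG q a b, 0; rB q a b, 0, 0; 0, 0, 0],
      !![0, 0, q ^ 4 * a * rE q a b; 0, rH q a b, 0; -b * rE q a b, 0, 0],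
      !![0, 0, 0; 0, 0, rB q a b; 0, b * rG q a b, 0]],
    ![!![0, 0, a * rS q a b; 0, q ^ 4 * a * rE q a b, 0; rD q a b, 0, 0],
      !![0, 0, 0; 0, 0, a * rG q a b; 0, rB q a b, 0],
      !![0, 0, 0; 0, 0, 0; 0, 0, rA q a b]]]

/-- The constant that accompanies the Casimir element in the rescaled `K`-matrix. -/
def kG (q κ u : F) : F := q ^ 7 * (q ^ 4 - 1) * ((q ^ 4 + 1) * κ * u + q ^ 11 * u ^ 2 - q ^ 5)

/-! Coefficients of the multiples of `α * (u ^ 2 - 1) - q ^ 6 * u ^ 2` and of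
`β * (v ^ 2 - 1) - q ^ 6 * v ^ 2` in the reflection equation with free parameters `α`, `β`. -/

def corrU02YZ (q u v : F) : F :=
  q ^ 16 * v ^ 2 * (q ^ 6 * u ^ 2 * v * (q ^ 2 - 1) * (q ^ 4 - 1) + q ^ 2 * u * (q ^ 8 - 1) * (v ^ 2 + 1) - v * (q ^ 2 - 1) * (q ^ 4 - 1))
def corrU02X (q u v : F) : F :=
  q ^ 24 * v ^ 2 * (q ^ 6 * u ^ 2 * v * (q ^ 4 - 1) ^ 2 + q ^ 2 * u * (q ^ 2 + 1) * (q ^ 8 - 1) * (v ^ 2 + 1) - v * (q ^ 4 - 1) ^ 2)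
def corrU02O (q κ u v : F) : F :=
  q ^ 20 * v * (q ^ 15 * u ^ 2 * v ^ 3 * (q ^ 4 - 1) ^ 2 - q ^ 6 * u ^ 2 * v ^ 2 * κ * (q ^ 4 - 1) * (q ^ 8 - 1) - q ^ 9 * v * (q ^ 4 - 1) ^ 2 * (u ^ 2 + v ^ 2) + q ^ 11 * u * v ^ 4 * (q ^ 2 + 1) * (q ^ 8 - 1) - q ^ 2 * u * v * κ * (q ^ 2 + 1) * (q ^ 4 + 1) * (q ^ 8 - 1) * (v ^ 2 + 1) + q ^ 5 * u * v ^ 2 * (q ^ 4 + q ^ 2 + 1) * (q ^ 4 - 1) * (q ^ 8 - 1) - q ^ 5 * u * (q ^ 2 + 1) * (q ^ 8 - 1) + v ^ 2 * κ * (q ^ 4 - 1) * (q ^ 8 - 1) + q ^ 3 * v * (q ^ 4 - 1) ^ 2)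
def corrV02YZ (q u v : F) : F :=
  q ^ 16 * u ^ 2 * (-q ^ 6 * u ^ 2 * v * (q ^ 2 - 1) * (q ^ 4 - 1) - q ^ 2 * u * (q ^ 8 - 1) * (v ^ 2 + 1) + v * (q ^ 2 - 1) * (q ^ 4 - 1))
def corrV02X (q u v : F) : F :=
  q ^ 24 * u ^ 2 * (-q ^ 6 * u ^ 2 * v * (q ^ 4 - 1) ^ 2 - q ^ 2 * u * (q ^ 2 + 1) * (q ^ 8 - 1) * (v ^ 2 + 1) + v * (q ^ 4 - 1) ^ 2)
def corrV02O (q κ u v : F) : F :=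
  q ^ 20 * u * (-q ^ 15 * u ^ 4 * v * (q ^ 4 - 1) ^ 2 - q ^ 11 * u ^ 3 * (q ^ 2 + 1) * (q ^ 8 - 1) * (v ^ 2 + 1) + q ^ 6 * u ^ 3 * v * κ * (q ^ 4 - 1) * (q ^ 8 - 1) + q ^ 2 * u ^ 2 * κ * (q ^ 2 + 1) * (q ^ 4 + 1) * (q ^ 8 - 1) * (v ^ 2 + 1) + 2 * q ^ 9 * u ^ 2 * v * (q ^ 4 - 1) ^ 2 + q ^ 5 * u * (q ^ 2 + 1) * (q ^ 8 - 1) * (v ^ 2 + 1) - u * v * κ * (q ^ 4 - 1) * (q ^ 8 - 1) - q ^ 3 * v * (q ^ 4 - 1) ^ 2)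
def corrU11YZ (q u v : F) : F :=
  q ^ 13 * v ^ 2 * (q ^ 4 - 1) * (q ^ 10 * u * (u * v - v ^ 2 - 1) + v * (q ^ 6 - q ^ 4 + 1))
def corrU11X (q u v : F) : F :=
  q ^ 21 * v ^ 2 * (q ^ 2 + 1) * (q ^ 4 - 1) * (q ^ 10 * u * (u * v - v ^ 2 - 1) + v * (q ^ 6 - q ^ 4 + 1))
def corrU11O (q κ u v : F) : F :=
  q ^ 17 * v * (q ^ 19 * u * v ^ 3 * (q ^ 2 + 1) * (q ^ 4 - 1) * (u - v) - q ^ 10 * u * v * κ * (q ^ 2 + 1) * (q ^ 8 - 1) * (u * v - v ^ 2 - 1) - q ^ 13 * u * (q ^ 2 + 1) * (q ^ 4 - 1) * (u * v - 1) - q ^ 13 * u * v ^ 2 * (q ^ 4 + q ^ 2 + 1) * (q ^ 4 - 1) ^ 2 + q ^ 9 * v ^ 3 * (q ^ 2 + 1) * (q ^ 4 - 1) * (q ^ 6 - q ^ 4 + 1) - v ^ 2 * κ * (q ^ 2 + 1) * (q ^ 6 - q ^ 4 + 1) * (q ^ 8 - 1) - q ^ 3 * v * (q ^ 2 + 1)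 * (q ^ 4 - 1) * (q ^ 6 - q ^ 4 + 1))
def corrV11YZ (q u v : F) : F :=
  q ^ 13 * u ^ 2 * (q ^ 4 - 1) * (-q ^ 10 * u * (u * v - v ^ 2 - 1) - v * (q ^ 6 - q ^ 4 + 1))
def corrV11X (q u v : F) : F :=
  q ^ 21 * u ^ 2 * (q ^ 2 + 1) * (q ^ 4 - 1) * (-q ^ 10 * u * (u * v - v ^ 2 - 1) - v * (q ^ 6 - q ^ 4 + 1))
def corrV11O (q κ u v : F) : F :=
  q ^ 17 * u * (-q ^ 19 * u ^ 3 * (q ^ 2 + 1) * (q ^ 4 - 1) * (u * v - v ^ 2 - 1) + q ^ 10 * u ^ 2 * κ * (q ^ 2 + 1) * (q ^ 8 - 1) * (u * v - v ^ 2 - 1) - q ^ 9 * u ^ 2 * v * (q ^ 4 - 1) ^ 2 * (q ^ 4 - q ^ 2 - 1) - q ^ 13 * u * (q ^ 2 + 1) * (q ^ 4 - 1) * (v ^ 2 + 1) + u * v * κ * (q ^ 2 + 1) * (q ^ 6 - q ^ 4 + 1) * (q ^ 8 - 1) + q ^ 3 * v * (q ^ 2 + 1) * (q ^ 4 - 1)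 * (q ^ 6 - q ^ 4 + 1))
def corrU12Z (q u v : F) : F :=
  q ^ 19 * v ^ 2 * (q ^ 2 + 1) * (q ^ 4 - 1) * (q ^ 12 * u ^ 2 * v + q ^ 6 * u * (v ^ 2 + 1) + v)
def corrU12Y (q u v : F) : F :=
  q ^ 14 * v * (q ^ 2 + 1) * (q ^ 4 - 1) * (q ^ 12 * u ^ 2 * v + q ^ 6 * u * (v ^ 2 + 1) + v)
def corrV12Z (q u v : F) : F :=
  q ^ 19 * u ^ 2 * (q ^ 2 + 1) * (q ^ 4 - 1) * (-q ^ 12 * u ^ 2 * v - q ^ 6 * u * (v ^ 2 + 1) - v)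
def corrV12Y (q u v : F) : F :=
  q ^ 14 * u * (q ^ 2 + 1) * (q ^ 4 - 1) * (-q ^ 12 * u ^ 2 * v - q ^ 6 * u * (v ^ 2 + 1) - v)
end

section
variable {A : Type*} [Ring A] {F : Type*} [Field F] [Algebra F A] {q κ : F} {x y z : A}

namespace NormRel

set_option linter.unusedSimpArgs false

-- The `refl_col` identities are the entries `(i, j)` with `i ≤ j` of the column of `v₃ ⊗ v₃` in the
-- reflection equation. The central summands `α T + γ` and `β T + δ` are kept free, so that no
-- denominator `u ^ 2 - 1` occurs and all scalar identities are polynomial.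
set_option maxHeartbeats 4000000 in
set_option maxRecDepth 20000 in
theorem refl_col_00 (h : NormRel q κ x y z) (hq : q ≠ 0) (u v α β γ δ : F) :
    kHat q κ u α γ x y z 0 2 * (rD q (u * v) 1 • kHat q κ v β δ x y z 0 2)
    = kHat q κ v β δ x y z 0 2 * ((rD q (u * v) 1) • kHat q κ u α γ x y z 0 2) := by
  simp only [kHat, kShape_00, kShape_01, kShape_02, kShape_10, kShape_11, kShape_12, kShape_20, kShape_21, kShape_22]
  have t1 := h.casT_mul_x hq
  have t2 := h.casT_mul_y hq
  have t3 := h.casT_mul_z hq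
  have t4 := h.x_mul_casT_mul hq
  have t5 := h.y_mul_casT_mul hq
  have t6 := h.z_mul_casT_mul hq
  -- Fixing `A` in the distributive laws prevents the scalar coefficients from being expanded.
  simp only [@mul_add A _ _ _, @mul_sub A _, @add_mul A _ _ _, @sub_mul A _, smul_add, smul_sub,
    smul_mul_assoc, mul_smul_comm, smul_smul, mul_one, one_mul, @mul_assoc A _]
  -- Normal ordering: quadratic relations, cyclic forms of the Casimir element, and the Casimir
  -- element moved to the left. It is then generalized to an atom for the comparison of
  -- coefficients.
  simp only [@mul_add A _ _ _, @mul_sub A _, @add_mul A _ _ _, @sub_mul A _, smul_add, smul_sub,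
    smul_mul_assoc, mul_smul_comm, smul_smul, mul_one, one_mul, @mul_assoc A _, h.yx, h.xz, h.zy,
    h.yx_assoc, h.xz_assoc, h.zy_assoc, x_mul_yz q κ x y z, h.y_mul_zx hq, h.z_mul_xy hq,
    ← t1, ← t2, ← t3, t4, t5, t6]
  clear t1 t2 t3 t4 t5 t6
  generalize casT q κ x y z = T
  match_scalars <;> simp only [kCoef_t₀, kCoef_a₁, kCoef_b₁, kCoef_c₁, kCoef_a₂, kCoef_c₂, kCoef_a₃, kCoef_b₃, kCoef_c₃, kCoef_d₁, kCoef_d₂, kCoef_e₁, kCoef_e₂, kCoef_e₃, kCoef_f₁, kCoef_f₂, kCoef_f₃, kCoef_g₁, kCoef_g₂, kCoef_m₁, kCoef_m₂, kCoef_m₃, kCoef_m₄, kCoef_n₁, kCoef_n₂, kCoef_n₃, rA, rB, rG, rD, rE, rP, rS, rH] <;> ring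

set_option maxHeartbeats 4000000 in
set_option maxRecDepth 20000 in
theorem refl_col_01 (h : NormRel q κ x y z) (hq : q ≠ 0) (u v α β γ δ : F) :
    rB q u v • (kHat q κ u α γ x y z 0 1 * ((-rE q (u * v) 1) • kHat q κ v β δ x y z 0 2) + kHat q κ u α γ x y z 0 2 * (rB q (u * v) 1 • kHat q κ v β δ x y z 1 2))
      + (u * rG q u v) • (kHat q κ u α γ x y z 1 2 * (rD q (u * v) 1 • kHat q κ v β δ x y z 0 2))
    = kHat q κ v β δ x y z 1 2 * ((rD q (u * v) 1 * rA q u v) • kHat q κ u α γ x y z 0 2) := by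
  simp only [kHat, kShape_00, kShape_01, kShape_02, kShape_10, kShape_11, kShape_12, kShape_20, kShape_21, kShape_22]
  have t1 := h.casT_mul_x hq
  have t2 := h.casT_mul_y hq
  have t3 := h.casT_mul_z hq
  have t4 := h.x_mul_casT_mul hq
  have t5 := h.y_mul_casT_mul hq
  have t6 := h.z_mul_casT_mul hq
  simp only [@mul_add A _ _ _, @mul_sub A _, @add_mul A _ _ _, @sub_mul A _, smul_add, smul_sub,
    smul_mul_assoc, mul_smul_comm, smul_smul, mul_one, one_mul, @mul_assoc A _]
  simp only [@mul_add A _ _ _, @mul_sub A _, @add_mul A _ _ _, @sub_mul A _, smul_add, smul_sub,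
    smul_mul_assoc, mul_smul_comm, smul_smul, mul_one, one_mul, @mul_assoc A _, h.yx, h.xz, h.zy,
    h.yx_assoc, h.xz_assoc, h.zy_assoc, x_mul_yz q κ x y z, h.y_mul_zx hq, h.z_mul_xy hq,
    ← t1, ← t2, ← t3, t4, t5, t6]
  clear t1 t2 t3 t4 t5 t6
  generalize casT q κ x y z = T
  match_scalars <;> simp only [kCoef_t₀, kCoef_a₁, kCoef_b₁, kCoef_c₁, kCoef_a₂, kCoef_c₂, kCoef_a₃, kCoef_b₃, kCoef_c₃, kCoef_d₁, kCoef_d₂, kCoef_e₁, kCoef_e₂, kCoef_e₃, kCoef_f₁, kCoef_f₂, kCoef_f₃, kCoef_g₁, kCoef_g₂, kCoef_m₁, kCoef_m₂, kCoef_m₃, kCoef_m₄, kCoef_n₁, kCoef_n₂, kCoef_n₃, rA, rB, rG, rD, rE, rP, rS, rH] <;> ring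

-- Here the diagonal entries matter, and the identity holds only up to correction terms. The central
-- summands are written as `α (T + g)` and `β (T + g')`, so that the corrections cancel in pairs
-- once `α (u ^ 2 - 1) = q ^ 6 u ^ 2` and `g = kG q κ u`, and similarly for `v`.
set_option maxHeartbeats 4000000 in
set_option maxRecDepth 20000 in
theorem refl_col_02 (h : NormRel q κ x y z) (hq : q ≠ 0) (u v α β g g' : F) :
    rD q u v • (kHat q κ u α (α * g) x y z 0 0 * ((rP q (u * v) 1) • kHat q κ v β (β * g') x y z 0 2) + kHat q κ u α (α * g) x y z 0 1 * ((rG q (u * v) 1) • kHat q κ v β (β * g') x y z 1 2) + kHat q κ u α (α * g) x y z 0 2 * (rA q (u * v) 1 • kHat q κ v β (β * g') x y z 2 2))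
      + (q ^ 4 * u * rE q u v) • (kHat q κ u α (α * g) x y z 1 1 * ((-rE q (u * v) 1) • kHat q κ v β (β * g') x y z 0 2) + kHat q κ u α (α * g) x y z 1 2 * (rB q (u * v) 1 • kHat q κ v β (β * g') x y z 1 2))
      + (u * rS q u v) • (kHat q κ u α (α * g) x y z 2 2 * (rD q (u * v) 1 • kHat q κ v β (β * g') x y z 0 2))
    = kHat q κ v β (β * g') x y z 2 2 * ((rD q (u * v) 1 * rA q u v) • kHat q κ u α (α * g) x y z 0 2)
      + (α * (u ^ 2 - 1)) • ((casT q κ x y z + g • 1) * (corrU02YZ q u v • (y * z) + corrU02X q u v • x + corrU02O q κ u v • (1 : A)))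
      - (q ^ 6 * u ^ 2) • ((casT q κ x y z + kG q κ u • 1) * (corrU02YZ q u v • (y * z) + corrU02X q u v • x + corrU02O q κ u v • (1 : A)))
      + (β * (v ^ 2 - 1)) • ((casT q κ x y z + g' • 1) * (corrV02YZ q u v • (y * z) + corrV02X q u v • x + corrV02O q κ u v • (1 : A)))
      - (q ^ 6 * v ^ 2) • ((casT q κ x y z + kG q κ v • 1) * (corrV02YZ q u v • (y * z) + corrV02X q u v • x + corrV02O q κ u v • (1 : A))) := by
  simp only [kHat, kShape_00, kShape_01, kShape_02, kShape_10, kShape_11, kShape_12, kShape_20, kShape_21, kShape_22]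
  have t1 := h.casT_mul_x hq
  have t2 := h.casT_mul_y hq
  have t3 := h.casT_mul_z hq
  have t4 := h.x_mul_casT_mul hq
  have t5 := h.y_mul_casT_mul hq
  have t6 := h.z_mul_casT_mul hq
  simp only [@mul_add A _ _ _, @mul_sub A _, @add_mul A _ _ _, @sub_mul A _, smul_add, smul_sub,
    smul_mul_assoc, mul_smul_comm, smul_smul, mul_one, one_mul, @mul_assoc A _]
  simp only [@mul_add A _ _ _, @mul_sub A _, @add_mul A _ _ _, @sub_mul A _, smul_add, smul_sub,
    smul_mul_assoc, mul_smul_comm, smul_smul, mul_one, one_mul, @mul_assoc A _, h.yx, h.xz, h.zy,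
    h.yx_assoc, h.xz_assoc, h.zy_assoc, x_mul_yz q κ x y z, h.y_mul_zx hq, h.z_mul_xy hq,
    ← t1, ← t2, ← t3, t4, t5, t6]
  clear t1 t2 t3 t4 t5 t6
  generalize casT q κ x y z = T
  match_scalars <;> simp only [kCoef_t₀, kCoef_a₁, kCoef_b₁, kCoef_c₁, kCoef_a₂, kCoef_c₂, kCoef_a₃, kCoef_b₃, kCoef_c₃, kCoef_d₁, kCoef_d₂, kCoef_e₁, kCoef_e₂, kCoef_e₃, kCoef_f₁, kCoef_f₂, kCoef_f₃, kCoef_g₁, kCoef_g₂, kCoef_m₁, kCoef_m₂, kCoef_m₃, kCoef_m₄, kCoef_n₁, kCoef_n₂, kCoef_n₃, kG, corrU02YZ, corrU02X, corrU02O, corrV02YZ, corrV02X, corrV02O, rA, rB, rG, rD, rE, rP, rS, rH] <;> ring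

set_option maxHeartbeats 4000000 in
set_option maxRecDepth 20000 in
theorem refl_col_11 (h : NormRel q κ x y z) (hq : q ≠ 0) (u v α β g g' : F) :
    (-v * rE q u v) • (kHat q κ u α (α * g) x y z 0 0 * ((rP q (u * v) 1) • kHat q κ v β (β * g') x y z 0 2) + kHat q κ u α (α * g) x y z 0 1 * ((rG q (u * v) 1) • kHat q κ v β (β * g') x y z 1 2) + kHat q κ u α (α * g) x y z 0 2 * (rA q (u * v) 1 • kHat q κ v β (β * g') x y z 2 2))
      + rH q u v • (kHat q κ u α (α * g) x y z 1 1 * ((-rE q (u * v) 1) • kHat q κ v β (β * g') x y z 0 2) + kHat q κ u α (α * g) x y z 1 2 * (rB q (u * v) 1 • kHat q κ v β (β * g') x y z 1 2))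
      + (q ^ 4 * u * rE q u v) • (kHat q κ u α (α * g) x y z 2 2 * (rD q (u * v) 1 • kHat q κ v β (β * g') x y z 0 2))
    = kHat q κ v β (β * g') x y z 1 1 * (((-rE q (u * v) 1) * rA q u v) • kHat q κ u α (α * g) x y z 0 2)
      + kHat q κ v β (β * g') x y z 1 2 * ((rB q (u * v) 1 * rA q u v) • kHat q κ u α (α * g) x y z 1 2)
      + (α * (u ^ 2 - 1)) • ((casT q κ x y z + g • 1) * (corrU11YZ q u v • (y * z) + corrU11X q u v • x + corrU11O q κ u v • (1 : A)))
      - (q ^ 6 * u ^ 2) • ((casT q κ x y z + kG q κ u • 1) * (corrU11YZ q u v • (y * z) + corrU11X q u v • x + corrU11O q κ u v • (1 : A)))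
      + (β * (v ^ 2 - 1)) • ((casT q κ x y z + g' • 1) * (corrV11YZ q u v • (y * z) + corrV11X q u v • x + corrV11O q κ u v • (1 : A)))
      - (q ^ 6 * v ^ 2) • ((casT q κ x y z + kG q κ v • 1) * (corrV11YZ q u v • (y * z) + corrV11X q u v • x + corrV11O q κ u v • (1 : A))) := by
  simp only [kHat, kShape_00, kShape_01, kShape_02, kShape_10, kShape_11, kShape_12, kShape_20, kShape_21, kShape_22]
  have t1 := h.casT_mul_x hq
  have t2 := h.casT_mul_y hq
  have t3 := h.casT_mul_z hq
  have t4 := h.x_mul_casT_mul hq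
  have t5 := h.y_mul_casT_mul hq
  have t6 := h.z_mul_casT_mul hq
  simp only [@mul_add A _ _ _, @mul_sub A _, @add_mul A _ _ _, @sub_mul A _, smul_add, smul_sub,
    smul_mul_assoc, mul_smul_comm, smul_smul, mul_one, one_mul, @mul_assoc A _]
  simp only [@mul_add A _ _ _, @mul_sub A _, @add_mul A _ _ _, @sub_mul A _, smul_add, smul_sub,
    smul_mul_assoc, mul_smul_comm, smul_smul, mul_one, one_mul, @mul_assoc A _, h.yx, h.xz, h.zy,
    h.yx_assoc, h.xz_assoc, h.zy_assoc, x_mul_yz q κ x y z, h.y_mul_zx hq, h.z_mul_xy hq,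
    ← t1, ← t2, ← t3, t4, t5, t6]
  clear t1 t2 t3 t4 t5 t6
  generalize casT q κ x y z = T
  match_scalars <;> simp only [kCoef_t₀, kCoef_a₁, kCoef_b₁, kCoef_c₁, kCoef_a₂, kCoef_c₂, kCoef_a₃, kCoef_b₃, kCoef_c₃, kCoef_d₁, kCoef_d₂, kCoef_e₁, kCoef_e₂, kCoef_e₃, kCoef_f₁, kCoef_f₂, kCoef_f₃, kCoef_g₁, kCoef_g₂, kCoef_m₁, kCoef_m₂, kCoef_m₃, kCoef_m₄, kCoef_n₁, kCoef_n₂, kCoef_n₃, kG, corrU11YZ, corrU11X, corrU11O, corrV11YZ, corrV11X, corrV11O, rA, rB, rG, rD, rE, rP, rS, rH] <;> ring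

set_option maxHeartbeats 4000000 in
set_option maxRecDepth 20000 in
theorem refl_col_12 (h : NormRel q κ x y z) (hq : q ≠ 0) (u v α β g g' : F) :
    rB q u v • (kHat q κ u α (α * g) x y z 1 0 * ((rP q (u * v) 1) • kHat q κ v β (β * g') x y z 0 2) + kHat q κ u α (α * g) x y z 1 1 * ((rG q (u * v) 1) • kHat q κ v β (β * g') x y z 1 2) + kHat q κ u α (α * g) x y z 1 2 * (rA q (u * v) 1 • kHat q κ v β (β * g') x y z 2 2))
      + (u * rG q u v) • (kHat q κ u α (α * g) x y z 2 1 * ((-rE q (u * v) 1) • kHat q κ v β (β * g') x y z 0 2) + kHat q κ u α (α * g) x y z 2 2 * (rB q (u * v) 1 • kHat q κ v β (β * g') x y z 1 2))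
    = kHat q κ v β (β * g') x y z 2 1 * (((-rE q (u * v) 1) * rA q u v) • kHat q κ u α (α * g) x y z 0 2)
      + kHat q κ v β (β * g') x y z 2 2 * ((rB q (u * v) 1 * rA q u v) • kHat q κ u α (α * g) x y z 1 2)
      + (α * (u ^ 2 - 1)) • ((casT q κ x y z + g • 1) * (corrU12Z q u v • z + corrU12Y q u v • y))
      - (q ^ 6 * u ^ 2) • ((casT q κ x y z + kG q κ u • 1) * (corrU12Z q u v • z + corrU12Y q u v • y))
      + (β * (v ^ 2 - 1)) • ((casT q κ x y z + g' • 1) * (corrV12Z q u v • z + corrV12Y q u v • y))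
      - (q ^ 6 * v ^ 2) • ((casT q κ x y z + kG q κ v • 1) * (corrV12Z q u v • z + corrV12Y q u v • y)) := by
  simp only [kHat, kShape_00, kShape_01, kShape_02, kShape_10, kShape_11, kShape_12, kShape_20, kShape_21, kShape_22]
  have t1 := h.casT_mul_x hq
  have t2 := h.casT_mul_y hq
  have t3 := h.casT_mul_z hq
  have t4 := h.x_mul_casT_mul hq
  have t5 := h.y_mul_casT_mul hq
  have t6 := h.z_mul_casT_mul hq
  simp only [@mul_add A _ _ _, @mul_sub A _, @add_mul A _ _ _, @sub_mul A _, smul_add, smul_sub,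
    smul_mul_assoc, mul_smul_comm, smul_smul, mul_one, one_mul, @mul_assoc A _]
  simp only [@mul_add A _ _ _, @mul_sub A _, @add_mul A _ _ _, @sub_mul A _, smul_add, smul_sub,
    smul_mul_assoc, mul_smul_comm, smul_smul, mul_one, one_mul, @mul_assoc A _, h.yx, h.xz, h.zy,
    h.yx_assoc, h.xz_assoc, h.zy_assoc, x_mul_yz q κ x y z, h.y_mul_zx hq, h.z_mul_xy hq,
    ← t1, ← t2, ← t3, t4, t5, t6]
  clear t1 t2 t3 t4 t5 t6
  generalize casT q κ x y z = T
  match_scalars <;> simp only [kCoef_t₀, kCoef_a₁, kCoef_b₁, kCoef_c₁, kCoef_a₂, kCoef_c₂, kCoef_a₃, kCoef_b₃, kCoef_c₃, kCoef_d₁, kCoef_d₂, kCoef_e₁, kCoef_e₂, kCoef_e₃, kCoef_f₁, kCoef_f₂, kCoef_f₃, kCoef_g₁, kCoef_g₂, kCoef_m₁, kCoef_m₂, kCoef_m₃, kCoef_m₄, kCoef_n₁, kCoef_n₂, kCoef_n₃, kG, corrU12Z, corrU12Y, corrV12Z, corrV12Y, rA, rB, rG, rD, rE, rP, rS, rH]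 <;> ring

-- No correction is needed: the central summands occur only in the two products of the last diagonal
-- entries, whose order is exchanged between the sides.
set_option maxHeartbeats 4000000 in
set_option maxRecDepth 20000 in
theorem refl_col_22 (h : NormRel q κ x y z) (hq : q ≠ 0) (u v α β γ δ : F) :
    kHat q κ u α γ x y z 2 0 * ((rP q (u * v) 1) • kHat q κ v β δ x y z 0 2) + kHat q κ u α γ x y z 2 1 * ((rG q (u * v) 1) • kHat q κ v β δ x y z 1 2) + kHat q κ u α γ x y z 2 2 * (rA q (u * v) 1 • kHat q κ v β δ x y z 2 2)
    = kHat q κ v β δ x y z 2 0 * (((rP q (u * v) 1)) • kHat q κ u α γ x y z 0 2)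
      + kHat q κ v β δ x y z 2 1 * (((rG q (u * v) 1)) • kHat q κ u α γ x y z 1 2)
      + kHat q κ v β δ x y z 2 2 * ((rA q (u * v) 1) • kHat q κ u α γ x y z 2 2) := by
  simp only [kHat, kShape_00, kShape_01, kShape_02, kShape_10, kShape_11, kShape_12, kShape_20, kShape_21, kShape_22]
  have t1 := h.casT_mul_x hq
  have t2 := h.casT_mul_y hq
  have t3 := h.casT_mul_z hq
  have t4 := h.x_mul_casT_mul hq
  have t5 := h.y_mul_casT_mul hq
  have t6 := h.z_mul_casT_mul hq
  simp only [@mul_add A _ _ _, @mul_sub A _, @add_mul A _ _ _, @sub_mul A _, smul_add, smul_sub,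
    smul_mul_assoc, mul_smul_comm, smul_smul, mul_one, one_mul, @mul_assoc A _]
  simp only [@mul_add A _ _ _, @mul_sub A _, @add_mul A _ _ _, @sub_mul A _, smul_add, smul_sub,
    smul_mul_assoc, mul_smul_comm, smul_smul, mul_one, one_mul, @mul_assoc A _, h.yx, h.xz, h.zy,
    h.yx_assoc, h.xz_assoc, h.zy_assoc, x_mul_yz q κ x y z, h.y_mul_zx hq, h.z_mul_xy hq,
    ← t1, ← t2, ← t3, t4, t5, t6]
  clear t1 t2 t3 t4 t5 t6
  generalize casT q κ x y z = T
  match_scalars <;> simp only [kCoef_t₀, kCoef_a₁, kCoef_b₁, kCoef_c₁, kCoef_a₂, kCoef_c₂, kCoef_a₃, kCoef_b₃, kCoef_c₃, kCoef_d₁, kCoef_d₂, kCoef_e₁, kCoef_e₂, kCoef_e₃, kCoef_f₁, kCoef_f₂, kCoef_f₃, kCoef_g₁, kCoef_g₂, kCoef_m₁, kCoef_m₂, kCoef_m₃, kCoef_m₄, kCoef_n₁, kCoef_n₂, kCoef_n₃, rA, rB, rG, rD, rE, rP, rS, rH] <;> ring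
end NormRel
end
end DynK

end

/-! ### The intertwining relations and one entry of `K(u) K(u⁻¹)`. -/

noncomputable section

namespace DynK

section
variable {F : Type*} [Field F]

/-- The coefficient of the Casimir element in the rescaled `K`-matrix. -/
def kA (q u : F) : F := q ^ 6 * u ^ 2 / (u ^ 2 - 1)

/-- The coefficients of the scalar `K(u) K(u⁻¹)` as a polynomial in the Casimir element. -/
def chiCoef (q κ u : F) : F × F :=
  (kA q u * (kA q u⁻¹ * kG q κ u⁻¹ - q ^ 6 * kG q κ u⁻¹)
      + kA q u⁻¹ * (kA q u * kG q κ u - q ^ 6 * kG q κ u)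
      + q ^ 24 * (q ^ 2 + 1) * (q ^ 6 + 1),
    (kA q u * kG q κ u - q ^ 6 * kG q κ u) * (kA q u⁻¹ * kG q κ u⁻¹ - q ^ 6 * kG q κ u⁻¹)
      + (q ^ 2 + 1) ^ 2 * (q ^ 28 * (q ^ 4 + 1) ^ 2 * κ ^ 2 + q ^ 38 * (q ^ 12 + 1)
        - q ^ 44 * (u ^ 2 + u⁻¹ ^ 2))
      - q ^ 35 * (q ^ 2 + 1) * (q ^ 8 - 1) * (u + u⁻¹) * κ)

end

section
variable {A : Type*} [Ring A] {F : Type*} [Field F] [Algebra F A]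

/-- The rescaled image of `A₁` under `(π_u ⊗ Π) ∘ δ`. -/
def onsM1 (q : F) (y : A) : Matrix (Fin 3) (Fin 3) A :=
  !![q ^ 4 • y, (q ^ 7 * (q ^ 4 - 1)) • 1, 0;
     (q ^ 7 * (q ^ 4 - 1)) • 1, q ^ 2 • y, (q ^ 6 * (q ^ 4 - 1)) • 1;
     0, (q ^ 6 * (q ^ 4 - 1)) • 1, y]

/-- The rescaled image of `A₀` under `(π_u ⊗ Π) ∘ δ`, where `a = u⁻¹`, `b = u`. -/
def onsM0 (q a b : F) (x : A) : Matrix (Fin 3) (Fin 3) A :=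
  !![x, 0, (q ^ 6 * (q ^ 8 - 1) * a) • 1;
     0, q ^ 4 • x, 0;
     (q ^ 6 * (q ^ 8 - 1) * b) • 1, 0, q ^ 8 • x]

/-- The rescaled `K`-matrix. -/
def kFull (q κ u : F) (x y z : A) : Matrix (Fin 3) (Fin 3) A :=
  kHat q κ u (kA q u) (kA q u * kG q κ u) x y z

variable {q κ : F} {x y z : A}

namespace NormRel

set_option linter.unusedSimpArgs false

-- The parameters `α, γ` are arbitrary because a central scalar matrix commutes with `onsM1`.
set_option maxHeartbeats 4000000 in
theorem kHat_mul_onsM1 (h : NormRel q κ x y z) (hq : q ≠ 0) (u α γ : F) :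
    kHat q κ u α γ x y z * onsM1 q y = onsM1 q y * kHat q κ u α γ x y z := by
  have t2 := h.casT_mul_y hq
  have t5 := h.y_mul_casT_mul hq
  ext i j
  fin_cases i <;> fin_cases j <;>
  (simp only [Matrix.mul_apply, Fin.sum_univ_three, kHat, kShape, onsM1]
   simp only [Fin.mk_zero, Fin.mk_one, Fin.reduceFinMk, Matrix.of_apply, Matrix.cons_val', Matrix.cons_val_zero,
     Matrix.cons_val_one, Matrix.cons_val, Fin.isValue, Fin.zero_eta]
   simp only [@mul_add A _ _ _, @mul_sub A _, @add_mul A _ _ _, @sub_mul A _, smul_add, smul_sub,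
    smul_mul_assoc, mul_smul_comm, smul_smul, mul_one, one_mul, @mul_assoc A _, mul_zero, zero_mul]
   simp only [@mul_add A _ _ _, @mul_sub A _, @add_mul A _ _ _, @sub_mul A _, smul_add, smul_sub,
    smul_mul_assoc, mul_smul_comm, smul_smul, mul_one, one_mul, @mul_assoc A _, h.yx, h.xz, h.zy,
    h.yx_assoc, h.xz_assoc, h.zy_assoc, x_mul_yz q κ x y z, h.y_mul_zx hq, h.z_mul_xy hq,
    ← t2, t5]
   clear t2 t5
   generalize casT q κ x y z = T
   match_scalars <;> simp only [kCoef] <;> ring)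

-- This equation fixes the central summand: a central scalar matrix `c` changes the two sides by
-- amounts that differ by a multiple of `(u - u⁻¹) c`. This is where the values `kA` and `kG` come
-- from.
set_option maxHeartbeats 4000000 in
theorem kFull_mul_onsM0 (h : NormRel q κ x y z) (hq : q ≠ 0) {u : F} (hu : u ≠ 0)
    (hu1 : u ^ 2 - 1 ≠ 0) :
    kFull q κ u x y z * onsM0 q u⁻¹ u x = onsM0 q u u⁻¹ x * kFull q κ u x y z := by
  have t1 := h.casT_mul_x hq
  have t4 := h.x_mul_casT_mul hq
  ext i j
  fin_cases i <;> fin_cases j <;>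
  (simp only [Matrix.mul_apply, Fin.sum_univ_three, kFull, kHat, kShape, onsM0]
   simp only [Fin.mk_zero, Fin.mk_one, Fin.reduceFinMk, Matrix.of_apply, Matrix.cons_val', Matrix.cons_val_zero,
     Matrix.cons_val_one, Matrix.cons_val, Fin.isValue, Fin.zero_eta]
   simp only [@mul_add A _ _ _, @mul_sub A _, @add_mul A _ _ _, @sub_mul A _, smul_add, smul_sub,
    smul_mul_assoc, mul_smul_comm, smul_smul, mul_one, one_mul, @mul_assoc A _, mul_zero, zero_mul]
   simp only [@mul_add A _ _ _, @mul_sub A _, @add_mul A _ _ _, @sub_mul A _, smul_add, smul_sub,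
    smul_mul_assoc, mul_smul_comm, smul_smul, mul_one, one_mul, @mul_assoc A _, h.yx, h.xz, h.zy,
    h.yx_assoc, h.xz_assoc, h.zy_assoc, x_mul_yz q κ x y z, h.y_mul_zx hq, h.z_mul_xy hq,
    ← t1, t4]
   clear t1 t4
   generalize casT q κ x y z = T
   match_scalars <;> simp only [kCoef, kA, kG] <;> field_simp <;> ring)

-- The only entry of the product that is computed; uniqueness of intertwiners supplies the others.
set_option maxHeartbeats 4000000 in
theorem kFull_mul_kFull_inv_22 (h : NormRel q κ x y z) (hq : q ≠ 0) {u : F} (hu : u ≠ 0)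
    (hu1 : u ^ 2 - 1 ≠ 0) :
    (kFull q κ u x y z * kFull q κ u⁻¹ x y z) 2 2 =
      (kA q u * kA q u⁻¹) • (casT q κ x y z * casT q κ x y z)
        + (chiCoef q κ u).1 • casT q κ x y z + (chiCoef q κ u).2 • 1 := by
  have t1 := h.casT_mul_x hq
  have t2 := h.casT_mul_y hq
  have t4 := h.x_mul_casT_mul hq
  have t5 := h.y_mul_casT_mul hq
  have hu2 : 1 - u ^ 2 ≠ 0 := fun e => hu1 (by linear_combination -e)
  have hv : kA q u⁻¹ = q ^ 6 / (1 - u ^ 2) := by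
    rw [kA]; field_simp
  simp only [Matrix.mul_apply, Fin.sum_univ_three, kFull, kHat, kShape_20, kShape_02, kShape_21,
    kShape_12, kShape_22]
  simp only [@mul_add A _ _ _, @mul_sub A _, @add_mul A _ _ _, @sub_mul A _, smul_add, smul_sub,
    smul_mul_assoc, mul_smul_comm, smul_smul, mul_one, one_mul, @mul_assoc A _]
  simp only [@mul_add A _ _ _, @mul_sub A _, @add_mul A _ _ _, @sub_mul A _, smul_add, smul_sub,
    smul_mul_assoc, mul_smul_comm, smul_smul, mul_one, one_mul, @mul_assoc A _, h.yx, h.xz, h.zy,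
    h.yx_assoc, h.xz_assoc, h.zy_assoc, x_mul_yz q κ x y z, h.y_mul_zx hq, h.z_mul_xy hq,
    ← t1, ← t2, t4, t5]
  clear t1 t2 t4 t5
  generalize casT q κ x y z = T
  match_scalars <;> simp only [kCoef, chiCoef, hv] <;> (try simp only [kA, kG]) <;> field_simp <;> ring

end NormRel
end
end DynK

end

/-! ### The filtration by degree in `y` and `z`. -/

noncomputable section

namespace DynK

section
variable {A : Type*} [Ring A] {F : Type*} [Field F] [Algebra F A]

/-- The filtration of the algebra in which `x` and the Casimir element have degree `0`, whereas
`y` and `z` have degree `1`. -/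
def filt (q κ : F) (x y z : A) (N : ℕ) : Submodule F A :=
  Submodule.span F {w | ∃ n i j : ℕ, (j ≤ N ∧ w = casT q κ x y z ^ n * (x ^ i * y ^ j)) ∨
    (j + 1 ≤ N ∧ w = casT q κ x y z ^ n * (x ^ i * (z * y ^ j)))}

variable {q κ : F} {x y z : A}

theorem filt_mono {N M : ℕ} (hNM : N ≤ M) : filt q κ x y z N ≤ filt q κ x y z M := by
  refine Submodule.span_mono ?_
  rintro w ⟨n, i, j, ⟨h, e⟩ | ⟨h, e⟩⟩
  · exact ⟨n, i, j, Or.inl ⟨h.trans hNM, e⟩⟩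
  · exact ⟨n, i, j, Or.inr ⟨h.trans hNM, e⟩⟩

theorem filt_le_of_forall {N : ℕ} {S : Submodule F A}
    (h₁ : ∀ n i j, j ≤ N → casT q κ x y z ^ n * (x ^ i * y ^ j) ∈ S)
    (h₂ : ∀ n i j, j + 1 ≤ N → casT q κ x y z ^ n * (x ^ i * (z * y ^ j)) ∈ S) :
    filt q κ x y z N ≤ S := by
  refine Submodule.span_le.2 ?_
  rintro w ⟨n, i, j, ⟨h, rfl⟩ | ⟨h, rfl⟩⟩
  exacts [h₁ n i j h, h₂ n i j h]

theorem pow_mem_filt {N j : ℕ} (hj : j ≤ N) (n i : ℕ) :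
    casT q κ x y z ^ n * (x ^ i * y ^ j) ∈ filt q κ x y z N :=
  Submodule.subset_span ⟨n, i, j, Or.inl ⟨hj, rfl⟩⟩

theorem z_pow_mem_filt {N j : ℕ} (hj : j + 1 ≤ N) (n i : ℕ) :
    casT q κ x y z ^ n * (x ^ i * (z * y ^ j)) ∈ filt q κ x y z N :=
  Submodule.subset_span ⟨n, i, j, Or.inr ⟨hj, rfl⟩⟩

theorem y_pow_mem_filt {N j : ℕ} (hj : j ≤ N) : y ^ j ∈ filt q κ x y z N := by
  simpa using pow_mem_filt (q := q) (κ := κ) (x := x) (y := y) (z := z) hj 0 0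

theorem z_mul_y_pow_mem_filt {N j : ℕ} (hj : j + 1 ≤ N) : z * y ^ j ∈ filt q κ x y z N := by
  simpa using z_pow_mem_filt (q := q) (κ := κ) (x := x) (y := y) (z := z) hj 0 0

theorem casT_mul_mem_filt {N : ℕ} {a : A} (ha : a ∈ filt q κ x y z N) :
    casT q κ x y z * a ∈ filt q κ x y z N := by
  have : filt q κ x y z N ≤ (filt q κ x y z N).comap (LinearMap.mulLeft F (casT q κ x y z)) := by
    refine filt_le_of_forall (fun n i j hj => ?_) (fun n i j hj => ?_)
    · simpa [← mul_assoc, ← pow_succ'] using pow_mem_filt hj (n + 1) i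
    · simpa [← mul_assoc, ← pow_succ'] using z_pow_mem_filt hj (n + 1) i
  exact this ha

namespace NormRel

theorem casT_pow_mul_comm_x (h : NormRel q κ x y z) (hq : q ≠ 0) (n : ℕ) (w : A) :
    x * (casT q κ x y z ^ n * w) = casT q κ x y z ^ n * (x * w) := by
  have : Commute x (casT q κ x y z ^ n) := Commute.pow_right (h.casT_mul_x hq).symm n
  rw [← mul_assoc, this.eq, mul_assoc]

theorem casT_pow_mul_comm_y (h : NormRel q κ x y z) (hq : q ≠ 0) (n : ℕ) (w : A) :
    y * (casT q κ x y z ^ n * w) = casT q κ x y z ^ n * (y * w) := by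
  have : Commute y (casT q κ x y z ^ n) := Commute.pow_right (h.casT_mul_y hq).symm n
  rw [← mul_assoc, this.eq, mul_assoc]

theorem casT_pow_mul_comm_z (h : NormRel q κ x y z) (hq : q ≠ 0) (n : ℕ) (w : A) :
    z * (casT q κ x y z ^ n * w) = casT q κ x y z ^ n * (z * w) := by
  have : Commute z (casT q κ x y z ^ n) := Commute.pow_right (h.casT_mul_z hq).symm n
  rw [← mul_assoc, this.eq, mul_assoc]

theorem x_mul_mem_filt (h : NormRel q κ x y z) (hq : q ≠ 0) {N : ℕ} {a : A}
    (ha : a ∈ filt q κ x y z N) : x * a ∈ filt q κ x y z N := by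
  have : filt q κ x y z N ≤ (filt q κ x y z N).comap (LinearMap.mulLeft F x) := by
    refine filt_le_of_forall (fun n i j hj => ?_) (fun n i j hj => ?_)
    · simpa [h.casT_pow_mul_comm_x hq, ← mul_assoc x, ← pow_succ'] using pow_mem_filt hj n (i + 1)
    · simpa [h.casT_pow_mul_comm_x hq, ← mul_assoc x, ← pow_succ'] using
        z_pow_mem_filt hj n (i + 1)
  exact this ha

theorem casT_pow_mul_mem_filt {N : ℕ} {a : A} (ha : a ∈ filt q κ x y z N) (n : ℕ) :
    casT q κ x y z ^ n * a ∈ filt q κ x y z N := by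
  induction n with
  | zero => simpa using ha
  | succ n ih => rw [pow_succ', mul_assoc]; exact casT_mul_mem_filt ih

/-- A joint induction, since moving `y` past `x` creates `z` and moving `z` past `x` creates `y`.
Neither raises the degree. -/
theorem yz_mul_x_pow_mem (h : NormRel q κ x y z) (hq : q ≠ 0) {N : ℕ} {w : A}
    (hy : y * w ∈ filt q κ x y z N) (hz : z * w ∈ filt q κ x y z N) (i : ℕ) :
    y * (x ^ i * w) ∈ filt q κ x y z N ∧ z * (x ^ i * w) ∈ filt q κ x y z N := by
  induction i with
  | zero => simpa using ⟨hy, hz⟩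
  | succ i ih =>
    obtain ⟨ihy, ihz⟩ := ih
    rw [pow_succ', mul_assoc, h.yx_assoc]
    refine ⟨Submodule.sub_mem _ (Submodule.smul_mem _ _ (h.x_mul_mem_filt hq ihy))
      (Submodule.smul_mem _ _ ihz), ?_⟩
    have e := h.xz_assoc (x ^ i * w)
    have e' : z * (x * (x ^ i * w)) = (q ^ 4)⁻¹ • (x * (z * (x ^ i * w))
        - (q ^ 4 * (q ^ 8 - 1)) • (y * (x ^ i * w))) := by
      rw [e, add_sub_cancel_right, inv_smul_smul₀ (pow_ne_zero 4 hq)]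
    rw [e']
    exact Submodule.smul_mem _ _ (Submodule.sub_mem _ (h.x_mul_mem_filt hq ihz)
      (Submodule.smul_mem _ _ ihy))

theorem y_mul_z_mul_mem (h : NormRel q κ x y z) (hq : q ≠ 0) {N j : ℕ} (hj : j + 1 ≤ N) :
    y * (z * y ^ j) ∈ filt q κ x y z (N + 1) := by
  have e := h.zy_assoc (y ^ j)
  have e' : y * (z * y ^ j) = (q ^ 4)⁻¹ • (z * y ^ (j + 1)
      - (q ^ 4 * (q ^ 8 - 1) * (q ^ 2 + 1)) • (x * y ^ j)
      + (q ^ 4 * (q ^ 8 - 1) * (q ^ 2 + 1) * κ) • y ^ j) := by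
    rw [pow_succ' y, e, eq_inv_smul_iff₀ (pow_ne_zero 4 hq)]; abel
  rw [e']
  have hyj : y ^ j ∈ filt q κ x y z (N + 1) := y_pow_mem_filt (by omega)
  exact Submodule.smul_mem _ _ (Submodule.add_mem _ (Submodule.sub_mem _
    (z_mul_y_pow_mem_filt (by omega)) (Submodule.smul_mem _ _ (h.x_mul_mem_filt hq hyj)))
    (Submodule.smul_mem _ _ hyj))

/-- The definition of the Casimir element is solved for `z * z`. This is why at most one factor `z`
is needed in the spanning set. -/
theorem z_mul_z_mul_mem (h : NormRel q κ x y z) (hq : q ≠ 0) {N j : ℕ} (hj : j + 1 ≤ N) :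
    z * (z * y ^ j) ∈ filt q κ x y z (N + 1) := by
  have e : casT q κ x y z * y ^ j = _ := congrArg (· * y ^ j) (casT.eq_1 q κ x y z)
  simp only [@add_mul A _ _ _, @sub_mul A _, smul_mul_assoc, @mul_assoc A _] at e
  have e' : z * (z * y ^ j) = (q ^ 8)⁻¹ • (x * (y * (z * y ^ j)) + y ^ (j + 2)
      + (q ^ 8 * (q ^ 2 + 1)) • (x * (x * y ^ j))
      - ((q ^ 2 + 1) * (q ^ 4 + 1) * q ^ 4 * κ) • (x * y ^ j) - casT q κ x y z * y ^ j) := by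
    rw [e, eq_inv_smul_iff₀ (pow_ne_zero 8 hq), pow_succ' y, pow_succ' y]; abel
  rw [e']
  have hyj : y ^ j ∈ filt q κ x y z (N + 1) := y_pow_mem_filt (by omega)
  have hx := h.x_mul_mem_filt hq hyj
  exact Submodule.smul_mem _ _ (Submodule.sub_mem _ (Submodule.sub_mem _ (Submodule.add_mem _
    (Submodule.add_mem _ (h.x_mul_mem_filt hq (h.y_mul_z_mul_mem hq hj))
      (y_pow_mem_filt (by omega))) (Submodule.smul_mem _ _ (h.x_mul_mem_filt hq hx)))
    (Submodule.smul_mem _ _ hx)) (casT_mul_mem_filt hyj))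

theorem y_mul_mem_filt (h : NormRel q κ x y z) (hq : q ≠ 0) {N : ℕ} {a : A}
    (ha : a ∈ filt q κ x y z N) : y * a ∈ filt q κ x y z (N + 1) := by
  have : filt q κ x y z N ≤ (filt q κ x y z (N + 1)).comap (LinearMap.mulLeft F y) := by
    refine filt_le_of_forall (fun n i j hj => ?_) (fun n i j hj => ?_)
    · simp only [Submodule.mem_comap, LinearMap.mulLeft_apply, h.casT_pow_mul_comm_y hq]
      refine casT_pow_mul_mem_filt (h.yz_mul_x_pow_mem hq ?_ ?_ i).1 n
      · rw [← pow_succ']; exact y_pow_mem_filt (by omega)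
      · exact z_mul_y_pow_mem_filt (by omega)
    · simp only [Submodule.mem_comap, LinearMap.mulLeft_apply, h.casT_pow_mul_comm_y hq]
      exact casT_pow_mul_mem_filt
        (h.yz_mul_x_pow_mem hq (h.y_mul_z_mul_mem hq hj) (h.z_mul_z_mul_mem hq hj) i).1 n
  exact this ha

theorem z_mul_mem_filt (h : NormRel q κ x y z) (hq : q ≠ 0) {N : ℕ} {a : A}
    (ha : a ∈ filt q κ x y z N) : z * a ∈ filt q κ x y z (N + 1) := by
  have : filt q κ x y z N ≤ (filt q κ x y z (N + 1)).comap (LinearMap.mulLeft F z) := by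
    refine filt_le_of_forall (fun n i j hj => ?_) (fun n i j hj => ?_)
    · simp only [Submodule.mem_comap, LinearMap.mulLeft_apply, h.casT_pow_mul_comm_z hq]
      refine casT_pow_mul_mem_filt (h.yz_mul_x_pow_mem hq ?_ ?_ i).2 n
      · rw [← pow_succ']; exact y_pow_mem_filt (by omega)
      · exact z_mul_y_pow_mem_filt (by omega)
    · simp only [Submodule.mem_comap, LinearMap.mulLeft_apply, h.casT_pow_mul_comm_z hq]
      exact casT_pow_mul_mem_filt
        (h.yz_mul_x_pow_mem hq (h.y_mul_z_mul_mem hq hj) (h.z_mul_z_mul_mem hq hj) i).2 n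
  exact this ha

/-- Left multiplication by a generator raises the degree by at most one, so induction on elements of
the algebra generated by `x, y, z` applies, starting from `1 = y ^ 0`. -/
theorem exists_mem_filt (h : NormRel q κ x y z) (hq : q ≠ 0)
    (htop : Algebra.adjoin F {x, y, z} = ⊤) (a : A) : ∃ N, a ∈ filt q κ x y z N := by
  suffices H : ∀ a ∈ Algebra.adjoin F {x, y, z}, ∀ (N : ℕ), ∀ b ∈ filt q κ x y z N,
      ∃ M, a * b ∈ filt q κ x y z M by
    obtain ⟨M, hM⟩ := H a (by rw [htop]; trivial) 0 (y ^ 0) (y_pow_mem_filt le_rfl)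
    exact ⟨M, by simpa using hM⟩
  intro a ha
  induction ha using Algebra.adjoin_induction with
  | mem a ha =>
    intro N b hb
    rcases ha with rfl | rfl | rfl
    · exact ⟨N, h.x_mul_mem_filt hq hb⟩
    · exact ⟨N + 1, h.y_mul_mem_filt hq hb⟩
    · exact ⟨N + 1, h.z_mul_mem_filt hq hb⟩
  | algebraMap r =>
    intro N b hb
    exact ⟨N, by rw [← Algebra.smul_def]; exact Submodule.smul_mem _ _ hb⟩
  | add a b _ _ iha ihb =>
    intro N c hc
    obtain ⟨M, hM⟩ := iha N c hc
    obtain ⟨M', hM'⟩ := ihb N c hc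
    refine ⟨max M M', ?_⟩
    rw [add_mul]
    exact Submodule.add_mem _ (filt_mono (le_max_left _ _) hM) (filt_mono (le_max_right _ _) hM')
  | mul a b _ _ iha ihb =>
    intro N c hc
    obtain ⟨M, hM⟩ := ihb N c hc
    obtain ⟨M', hM'⟩ := iha M _ hM
    exact ⟨M', by rwa [mul_assoc]⟩

end NormRel
end
end DynK

end

/-! ### The representation on functions on `ℤ` with values in polynomials in the Casimir element. -/

noncomputable section

namespace DynK

open Polynomial

section
variable {F : Type*} [Field F]

/-- The weighted shift `f ↦ (m ↦ g m * f (m - s))`. -/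
def stepOp (s : ℤ) (g : ℤ → F[X]) : Module.End F[X] (ℤ → F[X]) where
  toFun f := fun m => g m * f (m - s)
  map_add' f₁ f₂ := by ext1 m; simp only [Pi.add_apply]; ring
  map_smul' c f := by
    ext1 m; simp only [Pi.smul_apply, smul_eq_mul, RingHom.id_apply]; ring

theorem stepOp_apply (s : ℤ) (g : ℤ → F[X]) (f : ℤ → F[X]) (m : ℤ) :
    stepOp s g f m = g m * f (m - s) := rfl

/-- The spectral variable of the representation. -/
def repV (q τ : F) (m : ℤ) : F := τ * (q ^ 4) ^ m

/-- The eigenvalues of `x`. -/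
def repE (q τ : F) (m : ℤ) : F := q ^ 6 * (repV q τ m - (repV q τ m)⁻¹)

/-- The inverse of the leading coefficient of the weight of the lowering part of `y`. -/
def repD (q τ : F) (m : ℤ) : F :=
  (1 + (repV q τ (m - 1))⁻¹ ^ 2) * (1 + q ^ 8 * repV q τ (m - 1) ^ 2)

/-- The root of the weight of the lowering part of `y`. -/
def repR (q κ τ : F) (m : ℤ) : F :=
  q ^ 8 * (q ^ 2 + 1) * repE q τ (m - 1) ^ 2
    - (q ^ 2 + 1) * (q ^ 4 + 1) * q ^ 4 * κ * repE q τ (m - 1)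
    + q ^ 6 * (q ^ 8 - 1) * (q ^ 2 + 1) * (repE q τ (m - 1) - κ) * (repV q τ (m - 1))⁻¹

/-- The weight of the lowering part of `y`. -/
def repF (q κ τ : F) (m : ℤ) : F[X] := C (repD q τ m)⁻¹ * (X - C (repR q κ τ m))

def repX (q τ : F) : Module.End F[X] (ℤ → F[X]) := stepOp 0 fun m => C (repE q τ m)

def repY (q κ τ : F) : Module.End F[X] (ℤ → F[X]) :=
  stepOp 1 1 + stepOp (-1) fun m => repF q κ τ (m + 1)

/-- Forced by the relation for `y * x`: the differences `repE (m ± 1) - q ^ 4 * repE m` give the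
factors `repV` and `-repV⁻¹` of the raising and lowering parts. The raising weight of `y` is
normalized to `1`. -/
def repZ (q κ τ : F) : Module.End F[X] (ℤ → F[X]) :=
  stepOp 1 (fun m => C (q⁻¹ ^ 2 * repV q τ m))
    - stepOp (-1) fun m => C (q⁻¹ ^ 2 * (repV q τ m)⁻¹) * repF q κ τ (m + 1)

theorem repX_apply (q τ : F) (f : ℤ → F[X]) (m : ℤ) :
    repX q τ f m = C (repE q τ m) * f m := by simp [repX, stepOp_apply]

theorem repY_apply (q κ τ : F) (f : ℤ → F[X]) (m : ℤ) :
    repY q κ τ f m = f (m - 1) + repF q κ τ (m + 1) * f (m + 1) := by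
  simp [repY, stepOp_apply]

theorem repZ_apply (q κ τ : F) (f : ℤ → F[X]) (m : ℤ) :
    repZ q κ τ f m = C (q⁻¹ ^ 2 * repV q τ m) * f (m - 1)
      - C (q⁻¹ ^ 2 * (repV q τ m)⁻¹) * repF q κ τ (m + 1) * f (m + 1) := by
  simp [repZ, stepOp_apply]

variable {q κ τ : F}

theorem zpow_ne_one_of_forall (hq : ∀ n : ℕ, 0 < n → q ^ n ≠ 1) {n : ℤ} (hn : n ≠ 0) :
    q ^ n ≠ 1 := by
  rcases Int.natAbs_eq n with e | e
  · rw [e, zpow_natCast]; exact hq _ (by omega)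
  · rw [e, zpow_neg, zpow_natCast, inv_ne_one]; exact hq _ (by omega)

variable (hq0 : q ≠ 0) (hq : ∀ n : ℕ, 0 < n → q ^ n ≠ 1) (hτ : τ ^ 2 = -q ^ 4)

include hq0 hτ in
theorem tau_ne_zero : τ ≠ 0 := by
  rintro rfl
  exact pow_ne_zero 4 hq0 (by linear_combination hτ)

include hq0 hτ in
theorem repV_ne_zero (m : ℤ) : repV q τ m ≠ 0 :=
  mul_ne_zero (tau_ne_zero hq0 hτ) (zpow_ne_zero _ (pow_ne_zero _ hq0))

include hq0 in
theorem repV_succ (m : ℤ) : repV q τ (m + 1) = q ^ 4 * repV q τ m := by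
  rw [repV, repV, zpow_add_one₀ (pow_ne_zero 4 hq0)]; ring

include hq0 in
theorem repV_pred (m : ℤ) : repV q τ (m - 1) = (q ^ 4)⁻¹ * repV q τ m := by
  rw [repV, repV, zpow_sub_one₀ (pow_ne_zero 4 hq0)]; ring

include hq0 hτ in
theorem repV_sq (m : ℤ) : repV q τ m ^ 2 = -q ^ (8 * m + 4) := by
  have : (q ^ 4) ^ m = q ^ (4 * m) := by
    rw [zpow_mul]; norm_cast
  rw [repV, mul_pow, hτ, this, ← zpow_natCast (q ^ (4 * m)), ← zpow_mul, ← zpow_natCast q 4,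
    neg_mul, ← zpow_add₀ hq0]
  push_cast
  congr 2; ring

-- Since `τ ^ 2 = -q ^ 4`, the expression equals `1 - q ^ (8 m + 4)`, and the exponent is never
-- zero. This keeps the denominators `repD` away from zero.
include hq0 hq hτ in
theorem one_add_repV_sq_ne_zero (m : ℤ) : 1 + repV q τ m ^ 2 ≠ 0 := by
  rw [repV_sq hq0 hτ]
  intro e
  exact zpow_ne_one_of_forall hq (n := 8 * m + 4) (by omega) (by linear_combination -e)

include hq0 hq hτ in
theorem one_add_mul_repV_sq_ne_zero (m : ℤ) : 1 + q ^ 8 * repV q τ m ^ 2 ≠ 0 := by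
  have := one_add_repV_sq_ne_zero hq0 hq hτ (m + 1)
  rw [repV_succ hq0] at this
  intro e; apply this; linear_combination e

include hq0 hq hτ in
theorem pow_eight_add_repV_sq_ne_zero (m : ℤ) : q ^ 8 + repV q τ m ^ 2 ≠ 0 := by
  have := one_add_repV_sq_ne_zero hq0 hq hτ (m - 1)
  rw [repV_pred hq0] at this
  intro e; apply this; field_simp; linear_combination e

-- The diagonal part of the condition that the Casimir element acts as `X`. Together with the
-- diagonal part of the relation for `z * y`, it is a linear system for the weights at `m` and `m +
-- 1`, and the formula for `repF` is its solution.
include hq0 hq hτ in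
theorem repF_rel_casT (m : ℤ) :
    C (1 + q ^ 8 * (repV q τ m)⁻¹ ^ 2) * repF q κ τ m
      + C (1 + q ^ 8 * repV q τ m ^ 2) * repF q κ τ (m + 1)
      + C (q ^ 8 * (q ^ 2 + 1) * repE q τ m ^ 2
        - (q ^ 2 + 1) * (q ^ 4 + 1) * q ^ 4 * κ * repE q τ m) = X := by
  have h0 := repV_ne_zero hq0 hτ m
  have h1 := one_add_repV_sq_ne_zero hq0 hq hτ m
  have h2 := one_add_mul_repV_sq_ne_zero hq0 hq hτ m
  have h3 := pow_eight_add_repV_sq_ne_zero hq0 hq hτ m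
  have h1' : repV q τ m ^ 2 + 1 ≠ 0 := by rwa [add_comm]
  have h3' : repV q τ m ^ 2 + q ^ 8 ≠ 0 := by rwa [add_comm]
  have h4 : 1 + repV q τ m ^ 2 * q ^ 8 ≠ 0 := by rwa [mul_comm]
  have h5 : q ^ 8 * repV q τ m ^ 2 + 1 ≠ 0 := by rwa [add_comm]
  have h6 : repV q τ m ^ 2 * q ^ 8 + 1 ≠ 0 := by rwa [add_comm]
  -- As `repF` is linear in `X`, the identity splits into its leading coefficient `e1` and its
  -- constant term `e2`.
  have e1 : (1 + q ^ 8 * (repV q τ m)⁻¹ ^ 2) * (repD q τ m)⁻¹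
      + (1 + q ^ 8 * repV q τ m ^ 2) * (repD q τ (m + 1))⁻¹ = 1 := by
    simp only [repD, add_sub_cancel_right]
    rw [repV_pred hq0]
    generalize repV q τ m = Y at *
    field_simp
    ring
  have e2 : (1 + q ^ 8 * (repV q τ m)⁻¹ ^ 2) * (repD q τ m)⁻¹ * repR q κ τ m
      + (1 + q ^ 8 * repV q τ m ^ 2) * (repD q τ (m + 1))⁻¹ * repR q κ τ (m + 1)
      = q ^ 8 * (q ^ 2 + 1) * repE q τ m ^ 2
        - (q ^ 2 + 1) * (q ^ 4 + 1) * q ^ 4 * κ * repE q τ m := by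
    simp only [repD, repR, repE, add_sub_cancel_right]
    rw [repV_pred hq0]
    generalize repV q τ m = Y at *
    field_simp
    ring
  have e1' := congrArg (C : F → F[X]) e1
  have e2' := congrArg (C : F → F[X]) e2
  simp only [C_add, C_mul, C_1] at e1'
  rw [← e2']
  simp only [repF, C_add, C_mul, C_1]
  linear_combination X * e1'

include hq0 hq hτ in
theorem repF_rel_zy (m : ℤ) :
    C (repV q τ m + q ^ 8 * (repV q τ m)⁻¹) * repF q κ τ m
      - C ((repV q τ m)⁻¹ + q ^ 8 * repV q τ m) * repF q κ τ (m + 1)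
      = C (q ^ 6 * (q ^ 8 - 1) * (q ^ 2 + 1) * (repE q τ m - κ)) := by
  have h0 := repV_ne_zero hq0 hτ m
  have h1 := one_add_repV_sq_ne_zero hq0 hq hτ m
  have h2 := one_add_mul_repV_sq_ne_zero hq0 hq hτ m
  have h3 := pow_eight_add_repV_sq_ne_zero hq0 hq hτ m
  have h1' : repV q τ m ^ 2 + 1 ≠ 0 := by rwa [add_comm]
  have h3' : repV q τ m ^ 2 + q ^ 8 ≠ 0 := by rwa [add_comm]
  have h4 : 1 + repV q τ m ^ 2 * q ^ 8 ≠ 0 := by rwa [mul_comm]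
  have h5 : q ^ 8 * repV q τ m ^ 2 + 1 ≠ 0 := by rwa [add_comm]
  have h6 : repV q τ m ^ 2 * q ^ 8 + 1 ≠ 0 := by rwa [add_comm]
  have e1 : (repV q τ m + q ^ 8 * (repV q τ m)⁻¹) * (repD q τ m)⁻¹
      - ((repV q τ m)⁻¹ + q ^ 8 * repV q τ m) * (repD q τ (m + 1))⁻¹ = 0 := by
    simp only [repD, add_sub_cancel_right]
    rw [repV_pred hq0]
    generalize repV q τ m = Y at *
    field_simp
    ring
  have e2 : (repV q τ m + q ^ 8 * (repV q τ m)⁻¹) * (repD q τ m)⁻¹ * repR q κ τ m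
      - ((repV q τ m)⁻¹ + q ^ 8 * repV q τ m) * (repD q τ (m + 1))⁻¹ * repR q κ τ (m + 1)
      = -(q ^ 6 * (q ^ 8 - 1) * (q ^ 2 + 1) * (repE q τ m - κ)) := by
    simp only [repD, repR, repE, add_sub_cancel_right]
    rw [repV_pred hq0]
    generalize repV q τ m = Y at *
    field_simp
    ring
  have e1' := congrArg (C : F → F[X]) e1
  have e2' := congrArg (C : F → F[X]) e2
  simp only [C_add, C_sub, C_mul, C_0] at e1'
  rw [C_neg] at e2'
  rw [← neg_eq_iff_eq_neg] at e2'
  rw [← e2']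
  simp only [repF, C_add, C_sub, C_mul, C_1]
  linear_combination X * e1'

include hq0 hq hτ in
theorem normRel_rep : NormRel q κ (repX q τ) (repY q κ τ) (repZ q κ τ) := by
  have h0 := repV_ne_zero hq0 hτ
  refine ⟨?_, ?_, ?_⟩
  · refine LinearMap.ext fun f => funext fun m => ?_
    simp only [Module.End.mul_apply, LinearMap.sub_apply, LinearMap.smul_apply, Pi.sub_apply,
      Pi.smul_apply, repX_apply, repY_apply, repZ_apply, smul_eq_C_mul, ← C_mul, ← mul_assoc]
    have e1 : repE q τ (m - 1) = q ^ 4 * repE q τ m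
        - q ^ 4 * (q ^ 8 - 1) * (q⁻¹ ^ 2 * repV q τ m) := by
      rw [repE, repE, repV_pred hq0]; have := h0 m; field_simp; ring
    have e2 : repE q τ (m + 1) = q ^ 4 * repE q τ m
        + q ^ 4 * (q ^ 8 - 1) * (q⁻¹ ^ 2 * (repV q τ m)⁻¹) := by
      rw [repE, repE, repV_succ hq0]; have := h0 m; field_simp; ring
    rw [e1, e2]
    simp only [C_add, C_sub, C_mul]
    ring
  · refine LinearMap.ext fun f => funext fun m => ?_
    simp only [Module.End.mul_apply, LinearMap.add_apply, LinearMap.smul_apply, Pi.add_apply,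
      Pi.smul_apply, repX_apply, repY_apply, repZ_apply, smul_eq_C_mul, ← C_mul, ← mul_assoc]
    have e1 : repE q τ m * (q⁻¹ ^ 2 * repV q τ m)
        = q ^ 4 * (q⁻¹ ^ 2 * repV q τ m * repE q τ (m - 1)) + q ^ 4 * (q ^ 8 - 1) := by
      rw [repE, repE, repV_pred hq0]; have := h0 m; field_simp; ring
    have e2 : repE q τ m * (q⁻¹ ^ 2 * (repV q τ m)⁻¹)
        = q ^ 4 * (q⁻¹ ^ 2 * (repV q τ m)⁻¹ * repE q τ (m + 1)) - q ^ 4 * (q ^ 8 - 1) := by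
      rw [repE, repE, repV_succ hq0]; have := h0 m; field_simp; ring
    have e1' := congrArg (C : F → F[X]) e1
    have e2' := congrArg (C : F → F[X]) e2
    simp only [C_add, C_sub, C_mul] at e1' e2' ⊢
    linear_combination f (m - 1) * e1' - repF q κ τ (m + 1) * f (m + 1) * e2'
  · refine LinearMap.ext fun f => funext fun m => ?_
    simp only [Module.End.mul_apply, LinearMap.add_apply, LinearMap.sub_apply,
      LinearMap.smul_apply, Pi.add_apply, Pi.sub_apply, Module.End.one_apply,
      Pi.smul_apply, repX_apply, repY_apply, repZ_apply, smul_eq_C_mul, ← C_mul, ← mul_assoc,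
      sub_add_cancel, add_sub_cancel_right]
    -- The shifts by `±2` cancel by `e1` and `e2`; the terms without shift are collected by `e3`,
    -- `e4`, `e5` into `repF_rel_zy`.
    have e := repF_rel_zy (κ := κ) hq0 hq hτ m
    have e1 : q ^ 4 * (q⁻¹ ^ 2 * repV q τ (m - 1)) = q⁻¹ ^ 2 * repV q τ m := by
      rw [repV_pred hq0]; field_simp
    have e2 : q ^ 4 * (q⁻¹ ^ 2 * (repV q τ (m + 1))⁻¹) = q⁻¹ ^ 2 * (repV q τ m)⁻¹ := by
      rw [repV_succ hq0]; have := h0 m; field_simp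
    have e3 : q ^ 4 * (q⁻¹ ^ 2 * (repV q τ (m - 1))⁻¹) + q⁻¹ ^ 2 * repV q τ m
        = q⁻¹ ^ 2 * (repV q τ m + q ^ 8 * (repV q τ m)⁻¹) := by
      rw [repV_pred hq0]; have := h0 m; field_simp; ring
    have e4 : q ^ 4 * (q⁻¹ ^ 2 * repV q τ (m + 1)) + q⁻¹ ^ 2 * (repV q τ m)⁻¹
        = q⁻¹ ^ 2 * ((repV q τ m)⁻¹ + q ^ 8 * repV q τ m) := by
      rw [repV_succ hq0]; have := h0 m; field_simp; ring
    have e5 : q ^ 4 * (q ^ 8 - 1) * (q ^ 2 + 1) * (repE q τ m - κ)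
        = q⁻¹ ^ 2 * (q ^ 6 * (q ^ 8 - 1) * (q ^ 2 + 1) * (repE q τ m - κ)) := by
      field_simp
    have e1' := congrArg (C : F → F[X]) e1
    have e2' := congrArg (C : F → F[X]) e2
    have e3' := congrArg (C : F → F[X]) e3
    have e4' := congrArg (C : F → F[X]) e4
    have e5' := congrArg (C : F → F[X]) e5
    rw [C_mul (a := q⁻¹ ^ 2)] at e3' e4' e5'
    rw [← e] at e5'
    rw [C_add, C_mul] at e3' e4'
    rw [C_mul] at e1' e2'
    rw [mul_sub _ (repE q τ m) κ, C_sub] at e5'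
    linear_combination (-f (m - 1 - 1)) * e1' + (f m * repF q κ τ m) * e3' + (f (m + 1 + 1) * repF q κ τ (m + 1) * repF q κ τ (m + 1 + 1)) * e2' - (f m * repF q κ τ (m + 1)) * e4' - f m * e5'

include hq0 hq hτ in
theorem casT_rep : casT q κ (repX q τ) (repY q κ τ) (repZ q κ τ)
    = algebraMap F[X] (Module.End F[X] (ℤ → F[X])) X := by
  have h0 := repV_ne_zero hq0 hτ
  refine LinearMap.ext fun f => funext fun m => ?_
  simp only [casT, Module.End.mul_apply, LinearMap.add_apply, LinearMap.sub_apply,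
    LinearMap.smul_apply, Pi.add_apply, Pi.sub_apply, Module.End.one_apply,
    Pi.smul_apply, repX_apply, repY_apply, repZ_apply, smul_eq_C_mul, ← C_mul, ← mul_assoc,
    sub_add_cancel, add_sub_cancel_right, Module.algebraMap_end_apply, smul_eq_mul]
  have e := repF_rel_casT (κ := κ) hq0 hq hτ m
  have e1 : repE q τ m * (q⁻¹ ^ 2 * repV q τ (m - 1)) + 1
      = q ^ 8 * (q⁻¹ ^ 2 * repV q τ m * (q⁻¹ ^ 2 * repV q τ (m - 1))) := by
    rw [repE, repV_pred hq0]; have := h0 m; field_simp; ring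
  have e2 : 1 - repE q τ m * (q⁻¹ ^ 2 * (repV q τ (m + 1))⁻¹)
      = q ^ 8 * (q⁻¹ ^ 2 * (repV q τ m)⁻¹ * (q⁻¹ ^ 2 * (repV q τ (m + 1))⁻¹)) := by
    rw [repE, repV_succ hq0]; have := h0 m; field_simp; ring
  have e3 : 1 - repE q τ m * (q⁻¹ ^ 2 * (repV q τ (m - 1))⁻¹)
      + q ^ 8 * (q⁻¹ ^ 2 * repV q τ m * (q⁻¹ ^ 2 * (repV q τ (m - 1))⁻¹))
      = 1 + q ^ 8 * (repV q τ m)⁻¹ ^ 2 := by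
    rw [repE, repV_pred hq0]; have := h0 m; field_simp; ring
  have e4 : 1 + repE q τ m * (q⁻¹ ^ 2 * repV q τ (m + 1))
      + q ^ 8 * (q⁻¹ ^ 2 * (repV q τ m)⁻¹ * (q⁻¹ ^ 2 * repV q τ (m + 1)))
      = 1 + q ^ 8 * repV q τ m ^ 2 := by
    rw [repE, repV_succ hq0]; have := h0 m; field_simp; ring
  have e1' := congrArg (C : F → F[X]) e1
  have e2' := congrArg (C : F → F[X]) e2
  rw [← e3, ← e4] at e
  simp only [C_add, C_sub, C_mul, C_pow, C_1] at e e1' e2' ⊢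
  linear_combination f (m - 1 - 1) * e1' + f m * e + (f (m + 1 + 1) * repF q κ τ (m + 1) * repF q κ τ (m + 1 + 1)) * e2'

end
end DynK

end

/-! ### Symbols: the coefficient of the highest shift. -/

noncomputable section

namespace DynK

open Polynomial

section
variable {F : Type*} [Field F]

/-- `U` raises the upper end of the support of a function by at most `N`, and `g` is its symbol
in this degree. -/
def HasSym (N : ℕ) (U : Module.End F[X] (ℤ → F[X])) (g : ℤ → F[X]) : Prop :=
  ∀ (k : ℤ) (f : ℤ → F[X]), (∀ m, k < m → f m = 0) →
    (∀ m, k + N < m → U f m = 0) ∧ U f (k + N) = g (k + N) * f k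

namespace HasSym

variable {N M : ℕ} {U V : Module.End F[X] (ℤ → F[X])} {g h : ℤ → F[X]}

theorem zero (N : ℕ) : HasSym N (0 : Module.End F[X] (ℤ → F[X])) 0 := fun k f _ => by simp

theorem add (hU : HasSym N U g) (hV : HasSym N V h) : HasSym N (U + V) (g + h) := by
  intro k f hf
  obtain ⟨h1, h2⟩ := hU k f hf
  obtain ⟨h3, h4⟩ := hV k f hf
  refine ⟨fun m hm => by simp [h1 m hm, h3 m hm], ?_⟩
  simp only [LinearMap.add_apply, Pi.add_apply, h2, h4, add_mul]

theorem neg (hU : HasSym N U g) : HasSym N (-U) (-g) := by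
  intro k f hf
  obtain ⟨h1, h2⟩ := hU k f hf
  exact ⟨fun m hm => by simp [h1 m hm], by simp [h2]⟩

theorem sub (hU : HasSym N U g) (hV : HasSym N V h) : HasSym N (U - V) (g - h) := by
  rw [sub_eq_add_neg, sub_eq_add_neg]; exact hU.add hV.neg

theorem smul (c : F) (hU : HasSym N U g) : HasSym N (c • U) (fun m => C c * g m) := by
  intro k f hf
  obtain ⟨h1, h2⟩ := hU k f hf
  refine ⟨fun m hm => by simp [h1 m hm], ?_⟩
  simp only [LinearMap.smul_apply, Pi.smul_apply, h2, smul_eq_C_mul, mul_assoc]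

/-- `V` moves the top of the support first, so its symbol is read `N` places below the final
position. -/
theorem mul (hU : HasSym N U g) (hV : HasSym M V h) :
    HasSym (N + M) (U * V) (fun m => g m * h (m - N)) := by
  intro k f hf
  obtain ⟨h1, h2⟩ := hV k f hf
  obtain ⟨h3, h4⟩ := hU (k + M) (V f) h1
  have e : k + ((N + M : ℕ) : ℤ) = k + M + N := by push_cast; ring
  rw [e, Module.End.mul_apply]
  refine ⟨h3, ?_⟩
  beta_reduce
  rw [h4, h2, add_sub_cancel_right, mul_assoc]

/-- Terms of lower degree are invisible in the symbol; this is what discards them when leading parts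
are compared. -/
theorem succ (hU : HasSym N U g) : HasSym (N + 1) U 0 := by
  intro k f hf
  obtain ⟨h1, -⟩ := hU k f hf
  exact ⟨fun m hm => h1 m (by push_cast at hm; omega), by
    rw [h1 _ (by push_cast; omega)]; simp⟩

theorem unique (hU : HasSym N U g) (hV : HasSym N U h) : g = h := by
  funext m
  -- Testing on the function concentrated at `m - N` reads off the symbol at `m`.
  have hf : ∀ n, m - N < n → Pi.single (M := fun _ => F[X]) (m - N) 1 n = 0 := fun n hn => by
    rw [Pi.single_eq_of_ne (by omega)]
  have h1 := (hU (m - N) _ hf).2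
  have h2 := (hV (m - N) _ hf).2
  rw [h1] at h2
  simpa using h2

theorem congr (hU : HasSym N U g) (e : g = h) : HasSym N U h := e ▸ hU

end HasSym

theorem hasSym_algebraMap (c : F[X]) : HasSym 0 (algebraMap F[X] _ c) (fun _ => c) := by
  intro k f hf
  refine ⟨fun m hm => ?_, by simp⟩
  simp [hf m (by simpa using hm)]

theorem hasSym_one : HasSym (F := F) 0 1 (fun _ => 1) := by
  simpa using hasSym_algebraMap (1 : F[X])

variable {q κ τ : F}

theorem hasSym_repX : HasSym 0 (repX q τ) (fun m => C (repE q τ m)) := by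
  intro k f hf
  refine ⟨fun m hm => ?_, by simp [repX_apply]⟩
  simp [repX_apply, hf m (by simpa using hm)]

theorem hasSym_repY : HasSym 1 (repY q κ τ) (fun _ => 1) := by
  intro k f hf
  refine ⟨fun m hm => ?_, ?_⟩
  · push_cast at hm
    simp [repY_apply, hf (m - 1) (by omega), hf (m + 1) (by omega)]
  · simp [repY_apply, hf (k + 1 + 1) (by omega)]

theorem hasSym_repZ : HasSym 1 (repZ q κ τ) (fun m => C (q⁻¹ ^ 2 * repV q τ m)) := by
  intro k f hf
  refine ⟨fun m hm => ?_, ?_⟩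
  · push_cast at hm
    simp [repZ_apply, hf (m - 1) (by omega), hf (m + 1) (by omega)]
  · simp [repZ_apply, hf (k + 1 + 1) (by omega)]

theorem hasSym_repY_pow (j : ℕ) : HasSym j (repY q κ τ ^ j) (fun _ => 1) := by
  induction j with
  | zero => simpa using hasSym_one
  | succ j ih =>
    rw [pow_succ]
    simpa using ih.mul hasSym_repY

/-- The symbol of an element of the filtration. -/
def symPQ (q τ : F) (P Q : F[X][X]) (m : ℤ) : F[X] :=
  P.eval (C (repE q τ m)) + Q.eval (C (repE q τ m)) * C (q⁻¹ ^ 2 * repV q τ m)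

section
variable (hq0 : q ≠ 0) (hq : ∀ n : ℕ, 0 < n → q ^ n ≠ 1) (hτ : τ ^ 2 = -q ^ 4)

include hq0 hq in
theorem repV_injective (hτ0 : τ ≠ 0) : Function.Injective (repV q τ) := by
  intro m n e
  have e1 : (q ^ 4) ^ m = (q ^ 4) ^ n := mul_left_cancel₀ hτ0 e
  by_contra hne
  have h4 := pow_ne_zero 4 hq0
  have : (q ^ 4) ^ (m - n) = 1 := by rw [zpow_sub₀ h4, e1, div_self (zpow_ne_zero _ h4)]
  rw [← zpow_natCast, ← zpow_mul] at this
  exact zpow_ne_one_of_forall hq (by push_cast; omega) this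

-- The choice `τ ^ 2 = -q ^ 4` makes `repV (-1 - m) * repV m = -1`, so the spectrum of `x` is
-- symmetric under `m ↦ -1 - m` and each eigenvalue occurs exactly twice.
include hq0 hτ in
theorem repV_neg (m : ℤ) : repV q τ (-1 - m) = -(repV q τ m)⁻¹ := by
  have h0 := repV_ne_zero hq0 hτ m
  have h4 := pow_ne_zero 4 hq0
  rw [eq_neg_iff_add_eq_zero, ← mul_left_inj' h0, add_mul, inv_mul_cancel₀ h0, zero_mul]
  have : repV q τ (-1 - m) * repV q τ m = τ ^ 2 * ((q ^ 4) ^ (-1 - m) * (q ^ 4) ^ m) := by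
    rw [repV, repV]; ring
  rw [this, ← zpow_add₀ h4, hτ]
  simp [h4]

include hq0 hτ in
theorem repE_neg (m : ℤ) : repE q τ (-1 - m) = repE q τ m := by
  rw [repE, repE, repV_neg hq0 hτ, inv_neg, inv_inv]; ring

include hq0 hq hτ in
theorem repE_eq_iff {m n : ℤ} : repE q τ m = repE q τ n ↔ m = n ∨ m = -1 - n := by
  refine ⟨fun e => ?_, ?_⟩
  · have hm := repV_ne_zero hq0 hτ m
    have hn := repV_ne_zero hq0 hτ n
    have hi := repV_injective hq0 hq (tau_ne_zero hq0 hτ)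
    rw [repE, repE] at e
    have e' := mul_left_cancel₀ (pow_ne_zero 6 hq0) e
    have : (repV q τ m - repV q τ n) * (repV q τ m + (repV q τ n)⁻¹) = 0 := by
      field_simp at e' ⊢
      linear_combination e'
    rcases mul_eq_zero.1 this with h | h
    · exact Or.inl (hi (sub_eq_zero.1 h))
    · refine Or.inr (hi ?_)
      rw [repV_neg hq0 hτ]; exact eq_neg_of_add_eq_zero_left h
  · rintro (rfl | rfl)
    exacts [rfl, repE_neg hq0 hτ n]

include hq0 hq hτ in
theorem eq_zero_of_eval_repE {P : F[X][X]} (hP : ∀ m : ℤ, P.eval (C (repE q τ m)) = 0) :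
    P = 0 := by
  refine Polynomial.eq_zero_of_infinite_isRoot _ (Set.infinite_of_injective_forall_mem
    (f := fun n : ℕ => (C (repE q τ n) : F[X])) (fun a b e => ?_) fun n => hP n)
  rcases (repE_eq_iff hq0 hq hτ).1 (C_injective e) with h | h <;> omega

-- The positions `m` and `-1 - m` share the eigenvalue of `x` but not the value of `repV`, so the
-- difference of the two values isolates `Q`. A polynomial vanishing at infinitely many eigenvalues
-- is zero.
include hq0 hq hτ in
theorem symPQ_eq_zero {P Q : F[X][X]} (h : symPQ q τ P Q = 0) : P = 0 ∧ Q = 0 := by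
  have hQ : Q = 0 := by
    refine eq_zero_of_eval_repE hq0 hq hτ fun m => ?_
    have h1 := congrFun h m
    have h2 := congrFun h (-1 - m)
    rw [symPQ, Pi.zero_apply] at h1 h2
    rw [repE_neg hq0 hτ] at h2
    have h3 : Q.eval (C (repE q τ m))
        * C (q⁻¹ ^ 2 * repV q τ m - q⁻¹ ^ 2 * repV q τ (-1 - m)) = 0 := by
      rw [C_sub]; linear_combination h1 - h2
    refine (mul_eq_zero.1 h3).resolve_right ?_
    rw [← ne_eq, C_ne_zero, ← mul_sub]
    refine mul_ne_zero (pow_ne_zero _ (inv_ne_zero hq0)) (sub_ne_zero.2 fun e => ?_)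
    have := repV_injective hq0 hq (tau_ne_zero hq0 hτ) e
    omega
  refine ⟨eq_zero_of_eval_repE hq0 hq hτ fun m => ?_, hQ⟩
  simpa [symPQ, hQ] using congrFun h m

include hq0 hq hτ in
/-- The odd powers of `q ^ 2` are no symbols. -/
theorem eq_zero_of_symPQ_eq_zpow {P Q : F[X][X]} {c : F[X]}
    (h : ∀ m : ℤ, c * C ((q ^ 2) ^ m) = symPQ q τ P Q m) : c = 0 := by
  have h2 : q ^ 2 ≠ 0 := pow_ne_zero 2 hq0
  have hτ0 := tau_ne_zero hq0 hτ
  -- With `s = q ^ (2 m)` one has `repV = τ s²`, so `c` will be `Q(E)` times a constant times `s + 1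
  -- / (q² s)`. The square of that last factor is a linear function of the eigenvalue `E`.
  have key : ∀ m : ℤ, c ^ 2 = (Q.eval (C (repE q τ m))) ^ 2 *
      C (-q ^ 4 * q⁻¹ ^ 4 * (repE q τ m * (q ^ 6 * τ)⁻¹ + 2 * q⁻¹ ^ 2)) := by
    intro m
    set s := (q ^ 2) ^ m with hs
    have hs0 : s ≠ 0 := zpow_ne_zero _ h2
    have hV : repV q τ m = τ * s ^ 2 := by
      rw [repV, hs, ← zpow_natCast, ← zpow_natCast, ← zpow_mul, ← zpow_natCast _ 2, ← zpow_mul,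
        ← zpow_mul]; congr 2; push_cast; ring
    have h1 := h m
    have h3 := h (-1 - m)
    have hs' : (q ^ 2) ^ (-1 - m) = (q ^ 2 * s)⁻¹ := by
      rw [zpow_sub₀ h2, zpow_neg_one, mul_inv, div_eq_mul_inv]
    rw [symPQ, repE_neg hq0 hτ, repV_neg hq0 hτ, hV, hs'] at h3
    rw [symPQ, hV, ← hs] at h1
    have hti : τ⁻¹ = -τ * q⁻¹ ^ 4 := by
      field_simp; linear_combination hτ
    -- Subtracting the values at `m` and `-1 - m` removes `P`; both sides contain the nonzero factor
    -- `s - 1 / (q² s)`.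
    have e : c * C (s - (q ^ 2 * s)⁻¹) = Q.eval (C (repE q τ m)) *
        C (q⁻¹ ^ 2 * τ * (s + (q ^ 2 * s)⁻¹) * (s - (q ^ 2 * s)⁻¹)) := by
      have e' : q⁻¹ ^ 2 * τ * (s + (q ^ 2 * s)⁻¹) * (s - (q ^ 2 * s)⁻¹)
          = q⁻¹ ^ 2 * (τ * s ^ 2) - q⁻¹ ^ 2 * -(τ * s ^ 2)⁻¹ := by
        rw [mul_inv τ, hti]; field_simp; ring
      rw [e', C_sub, C_sub]; linear_combination h1 - h3
    rw [C_mul, ← mul_assoc] at e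
    have hne : s - (q ^ 2 * s)⁻¹ ≠ 0 := by
      intro e0
      have : q ^ (4 * m + 2) = 1 := by
        have e1 : q ^ 2 * s * s = 1 := by
          rw [sub_eq_zero] at e0; nth_rewrite 2 [e0]; exact mul_inv_cancel₀ (mul_ne_zero h2 hs0)
        rw [← e1, hs, ← zpow_natCast, ← zpow_mul, ← zpow_add₀ hq0, ← zpow_add₀ hq0]
        congr 1; push_cast; ring
      exact zpow_ne_one_of_forall hq (by omega) this
    have e2 := mul_right_cancel₀ (C_ne_zero.2 hne) e
    have e3 : -q ^ 4 * q⁻¹ ^ 4 * (repE q τ m * (q ^ 6 * τ)⁻¹ + 2 * q⁻¹ ^ 2)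
        = (q⁻¹ ^ 2 * τ * (s + (q ^ 2 * s)⁻¹)) ^ 2 := by
      have e4 : repE q τ m * (q ^ 6 * τ)⁻¹ = s ^ 2 - (τ ^ 2)⁻¹ * s⁻¹ ^ 2 := by
        rw [repE, hV]; field_simp
      rw [e4, mul_pow, mul_pow, hτ]
      field_simp
      ring
    rw [e2, e3, mul_pow, C_pow]
  have hL : (-q ^ 4 * q⁻¹ ^ 4 * (q ^ 6 * τ)⁻¹) ≠ 0 := by simp [hq0, hτ0]
  have hP : C (c ^ 2) - Q ^ 2 * (C (C (-q ^ 4 * q⁻¹ ^ 4 * (q ^ 6 * τ)⁻¹)) * X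
      + C (C (-q ^ 4 * q⁻¹ ^ 4 * (2 * q⁻¹ ^ 2)))) = 0 := by
    refine eq_zero_of_eval_repE hq0 hq hτ fun m => ?_
    simp only [eval_sub, eval_C, eval_mul, eval_pow, eval_add, eval_X, ← C_mul, ← C_add]
    rw [key m, sub_eq_zero]
    congr 2
    ring
  -- A parity argument: the constant `c ^ 2` has degree `0`, whereas `Q ^ 2` times a linear
  -- polynomial has odd degree unless `Q = 0`.
  have hP' := congrArg natDegree (sub_eq_zero.1 hP)
  by_cases hQ : Q = 0
  · rw [hQ] at hP
    simpa using hP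
  · have hL' : natDegree (C (C (-q ^ 4 * q⁻¹ ^ 4 * (q ^ 6 * τ)⁻¹)) * X
      + C (C (-q ^ 4 * q⁻¹ ^ 4 * (2 * q⁻¹ ^ 2))) : F[X][X]) = 1 :=
      natDegree_linear (C_ne_zero.2 hL)
    rw [natDegree_C, natDegree_mul (pow_ne_zero 2 hQ) (fun e => by rw [e, natDegree_zero] at hL'; exact zero_ne_one hL'), hL'] at hP'
    omega

end
end
end DynK

end

/-! ### Faithfulness of the representation and regularity of polynomials in the Casimir element. -/

noncomputable section

namespace DynK

open Polynomial

section
variable {F : Type*} [Field F] {A : Type*} [Ring A] [Algebra F A] {q κ τ : F} {x y z : A}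

/-- Polynomials in the Casimir element and in `x`. -/
def NormRel.ev (h : NormRel q κ x y z) (hq0 : q ≠ 0) : F[X][X] →+* A :=
  eval₂RingHom' (aeval (casT q κ x y z) : F[X] →ₐ[F] A).toRingHom x fun a => by
    induction a using Polynomial.induction_on' with
    | add p r hp hr => simpa using hp.add_left hr
    | monomial n c =>
      have : Commute (casT q κ x y z ^ n) x := Commute.pow_left (h.casT_mul_x hq0) n
      simpa [aeval_monomial, ← Algebra.smul_def] using this.smul_left c

theorem NormRel.ev_C (h : NormRel q κ x y z) (hq0 : q ≠ 0) (f : F[X]) :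
    h.ev hq0 (C f) = aeval (casT q κ x y z) f := by
  simp [NormRel.ev]

theorem NormRel.ev_X (h : NormRel q κ x y z) (hq0 : q ≠ 0) : h.ev hq0 X = x := by
  simp [NormRel.ev]

theorem NormRel.ev_C_X_pow_mul (h : NormRel q κ x y z) (hq0 : q ≠ 0) (n i : ℕ) :
    h.ev hq0 (C (X ^ n) * X ^ i) = casT q κ x y z ^ n * x ^ i := by
  rw [map_mul, h.ev_C, map_pow, map_pow, h.ev_X, aeval_X]

theorem NormRel.ev_C_C_mul (h : NormRel q κ x y z) (hq0 : q ≠ 0) (c : F) (P : F[X][X]) :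
    h.ev hq0 (C (C c) * P) = c • h.ev hq0 P := by
  rw [map_mul, h.ev_C, aeval_C, Algebra.smul_def]

theorem exists_top_of_mem_filt (h : NormRel q κ x y z) (hq0 : q ≠ 0) {N : ℕ} {a : A}
    (ha : a ∈ filt q κ x y z (N + 1)) : ∃ P Q : F[X][X], ∃ b ∈ filt q κ x y z N,
      a = h.ev hq0 P * y ^ (N + 1) + h.ev hq0 Q * (z * y ^ N) + b := by
  refine Submodule.span_induction ?_ ?_ ?_ ?_ ha
  · rintro w ⟨n, i, j, ⟨hj, rfl⟩ | ⟨hj, rfl⟩⟩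
    · rcases Nat.lt_or_ge N j with hj' | hj'
      · obtain rfl : j = N + 1 := by omega
        refine ⟨C (X ^ n) * X ^ i, 0, 0, Submodule.zero_mem _, ?_⟩
        rw [h.ev_C_X_pow_mul]; simp [mul_assoc]
      · exact ⟨0, 0, _, pow_mem_filt hj' n i, by simp⟩
    · rcases Nat.lt_or_ge N (j + 1) with hj' | hj'
      · obtain rfl : j = N := by omega
        refine ⟨0, C (X ^ n) * X ^ i, 0, Submodule.zero_mem _, ?_⟩
        rw [h.ev_C_X_pow_mul]; simp [mul_assoc]
      · exact ⟨0, 0, _, z_pow_mem_filt hj' n i, by simp⟩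
  · exact ⟨0, 0, 0, Submodule.zero_mem _, by simp⟩
  · rintro a b - - ⟨P, Q, c, hc, rfl⟩ ⟨P', Q', c', hc', rfl⟩
    refine ⟨P + P', Q + Q', c + c', Submodule.add_mem _ hc hc', ?_⟩
    rw [map_add, map_add]; simp only [add_mul]; abel
  · rintro r a - ⟨P, Q, c, hc, rfl⟩
    refine ⟨C (C r) * P, C (C r) * Q, r • c, Submodule.smul_mem _ _ hc, ?_⟩
    simp only [h.ev_C_C_mul, smul_add, smul_mul_assoc]

theorem exists_ev_of_mem_filt_zero (h : NormRel q κ x y z) (hq0 : q ≠ 0) {a : A}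
    (ha : a ∈ filt q κ x y z 0) : ∃ P : F[X][X], a = h.ev hq0 P := by
  refine Submodule.span_induction ?_ ?_ ?_ ?_ ha
  · rintro w ⟨n, i, j, ⟨hj, rfl⟩ | ⟨hj, rfl⟩⟩
    · obtain rfl : j = 0 := by omega
      exact ⟨C (X ^ n) * X ^ i, by rw [h.ev_C_X_pow_mul]; simp⟩
    · omega
  · exact ⟨0, by simp⟩
  · rintro a b - - ⟨P, rfl⟩ ⟨P', rfl⟩
    exact ⟨P + P', by rw [map_add]⟩
  · rintro r a - ⟨P, rfl⟩
    exact ⟨C (C r) * P, by rw [h.ev_C_C_mul]⟩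

/-- An algebra map compatible with the representation on functions. -/
structure IsRep (q κ τ : F) (x y z : A) (Φ : A →ₐ[F] Module.End F[X] (ℤ → F[X])) : Prop where
  rel : NormRel q κ x y z
  q_ne : q ≠ 0
  q_pow : ∀ n : ℕ, 0 < n → q ^ n ≠ 1
  tau_sq : τ ^ 2 = -q ^ 4
  map_x : Φ x = repX q τ
  map_y : Φ y = repY q κ τ
  map_z : Φ z = repZ q κ τ
  adjoin_eq : Algebra.adjoin F {x, y, z} = ⊤

namespace IsRep

variable {Φ : A →ₐ[F] Module.End F[X] (ℤ → F[X])}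

theorem map_casT (H : IsRep q κ τ x y z Φ) :
    Φ (casT q κ x y z) = algebraMap F[X] (Module.End F[X] (ℤ → F[X])) X := by
  rw [← casT_rep (κ := κ) H.q_ne H.q_pow H.tau_sq]
  simp only [casT, map_add, map_sub, map_mul, map_smul, H.map_x, H.map_y, H.map_z]

theorem map_aeval_casT (H : IsRep q κ τ x y z Φ) (f : F[X]) :
    Φ (aeval (casT q κ x y z) f) = algebraMap F[X] (Module.End F[X] (ℤ → F[X])) f := by
  induction f using Polynomial.induction_on' with
  | add p r hp hr => rw [map_add, map_add, hp, hr, map_add]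
  | monomial n c =>
    rw [aeval_monomial, map_mul, map_pow, H.map_casT, AlgHom.commutes, ← map_pow,
      ← C_mul_X_pow_eq_monomial, map_mul]
    congr 1
    refine LinearMap.ext fun f => funext fun m => ?_
    simp [Module.algebraMap_end_apply, smul_eq_C_mul]

theorem hasSym_ev (H : IsRep q κ τ x y z Φ) (P : F[X][X]) :
    HasSym 0 (Φ (H.rel.ev H.q_ne P)) (fun m => P.eval (C (repE q τ m))) := by
  induction P using Polynomial.induction_on' with
  | add p r hp hr =>
    rw [map_add, map_add]
    exact (hp.add hr).congr (by funext m; simp)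
  | monomial n c =>
    rw [← C_mul_X_pow_eq_monomial, map_mul, H.rel.ev_C, map_mul, H.map_aeval_casT]
    have hx : HasSym 0 (Φ (H.rel.ev H.q_ne (X ^ n))) (fun m => C (repE q τ m) ^ n) := by
      rw [map_pow, map_pow, H.rel.ev_X, H.map_x]
      induction n with
      | zero => simpa using hasSym_one
      | succ n ih => simpa [pow_succ] using ih.mul (hasSym_repX (q := q) (τ := τ))
    simpa using (hasSym_algebraMap c).mul hx

theorem hasSym_top (H : IsRep q κ τ x y z Φ) (N : ℕ) (P Q : F[X][X]) :
    HasSym (N + 1) (Φ (H.rel.ev H.q_ne P * y ^ (N + 1) + H.rel.ev H.q_ne Q * (z * y ^ N)))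
      (symPQ q τ P Q) := by
  rw [map_add, map_mul, map_mul, map_mul, map_pow, map_pow, H.map_y, H.map_z]
  have h1 := (H.hasSym_ev P).mul (hasSym_repY_pow (q := q) (κ := κ) (τ := τ) (N + 1))
  have h2 := (H.hasSym_ev Q).mul ((hasSym_repZ (q := q) (κ := κ) (τ := τ)).mul
    (hasSym_repY_pow (q := q) (κ := κ) (τ := τ) N))
  rw [zero_add] at h1 h2
  rw [add_comm 1 N] at h2
  refine (h1.add h2).congr ?_
  funext m
  simp [symPQ]

theorem hasSym_of_mem_filt (H : IsRep q κ τ x y z Φ) {N : ℕ} {a : A}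
    (ha : a ∈ filt q κ x y z N) : ∃ P Q, HasSym N (Φ a) (symPQ q τ P Q) := by
  induction N generalizing a with
  | zero =>
    obtain ⟨P, rfl⟩ := exists_ev_of_mem_filt_zero H.rel H.q_ne ha
    exact ⟨P, 0, (H.hasSym_ev P).congr (by funext m; simp [symPQ])⟩
  | succ N ih =>
    obtain ⟨P, Q, b, hb, rfl⟩ := exists_top_of_mem_filt H.rel H.q_ne ha
    obtain ⟨P', Q', hb'⟩ := ih hb
    refine ⟨P, Q, ?_⟩
    rw [map_add Φ]
    simpa using (H.hasSym_top N P Q).add hb'.succ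

/-- The symbol determines both coefficient polynomials of the leading part, so a vanishing symbol
removes that part. -/
theorem mem_filt_of_hasSym_zero (H : IsRep q κ τ x y z Φ) {N : ℕ} {a : A}
    (ha : a ∈ filt q κ x y z (N + 1)) (h0 : HasSym (N + 1) (Φ a) 0) : a ∈ filt q κ x y z N := by
  obtain ⟨P, Q, b, hb, rfl⟩ := exists_top_of_mem_filt H.rel H.q_ne ha
  obtain ⟨P', Q', hb'⟩ := H.hasSym_of_mem_filt hb
  have h1 := (H.hasSym_top N P Q).add hb'.succ
  rw [← map_add Φ, add_zero] at h1
  obtain ⟨rfl, rfl⟩ := symPQ_eq_zero H.q_ne H.q_pow H.tau_sq (h1.unique h0)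
  simpa using hb

theorem eq_zero_of_hasSym_zero (H : IsRep q κ τ x y z Φ) {a : A}
    (ha : a ∈ filt q κ x y z 0) (h0 : HasSym 0 (Φ a) 0) : a = 0 := by
  obtain ⟨P, rfl⟩ := exists_ev_of_mem_filt_zero H.rel H.q_ne ha
  have h1 := (H.hasSym_ev P).unique h0
  rw [eq_zero_of_eval_repE H.q_ne H.q_pow H.tau_sq fun m => congrFun h1 m, map_zero]

/-- All symbols of the zero operator vanish, so the degree can be lowered step by step. -/
theorem eq_zero_of_map_eq_zero (H : IsRep q κ τ x y z Φ) {a : A} (h0 : Φ a = 0) : a = 0 := by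
  obtain ⟨N, hN⟩ := H.rel.exists_mem_filt H.q_ne H.adjoin_eq a
  induction N with
  | zero => exact H.eq_zero_of_hasSym_zero hN (by rw [h0]; exact HasSym.zero 0)
  | succ N ih => exact ih (H.mem_filt_of_hasSym_zero hN (by rw [h0]; exact HasSym.zero _))

theorem injective (H : IsRep q κ τ x y z Φ) : Function.Injective Φ :=
  (injective_iff_map_eq_zero Φ).2 fun _ => H.eq_zero_of_map_eq_zero

/-- An element of degree `0` with constant symbol is a polynomial in the Casimir element. -/
theorem eq_aeval_of_hasSym_const (H : IsRep q κ τ x y z Φ) {a : A}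
    (ha : a ∈ filt q κ x y z 0) {c : F[X]} (h0 : HasSym 0 (Φ a) (fun _ => c)) :
    a = aeval (casT q κ x y z) c := by
  obtain ⟨P, rfl⟩ := exists_ev_of_mem_filt_zero H.rel H.q_ne ha
  have h1 := (H.hasSym_ev P).unique h0
  have : P - C c = 0 := eq_zero_of_eval_repE H.q_ne H.q_pow H.tau_sq fun m => by
    simpa [sub_eq_zero] using congrFun h1 m
  rw [sub_eq_zero.1 this, H.rel.ev_C]

/-- Nonzero polynomials in the Casimir element are no zero divisors. -/
theorem isRegular_aeval (H : IsRep q κ τ x y z Φ) {f : F[X]} (hf : f ≠ 0) :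
    IsRegular (aeval (casT q κ x y z) f) := by
  have key : ∀ a : A, algebraMap F[X] (Module.End F[X] (ℤ → F[X])) f * Φ a = 0 → a = 0 := by
    intro a ha
    refine H.eq_zero_of_map_eq_zero (LinearMap.ext fun g => funext fun m => ?_)
    have := congrFun (LinearMap.congr_fun ha g) m
    simpa [Module.algebraMap_end_apply, hf] using this
  refine ⟨fun a b e => ?_, fun a b e => ?_⟩
  · have e' : aeval (casT q κ x y z) f * (a - b) = 0 := by
      rw [mul_sub]; exact sub_eq_zero.2 e
    refine sub_eq_zero.1 (key _ ?_)
    rw [← H.map_aeval_casT, ← map_mul, e', map_zero]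
  · have e' : (a - b) * aeval (casT q κ x y z) f = 0 := by
      rw [sub_mul]; exact sub_eq_zero.2 e
    refine sub_eq_zero.1 (key _ ?_)
    rw [Algebra.commutes, ← H.map_aeval_casT, ← map_mul, e', map_zero]

end IsRep
end
end DynK

end

/-! ### Equations for the symbols of an intertwiner. -/

noncomputable section

namespace DynK

open Polynomial

section
variable {F : Type*} [Field F] {q τ : F}

section
variable (hq0 : q ≠ 0) (hq : ∀ n : ℕ, 0 < n → q ^ n ≠ 1) (hτ : τ ^ 2 = -q ^ 4)

-- Reflecting `m` to `-1 - m` turns negative powers into positive ones and keeps the space of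
-- symbols, because `-repV⁻¹` is a multiple of the eigenvalue of `x` minus `repV`. This gives the
-- new pair `P + q⁻⁸ X Q`, `-Q`.
include hq0 hq hτ in
theorem eq_zero_of_symPQ_eq_zpow_neg {P Q : F[X][X]} {c : F[X]}
    (h : ∀ m : ℤ, c * C ((q⁻¹ ^ 2) ^ m) = symPQ q τ P Q m) : c = 0 := by
  have h2 : q ^ 2 ≠ 0 := pow_ne_zero 2 hq0
  have : c * C (q ^ 2) = 0 := by
    refine eq_zero_of_symPQ_eq_zpow (P := P + C (C (q⁻¹ ^ 8)) * X * Q) (Q := -Q) hq0 hq hτ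
      fun m => ?_
    have h1 := h (-1 - m)
    rw [symPQ, repE_neg hq0 hτ, repV_neg hq0 hτ] at h1
    have e1 : (q⁻¹ ^ 2) ^ (-1 - m) = q ^ 2 * (q ^ 2) ^ m := by
      rw [inv_pow, inv_zpow, ← zpow_neg, neg_sub, sub_neg_eq_add, zpow_add_one₀ h2, mul_comm]
    have e2 : q⁻¹ ^ 2 * -(repV q τ m)⁻¹ = q⁻¹ ^ 8 * repE q τ m - q⁻¹ ^ 2 * repV q τ m := by
      rw [repE]; field_simp; ring
    rw [e1, e2] at h1
    rw [symPQ, mul_assoc, ← C_mul, h1]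
    simp only [eval_add, eval_mul, eval_neg, eval_C, eval_X, C_sub, C_mul]
    ring
  exact (mul_eq_zero.1 this).resolve_right (C_ne_zero.2 h2)

theorem eq_zpow_mul_of_step {k : F} (hk : k ≠ 0) {s : ℤ → F[X]}
    (h : ∀ m, s m = C k * s (m - 1)) (m : ℤ) : s m = s 0 * C (k ^ m) := by
  induction m using Int.induction_on with
  | zero => simp
  | succ i ih =>
    rw [h, add_sub_cancel_right, ih, zpow_add_one₀ hk, C_mul]; ring
  | pred i ih =>
    have e := h (-i)
    rw [ih] at e
    refine mul_left_cancel₀ (C_ne_zero.2 hk) ?_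
    rw [← e, zpow_sub_one₀ hk, mul_left_comm, ← C_mul]
    congr 2
    field_simp

end

variable {A : Type*} [Ring A] [Algebra F A] {κ : F} {x y z : A}
  {Φ : A →ₐ[F] Module.End F[X] (ℤ → F[X])}

namespace IsRep

/-- In degree `N + 1` the terms `b, b'` disappear. The raising part of `y` has weight one, so right
multiplication by `y` keeps the symbol of `a` and left multiplication shifts its argument. -/
theorem sym_eq_of_y_comm (H : IsRep q κ τ x y z Φ) {N : ℕ} {a b b' : A} {s t t' : ℤ → F[X]}
    (ha : HasSym N (Φ a) s) (hb : HasSym N (Φ b) t) (hb' : HasSym N (Φ b') t') {k k' : F}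
    (e : k • (a * y) + b = k' • (y * a) + b') (m : ℤ) : C k * s m = C k' * s (m - 1) := by
  have h1 := ((ha.mul (hasSym_repY (q := q) (κ := κ) (τ := τ))).smul k).add hb.succ
  have h2 := (((hasSym_repY (q := q) (κ := κ) (τ := τ)).mul ha).smul k').add
    ((hb'.succ).congr rfl |> fun h => by rwa [add_comm N 1] at h)
  rw [← H.map_y, ← map_mul, ← map_smul, ← map_add] at h1 h2
  rw [← e, add_comm 1 N] at h2
  have := congrFun (h1.unique h2) m
  simpa using this

theorem hasSym_mul_x (H : IsRep q κ τ x y z Φ) {N : ℕ} {a : A} {s : ℤ → F[X]}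
    (ha : HasSym N (Φ a) s) : HasSym N (Φ (a * x)) (fun m => s m * C (repE q τ (m - N))) := by
  rw [map_mul, H.map_x]; exact ha.mul hasSym_repX

theorem hasSym_x_mul (H : IsRep q κ τ x y z Φ) {N : ℕ} {a : A} {s : ℤ → F[X]}
    (ha : HasSym N (Φ a) s) : HasSym N (Φ (x * a)) (fun m => C (repE q τ m) * s m) := by
  rw [map_mul, H.map_x]; simpa using hasSym_repX.mul ha

theorem hasSym_smul (c : F) {N : ℕ} {a : A} {s : ℤ → F[X]}
    (ha : HasSym N (Φ a) s) : HasSym N (Φ (c • a)) (fun m => C c * s m) := by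
  rw [map_smul]; exact ha.smul c

theorem hasSym_add {N : ℕ} {a b : A} {s t : ℤ → F[X]} (ha : HasSym N (Φ a) s)
    (hb : HasSym N (Φ b) t) : HasSym N (Φ (a + b)) (fun m => s m + t m) := by
  rw [map_add]; exact ha.add hb

variable {K : Matrix (Fin 3) (Fin 3) A} {N : ℕ} {s : Fin 3 → Fin 3 → ℤ → F[X]}

/-- The weights of the diagonal of `onsM1`. -/
def wt (q : F) : Fin 3 → F := ![q ^ 4, q ^ 2, 1]

/-- Only the diagonal of `onsM1` contains `y`; the scalar entries off the diagonal contribute in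
lower degree. -/
theorem sym_step (H : IsRep q κ τ x y z Φ) (hs : ∀ i j, HasSym N (Φ (K i j)) (s i j))
    (hK : K * onsM1 q y = onsM1 q y * K) (i j : Fin 3) (m : ℤ) :
    C (wt q j) * s i j m = C (wt q i) * s i j (m - 1) := by
  have e := congrFun (congrFun hK i) j
  fin_cases i <;> fin_cases j <;>
    simp [Matrix.mul_apply, Fin.sum_univ_three, onsM1] at e <;>
    simp only [wt, Fin.mk_zero, Fin.mk_one, Fin.reduceFinMk, Matrix.cons_val_zero,
      Matrix.cons_val_one, Matrix.cons_val, Fin.isValue, Fin.zero_eta]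
  · exact H.sym_eq_of_y_comm (hs 0 0) (hasSym_smul _ (hs 0 1)) (hasSym_smul _ (hs 1 0)) e m
  · refine H.sym_eq_of_y_comm (hs 0 1) (hasSym_add (hasSym_smul (q ^ 7 * (q ^ 4 - 1)) (hs 0 0))
      (hasSym_smul (q ^ 6 * (q ^ 4 - 1)) (hs 0 2))) (hasSym_smul (q ^ 7 * (q ^ 4 - 1)) (hs 1 1))
      ?_ m
    rw [← e]; abel
  · refine H.sym_eq_of_y_comm (hs 0 2) (hasSym_smul (q ^ 6 * (q ^ 4 - 1)) (hs 0 1))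
      (hasSym_smul (q ^ 7 * (q ^ 4 - 1)) (hs 1 2)) ?_ m
    rw [one_smul, ← e]; abel
  · refine H.sym_eq_of_y_comm (hs 1 0) (hasSym_smul (q ^ 7 * (q ^ 4 - 1)) (hs 1 1))
      (hasSym_add (hasSym_smul (q ^ 7 * (q ^ 4 - 1)) (hs 0 0))
      (hasSym_smul (q ^ 6 * (q ^ 4 - 1)) (hs 2 0))) ?_ m
    rw [e]; abel
  · refine H.sym_eq_of_y_comm (hs 1 1) (hasSym_add (hasSym_smul (q ^ 7 * (q ^ 4 - 1)) (hs 1 0))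
      (hasSym_smul (q ^ 6 * (q ^ 4 - 1)) (hs 1 2)))
      (hasSym_add (hasSym_smul (q ^ 7 * (q ^ 4 - 1)) (hs 0 1))
      (hasSym_smul (q ^ 6 * (q ^ 4 - 1)) (hs 2 1))) ?_ m
    rw [← add_assoc, add_comm (q ^ 2 • (K 1 1 * y)), e]; abel
  · refine H.sym_eq_of_y_comm (hs 1 2) (hasSym_smul (q ^ 6 * (q ^ 4 - 1)) (hs 1 1))
      (hasSym_add (hasSym_smul (q ^ 7 * (q ^ 4 - 1)) (hs 0 2))
      (hasSym_smul (q ^ 6 * (q ^ 4 - 1)) (hs 2 2))) ?_ m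
    rw [one_smul, add_comm, e]; abel
  · refine H.sym_eq_of_y_comm (hs 2 0) (hasSym_smul (q ^ 7 * (q ^ 4 - 1)) (hs 2 1))
      (hasSym_smul (q ^ 6 * (q ^ 4 - 1)) (hs 1 0)) ?_ m
    rw [e, one_smul]; abel
  · refine H.sym_eq_of_y_comm (hs 2 1) (hasSym_add (hasSym_smul (q ^ 7 * (q ^ 4 - 1)) (hs 2 0))
      (hasSym_smul (q ^ 6 * (q ^ 4 - 1)) (hs 2 2))) (hasSym_smul (q ^ 6 * (q ^ 4 - 1)) (hs 1 1))
      ?_ m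
    rw [one_smul, add_comm (y * K 2 1), ← e]; abel
  · refine H.sym_eq_of_y_comm (hs 2 2) (hasSym_smul (q ^ 6 * (q ^ 4 - 1)) (hs 2 1))
      (hasSym_smul (q ^ 6 * (q ^ 4 - 1)) (hs 1 2)) ?_ m
    rw [one_smul, one_smul, add_comm, e]; abel

/-- The equations for the symbols of an intertwiner that come from `onsM0`. -/
theorem sym_onsM0 (H : IsRep q κ τ x y z Φ) (hs : ∀ i j, HasSym N (Φ (K i j)) (s i j))
    {a b a' b' : F} (hK : K * onsM0 q a b x = onsM0 q a' b' x * K) (m : ℤ) :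
    (s 0 0 m * C (repE q τ (m - N)) + C (q ^ 6 * (q ^ 8 - 1) * b) * s 0 2 m
      = C (repE q τ m) * s 0 0 m + C (q ^ 6 * (q ^ 8 - 1) * a') * s 2 0 m) ∧
    (C (q ^ 6 * (q ^ 8 - 1) * a) * s 0 0 m + C (q ^ 8) * (s 0 2 m * C (repE q τ (m - N)))
      = C (repE q τ m) * s 0 2 m + C (q ^ 6 * (q ^ 8 - 1) * a') * s 2 2 m) ∧
    (s 2 0 m * C (repE q τ (m - N)) + C (q ^ 6 * (q ^ 8 - 1) * b) * s 2 2 m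
      = C (q ^ 6 * (q ^ 8 - 1) * b') * s 0 0 m + C (q ^ 8) * (C (repE q τ m) * s 2 0 m)) ∧
    (C (q ^ 6 * (q ^ 8 - 1) * a) * s 2 0 m + C (q ^ 8) * (s 2 2 m * C (repE q τ (m - N)))
      = C (q ^ 6 * (q ^ 8 - 1) * b') * s 0 2 m + C (q ^ 8) * (C (repE q τ m) * s 2 2 m)) ∧
    (C (q ^ 4) * (s 1 1 m * C (repE q τ (m - N))) = C (q ^ 4) * (C (repE q τ m) * s 1 1 m)) := by
  have e := fun i j => congrFun (congrFun hK i) j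
  have e00 := e 0 0
  have e02 := e 0 2
  have e20 := e 2 0
  have e22 := e 2 2
  have e11 := e 1 1
  simp [Matrix.mul_apply, Fin.sum_univ_three, onsM0] at e00 e02 e20 e22 e11
  refine ⟨?_, ?_, ?_, ?_, ?_⟩
  · have h1 := hasSym_add (H.hasSym_mul_x (hs 0 0))
      (hasSym_smul (q ^ 6 * (q ^ 8 - 1) * b) (hs 0 2))
    rw [e00] at h1
    exact congrFun (h1.unique (hasSym_add (H.hasSym_x_mul (hs 0 0))
      (hasSym_smul (q ^ 6 * (q ^ 8 - 1) * a') (hs 2 0)))) m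
  · have h1 := hasSym_add (hasSym_smul (q ^ 6 * (q ^ 8 - 1) * a) (hs 0 0))
      (hasSym_smul (q ^ 8) (H.hasSym_mul_x (hs 0 2)))
    rw [e02] at h1
    exact congrFun (h1.unique (hasSym_add (H.hasSym_x_mul (hs 0 2))
      (hasSym_smul (q ^ 6 * (q ^ 8 - 1) * a') (hs 2 2)))) m
  · have h1 := hasSym_add (H.hasSym_mul_x (hs 2 0))
      (hasSym_smul (q ^ 6 * (q ^ 8 - 1) * b) (hs 2 2))
    rw [e20] at h1
    exact congrFun (h1.unique (hasSym_add (hasSym_smul (q ^ 6 * (q ^ 8 - 1) * b') (hs 0 0))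
      (hasSym_smul (q ^ 8) (H.hasSym_x_mul (hs 2 0))))) m
  · have h1 := hasSym_add (hasSym_smul (q ^ 6 * (q ^ 8 - 1) * a) (hs 2 0))
      (hasSym_smul (q ^ 8) (H.hasSym_mul_x (hs 2 2)))
    rw [e22] at h1
    exact congrFun (h1.unique (hasSym_add (hasSym_smul (q ^ 6 * (q ^ 8 - 1) * b') (hs 0 2))
      (hasSym_smul (q ^ 8) (H.hasSym_x_mul (hs 2 2))))) m
  · have h1 := hasSym_smul (q ^ 4) (H.hasSym_mul_x (hs 1 1))
    have e11' : K 1 1 * x = x * K 1 1 := smul_right_injective A (pow_ne_zero 4 H.q_ne) e11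
    rw [e11'] at h1
    exact congrFun (h1.unique (hasSym_smul (q ^ 4) (H.hasSym_x_mul (hs 1 1)))) m

end IsRep
end
end DynK

end

/-! ### Vanishing of symbols of intertwiners outside degree two. -/

noncomputable section

namespace DynK

open Polynomial

section
variable {F : Type*} [Field F] {q τ : F}
variable {A : Type*} [Ring A] [Algebra F A] {κ : F} {x y z : A}
  {Φ : A →ₐ[F] Module.End F[X] (ℤ → F[X])}

namespace IsRep

variable {K : Matrix (Fin 3) (Fin 3) A} {N : ℕ} {s : Fin 3 → Fin 3 → ℤ → F[X]}

theorem sym_eq_zpow (H : IsRep q κ τ x y z Φ) (hs : ∀ i j, HasSym N (Φ (K i j)) (s i j))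
    (hK : K * onsM1 q y = onsM1 q y * K) (i j : Fin 3) (m : ℤ) :
    s i j m = s i j 0 * C ((wt q i / wt q j) ^ m) := by
  have hw : ∀ i, wt q i ≠ 0 := fun i => by fin_cases i <;> simp [wt, H.q_ne]
  refine eq_zpow_mul_of_step (div_ne_zero (hw i) (hw j)) (fun m => ?_) m
  refine mul_left_cancel₀ (C_ne_zero.2 (hw j)) ?_
  rw [H.sym_step hs hK i j m, ← mul_assoc, ← C_mul, mul_div_cancel₀ _ (hw j)]

/-- Here the ratio of weights is `q ^ 2` or `q ^ (-2)`, and a nonzero multiple of the powers of such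
a number is never a symbol. -/
theorem sym_odd_eq_zero (H : IsRep q κ τ x y z Φ) (hs : ∀ i j, HasSym N (Φ (K i j)) (s i j))
    (hPQ : ∀ i j, ∃ P Q, s i j = symPQ q τ P Q) (hK : K * onsM1 q y = onsM1 q y * K) :
    s 0 1 = 0 ∧ s 1 0 = 0 ∧ s 1 2 = 0 ∧ s 2 1 = 0 := by
  have h := H.sym_eq_zpow hs hK
  have key : ∀ i j, wt q i / wt q j = q ^ 2 → s i j = 0 := by
    intro i j e
    obtain ⟨P, Q, hP⟩ := hPQ i j
    have h' := h i j
    rw [e] at h'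
    have : s i j 0 = 0 := eq_zero_of_symPQ_eq_zpow H.q_ne H.q_pow H.tau_sq (P := P) (Q := Q)
      fun m => by rw [← h' m, hP]
    funext m
    rw [h' m, this, zero_mul]; rfl
  have key' : ∀ i j, wt q i / wt q j = q⁻¹ ^ 2 → s i j = 0 := by
    intro i j e
    obtain ⟨P, Q, hP⟩ := hPQ i j
    have h' := h i j
    rw [e] at h'
    have : s i j 0 = 0 := eq_zero_of_symPQ_eq_zpow_neg H.q_ne H.q_pow H.tau_sq (P := P) (Q := Q)
      fun m => by rw [← h' m, hP]
    funext m
    rw [h' m, this, zero_mul]; rfl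
  have hq := H.q_ne
  refine ⟨key _ _ ?_, key' _ _ ?_, key _ _ ?_, key' _ _ ?_⟩ <;> simp [wt] <;> field_simp

theorem sym_even (H : IsRep q κ τ x y z Φ) (hs : ∀ i j, HasSym N (Φ (K i j)) (s i j))
    (hK : K * onsM1 q y = onsM1 q y * K) (m : ℤ) :
    s 0 0 m = s 0 0 0 ∧ s 1 1 m = s 1 1 0 ∧ s 2 2 m = s 2 2 0 ∧
      s 0 2 m = s 0 2 0 * C ((q ^ 4) ^ m) ∧ s 2 0 m = s 2 0 0 * C (((q ^ 4)⁻¹) ^ m) := by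
  have h := H.sym_eq_zpow hs hK
  have hq := H.q_ne
  have e1 : wt q 0 / wt q 0 = 1 := div_self (by simp [wt, hq])
  have e2 : wt q 1 / wt q 1 = 1 := div_self (by simp [wt, hq])
  have e3 : wt q 2 / wt q 2 = 1 := div_self (by simp [wt])
  have e4 : wt q 0 / wt q 2 = q ^ 4 := by simp [wt]
  have e5 : wt q 2 / wt q 0 = (q ^ 4)⁻¹ := by simp [wt]
  refine ⟨?_, ?_, ?_, ?_, ?_⟩
  · rw [h 0 0 m, e1]; simp
  · rw [h 1 1 m, e2]; simp
  · rw [h 2 2 m, e3]; simp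
  · rw [h 0 2 m, e4]
  · rw [h 2 0 m, e5]

theorem pow_eight_ne_one (H : IsRep q κ τ x y z Φ) : q ^ 8 - 1 ≠ 0 :=
  sub_ne_zero.2 (H.q_pow 8 (by norm_num))

/-- In the `onsM0` equations the diagonal symbols are constant in `m`, so the corner symbol times `q
^ 8 E (m - N) - E m`, or its mirror image, is constant as well. Comparing two neighbouring positions
gives the factor `q ^ (8 - 4 N) - 1`, which vanishes only for `N = 2`. -/
theorem sym_corner_eq_zero (H : IsRep q κ τ x y z Φ)
    (hs : ∀ i j, HasSym N (Φ (K i j)) (s i j))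
    (hK : K * onsM1 q y = onsM1 q y * K) {a b a' b' : F}
    (hK' : K * onsM0 q a b x = onsM0 q a' b' x * K) (hN : N ≠ 2) : s 0 2 0 = 0 ∧ s 2 0 0 = 0 := by
  have hq := H.q_ne
  have h4 : q ^ 4 ≠ 0 := pow_ne_zero 4 hq
  have hτ := tau_ne_zero hq H.tau_sq
  have hv : (q ^ 4) ^ (-(N : ℤ)) ≠ 0 := zpow_ne_zero _ h4
  have hv8 : q ^ 8 * (q ^ 4) ^ (-(N : ℤ)) - 1 ≠ 0 := by
    rw [sub_ne_zero, ← zpow_natCast, ← zpow_natCast, ← zpow_mul, ← zpow_add₀ hq]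
    exact zpow_ne_one_of_forall H.q_pow (by push_cast; omega)
  have hE0 : repE q τ 0 = q ^ 6 * (τ - τ⁻¹) := by simp [repE, repV]
  have hE1 : repE q τ 1 = q ^ 6 * (τ * q ^ 4 - (τ * q ^ 4)⁻¹) := by simp [repE, repV]
  have hEm : repE q τ (-1) = q ^ 6 * (τ * (q ^ 4)⁻¹ - (τ * (q ^ 4)⁻¹)⁻¹) := by
    simp [repE, repV, zpow_neg]
  have hE0N : repE q τ (0 - N) = q ^ 6 * (τ * (q ^ 4) ^ (-(N : ℤ))
      - (τ * (q ^ 4) ^ (-(N : ℤ)))⁻¹) := by rw [repE, repV, zero_sub]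
  have hE1N : repE q τ (1 - N) = q ^ 6 * (τ * (q ^ 4 * (q ^ 4) ^ (-(N : ℤ)))
      - (τ * (q ^ 4 * (q ^ 4) ^ (-(N : ℤ))))⁻¹) := by
    rw [repE, repV, sub_eq_add_neg (1 : ℤ), zpow_one_add₀ h4]
  have hEmN : repE q τ (-1 - N) = q ^ 6 * (τ * ((q ^ 4)⁻¹ * (q ^ 4) ^ (-(N : ℤ)))
      - (τ * ((q ^ 4)⁻¹ * (q ^ 4) ^ (-(N : ℤ))))⁻¹) := by
    rw [repE, repV, sub_eq_add_neg (-1 : ℤ), zpow_add₀ h4, zpow_neg_one]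
  generalize (q ^ 4) ^ (-(N : ℤ)) = v at *
  constructor
  · obtain ⟨-, e0, -⟩ := H.sym_onsM0 hs hK' 0
    obtain ⟨-, e1, -⟩ := H.sym_onsM0 hs hK' 1
    obtain ⟨h00, -, h22, h02, -⟩ := H.sym_even hs hK 1
    rw [h00, h22, h02, zpow_one] at e1
    have e : s 0 2 0 * C (q ^ 4 * (q ^ 8 * repE q τ (1 - N) - repE q τ 1)
        - (q ^ 8 * repE q τ (0 - N) - repE q τ 0)) = 0 := by
      simp only [C_sub, C_mul] at e0 e1 ⊢
      linear_combination e1 - e0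
    refine (mul_eq_zero.1 e).resolve_right ?_
    rw [← ne_eq, C_ne_zero]
    have : q ^ 4 * (q ^ 8 * repE q τ (1 - N) - repE q τ 1)
        - (q ^ 8 * repE q τ (0 - N) - repE q τ 0) = q ^ 6 * τ * (q ^ 8 * v - 1) * (q ^ 8 - 1) := by
      rw [hE0, hE1, hE0N, hE1N]; field_simp; ring
    rw [this]
    exact mul_ne_zero (mul_ne_zero (mul_ne_zero (pow_ne_zero 6 hq) hτ) hv8) H.pow_eight_ne_one
  · obtain ⟨-, -, e0, -⟩ := H.sym_onsM0 hs hK' 0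
    obtain ⟨-, -, e1, -⟩ := H.sym_onsM0 hs hK' (-1)
    obtain ⟨h00, -, h22, -, h20⟩ := H.sym_even hs hK (-1)
    rw [h00, h22, h20, zpow_neg_one, inv_inv] at e1
    have e : s 2 0 0 * C (q ^ 4 * (repE q τ (-1 - N) - q ^ 8 * repE q τ (-1))
        - (repE q τ (0 - N) - q ^ 8 * repE q τ 0)) = 0 := by
      simp only [C_sub, C_mul] at e0 e1 ⊢
      linear_combination e1 - e0
    refine (mul_eq_zero.1 e).resolve_right ?_
    rw [← ne_eq, C_ne_zero]
    have : q ^ 4 * (repE q τ (-1 - N) - q ^ 8 * repE q τ (-1))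
        - (repE q τ (0 - N) - q ^ 8 * repE q τ 0)
        = q ^ 6 * (τ * v)⁻¹ * (q ^ 8 * v - 1) * (q ^ 8 - 1) := by
      rw [hE0, hEm, hE0N, hEmN]; field_simp; ring
    rw [this]
    exact mul_ne_zero (mul_ne_zero (mul_ne_zero (pow_ne_zero 6 hq)
      (inv_ne_zero (mul_ne_zero hτ hv))) hv8) H.pow_eight_ne_one

/-- Evaluated at `m = N`: the eigenvalues at `0` and at `N > 0` differ, since the only other
position with the eigenvalue of `0` is `-1`. -/
theorem eq_zero_of_const_mul_sub (H : IsRep q κ τ x y z Φ) (hN : 0 < N) {c : F[X]}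
    (h : ∀ m : ℤ, c * C (repE q τ (m - N)) = C (repE q τ m) * c) : c = 0 := by
  have h1 := h N
  have e : c * C (repE q τ (N - N) - repE q τ N) = 0 := by
    rw [C_sub]; linear_combination h1
  refine (mul_eq_zero.1 e).resolve_right ?_
  rw [← ne_eq, C_ne_zero, sub_ne_zero, ne_eq, repE_eq_iff H.q_ne H.q_pow H.tau_sq]
  omega

/-- The corner symbols grow like `q ^ (4 m)` and `q ^ (-4 m)`, so proportionality at `m = 0` and `m
= 1` is impossible for nonzero values. -/
theorem corner_eq_zero_of_balance (H : IsRep q κ τ x y z Φ) {c d : F[X]} {k l : F} (hk : k ≠ 0)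
    (hl : l ≠ 0) (h0 : C k * c = C l * d)
    (h1 : C k * (c * C (q ^ 4)) = C l * (d * C ((q ^ 4)⁻¹))) : c = 0 ∧ d = 0 := by
  have h4 : (C (q ^ 4)⁻¹ : F[X]) * C (q ^ 4) = 1 := by
    rw [← C_mul, inv_mul_cancel₀ (pow_ne_zero 4 H.q_ne), C_1]
  have e : c * C (k * (q ^ 8 - 1)) = 0 := by
    have e8 : (C (q ^ 8) : F[X]) = C (q ^ 4) * C (q ^ 4) := by rw [← C_mul]; ring_nf
    rw [C_mul, C_sub, e8, C_1]
    linear_combination C (q ^ 4) * h1 - h0 + C l * d * h4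
  have hc : c = 0 :=
    (mul_eq_zero.1 e).resolve_right (C_ne_zero.2 (mul_ne_zero hk H.pow_eight_ne_one))
  refine ⟨hc, ?_⟩
  rw [hc, mul_zero] at h0
  exact (mul_eq_zero.1 h0.symm).resolve_left (C_ne_zero.2 hl)

/-- Once the corners vanish, the `onsM0` equations say that the constant diagonal symbols are
compatible with a change of eigenvalue, which forces them to be zero. In degree two one vanishing
outer diagonal symbol makes the corners proportional to each other. -/
theorem sym_eq_zero (H : IsRep q κ τ x y z Φ) (hs : ∀ i j, HasSym N (Φ (K i j)) (s i j))
    (hPQ : ∀ i j, ∃ P Q, s i j = symPQ q τ P Q) (hK : K * onsM1 q y = onsM1 q y * K)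
    {a b a' b' : F} (hK' : K * onsM0 q a b x = onsM0 q a' b' x * K) (ha : a ≠ 0) (hb : b ≠ 0)
    (ha' : a' ≠ 0) (hb' : b' ≠ 0) (hN : 0 < N) (hcase : N ≠ 2 ∨ s 0 0 = 0 ∨ s 2 2 = 0) :
    ∀ i j, s i j = 0 := by
  obtain ⟨h01, h10, h12, h21⟩ := H.sym_odd_eq_zero hs hPQ hK
  have hg : q ^ 6 * (q ^ 8 - 1) ≠ 0 := mul_ne_zero (pow_ne_zero 6 H.q_ne) H.pow_eight_ne_one
  have hE := H.sym_onsM0 hs hK'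
  have hev := H.sym_even hs hK
  have h11 : s 1 1 0 = 0 := by
    refine H.eq_zero_of_const_mul_sub hN fun m => ?_
    obtain ⟨-, -, -, -, e⟩ := hE m
    rw [(hev m).2.1] at e
    exact mul_left_cancel₀ (C_ne_zero.2 (pow_ne_zero 4 H.q_ne)) e
  have main : s 0 2 0 = 0 ∧ s 2 0 0 = 0 := by
    rcases hcase with h | h | h
    · exact H.sym_corner_eq_zero hs hK hK' h
    · have e : ∀ m, C (q ^ 6 * (q ^ 8 - 1) * b) * s 0 2 m
          = C (q ^ 6 * (q ^ 8 - 1) * a') * s 2 0 m := fun m => by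
        simpa [h] using (hE m).1
      refine H.corner_eq_zero_of_balance (mul_ne_zero hg hb) (mul_ne_zero hg ha') (e 0) ?_
      have e1 := e 1
      rwa [(hev 1).2.2.2.1, (hev 1).2.2.2.2, zpow_one, zpow_one] at e1
    · have e : ∀ m, C (q ^ 6 * (q ^ 8 - 1) * b') * s 0 2 m
          = C (q ^ 6 * (q ^ 8 - 1) * a) * s 2 0 m := fun m => by
        simpa [h] using (hE m).2.2.2.1.symm
      refine H.corner_eq_zero_of_balance (mul_ne_zero hg hb') (mul_ne_zero hg ha) (e 0) ?_
      have e1 := e 1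
      rwa [(hev 1).2.2.2.1, (hev 1).2.2.2.2, zpow_one, zpow_one] at e1
  have hc02 : ∀ m, s 0 2 m = 0 := fun m => by rw [(hev m).2.2.2.1, main.1, zero_mul]
  have hc20 : ∀ m, s 2 0 m = 0 := fun m => by rw [(hev m).2.2.2.2, main.2, zero_mul]
  have h00 : s 0 0 0 = 0 := by
    refine H.eq_zero_of_const_mul_sub hN fun m => ?_
    have e := (hE m).1
    rwa [hc02, hc20, (hev m).1, mul_zero, mul_zero, add_zero, add_zero] at e
  have h22 : s 2 2 0 = 0 := by
    refine H.eq_zero_of_const_mul_sub hN fun m => ?_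
    have e := (hE m).2.2.2.1
    rw [hc02, hc20, (hev m).2.2.1, mul_zero, mul_zero, zero_add, zero_add] at e
    exact mul_left_cancel₀ (C_ne_zero.2 (pow_ne_zero 8 H.q_ne)) e
  intro i j
  funext m
  rw [Pi.zero_apply]
  fin_cases i <;> fin_cases j
  · exact ((hev m).1).trans h00
  · exact congrFun h01 m
  · exact hc02 m
  · exact congrFun h10 m
  · exact ((hev m).2.1).trans h11
  · exact congrFun h12 m
  · exact hc20 m
  · exact congrFun h21 m
  · exact ((hev m).2.2.1).trans h22

variable {a b a' b' : F}

theorem intertwiner_mem_filt_pred (H : IsRep q κ τ x y z Φ)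
    (hK : K * onsM1 q y = onsM1 q y * K) (hK' : K * onsM0 q a b x = onsM0 q a' b' x * K)
    (ha : a ≠ 0) (hb : b ≠ 0) (ha' : a' ≠ 0) (hb' : b' ≠ 0)
    (hmem : ∀ i j, K i j ∈ filt q κ x y z (N + 1))
    (hcase : N ≠ 1 ∨ HasSym (N + 1) (Φ (K 0 0)) 0 ∨ HasSym (N + 1) (Φ (K 2 2)) 0) :
    ∀ i j, K i j ∈ filt q κ x y z N := by
  choose P Q hs using fun i j => H.hasSym_of_mem_filt (hmem i j)
  have h0 := H.sym_eq_zero hs (fun i j => ⟨P i j, Q i j, rfl⟩) hK hK' ha hb ha' hb'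
    (Nat.succ_pos N) (by
      rcases hcase with h | h | h
      · exact Or.inl (by omega)
      · exact Or.inr (Or.inl ((hs 0 0).unique h))
      · exact Or.inr (Or.inr ((hs 2 2).unique h)))
  intro i j
  refine H.mem_filt_of_hasSym_zero (hmem i j) ?_
  rw [← h0 i j]
  exact hs i j

theorem intertwiner_mem_filt_two (H : IsRep q κ τ x y z Φ)
    (hK : K * onsM1 q y = onsM1 q y * K) (hK' : K * onsM0 q a b x = onsM0 q a' b' x * K)
    (ha : a ≠ 0) (hb : b ≠ 0) (ha' : a' ≠ 0) (hb' : b' ≠ 0) :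
    ∀ i j, K i j ∈ filt q κ x y z 2 := by
  have : ∃ N, ∀ i j, K i j ∈ filt q κ x y z N := by
    choose n hn using fun i j => H.rel.exists_mem_filt H.q_ne H.adjoin_eq (K i j)
    -- The sum of the nine degrees serves as a common bound.
    refine ⟨∑ i, ∑ j, n i j, fun i j => filt_mono ?_ (hn i j)⟩
    exact (Finset.single_le_sum (f := fun j => n i j) (fun _ _ => Nat.zero_le _)
      (Finset.mem_univ j)).trans (Finset.single_le_sum (f := fun i => ∑ j, n i j)
      (fun _ _ => Nat.zero_le _) (Finset.mem_univ i))
  obtain ⟨N, hN⟩ := this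
  have key : ∀ n, (∀ i j, K i j ∈ filt q κ x y z (n + 2)) → ∀ i j, K i j ∈ filt q κ x y z 2 := by
    intro n
    induction n with
    | zero => exact fun h => h
    | succ n ih =>
      exact fun h => ih (H.intertwiner_mem_filt_pred hK hK' ha hb ha' hb' h (Or.inl (by omega)))
  exact key N fun i j => filt_mono (by omega) (hN i j)

/-- An intertwiner of degree at most one is a scalar. -/
theorem intertwiner_eq_scalar (H : IsRep q κ τ x y z Φ)
    (hK : K * onsM1 q y = onsM1 q y * K) (hK' : K * onsM0 q a b x = onsM0 q a' b' x * K)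
    (ha : a ≠ 0) (hb : b ≠ 0) (ha' : a' ≠ 0) (hb' : b' ≠ 0)
    (hmem : ∀ i j, K i j ∈ filt q κ x y z 1) :
    ∃ f : F[X], K = Matrix.scalar (Fin 3) (aeval (casT q κ x y z) f) := by
  have hmem0 := H.intertwiner_mem_filt_pred (N := 0) hK hK' ha hb ha' hb' hmem
    (Or.inl (by norm_num))
  choose P Q hs using fun i j => H.hasSym_of_mem_filt (hmem0 i j)
  obtain ⟨h01, h10, h12, h21⟩ := H.sym_odd_eq_zero hs (fun i j => ⟨P i j, Q i j, rfl⟩) hK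
  obtain ⟨h02, h20⟩ := H.sym_corner_eq_zero hs hK hK' (by norm_num)
  have hev := H.sym_even hs hK
  have z01 : K 0 1 = 0 := H.eq_zero_of_hasSym_zero (hmem0 0 1) (h01 ▸ hs 0 1)
  have z10 : K 1 0 = 0 := H.eq_zero_of_hasSym_zero (hmem0 1 0) (h10 ▸ hs 1 0)
  have z12 : K 1 2 = 0 := H.eq_zero_of_hasSym_zero (hmem0 1 2) (h12 ▸ hs 1 2)
  have z21 : K 2 1 = 0 := H.eq_zero_of_hasSym_zero (hmem0 2 1) (h21 ▸ hs 2 1)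
  have z02 : K 0 2 = 0 := H.eq_zero_of_hasSym_zero (hmem0 0 2)
    ((hs 0 2).congr (by funext m; rw [(hev m).2.2.2.1, h02, zero_mul]; rfl))
  have z20 : K 2 0 = 0 := H.eq_zero_of_hasSym_zero (hmem0 2 0)
    ((hs 2 0).congr (by funext m; rw [(hev m).2.2.2.2, h20, zero_mul]; rfl))
  have e0 := H.eq_aeval_of_hasSym_const (hmem0 0 0) ((hs 0 0).congr (funext fun m => (hev m).1))
  have hq := H.q_ne
  have hq4 : q ^ 4 - 1 ≠ 0 := sub_ne_zero.2 (H.q_pow 4 (by norm_num))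
  -- In degree zero only the diagonal survives; the scalar off-diagonal entries of `onsM1` connect
  -- its three entries.
  have e01 : K 0 0 = K 1 1 := by
    have e := congrFun (congrFun hK 0) 1
    simp [Matrix.mul_apply, Fin.sum_univ_three, onsM1, z01, z21, z02] at e
    exact smul_right_injective A (mul_ne_zero (pow_ne_zero 7 hq) hq4) e
  have e12 : K 1 1 = K 2 2 := by
    have e := congrFun (congrFun hK 1) 2
    simp [Matrix.mul_apply, Fin.sum_univ_three, onsM1, z12, z02] at e
    exact smul_right_injective A (mul_ne_zero (pow_ne_zero 6 hq) hq4) e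
  refine ⟨symPQ q τ (P 0 0) (Q 0 0) 0, ?_⟩
  rw [← e0]
  ext i j
  fin_cases i <;> fin_cases j <;> simp [z01, z10, z12, z21, z02, z20, ← e12, e01]

end IsRep
end
end DynK

end

/-! ### Uniqueness, the inverse, and the degree bound. -/

noncomputable section

namespace DynK

open Polynomial

section
variable {F : Type*} [Field F] {q τ : F}
variable {A : Type*} [Ring A] [Algebra F A] {κ : F} {x y z : A}
  {Φ : A →ₐ[F] Module.End F[X] (ℤ → F[X])}

/-- The scalar `K(u) K(u⁻¹)` as a polynomial in the Casimir element. -/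
def chiPoly (q κ u : F) : F[X] :=
  C (kA q u * kA q u⁻¹) * X ^ 2 + C (chiCoef q κ u).1 * X + C (chiCoef q κ u).2

namespace IsRep

variable {K : Matrix (Fin 3) (Fin 3) A}

/-- The action is faithful and by operators linear over the polynomials, on which polynomials in the
Casimir element act as scalars. -/
theorem aeval_commute (H : IsRep q κ τ x y z Φ) (f : F[X]) (w : A) :
    Commute (aeval (casT q κ x y z) f) w := by
  refine H.injective ?_
  rw [map_mul, map_mul, H.map_aeval_casT, Algebra.commutes]

theorem scalar_commute (H : IsRep q κ τ x y z Φ) (f : F[X]) (M : Matrix (Fin 3) (Fin 3) A) :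
    Commute (Matrix.scalar (Fin 3) (aeval (casT q κ x y z) f)) M :=
  Matrix.scalar_commute _ (H.aeval_commute f) M

/-- Only the summand with `y * y` has degree two. Its coefficient is an invertible scalar, so any
constant polynomial symbol can be matched by multiplication with some `f(T)`. -/
theorem hasSym_kFull_00 (H : IsRep q κ τ x y z Φ) (u : F) :
    HasSym 2 (Φ (kFull q κ u x y z 0 0)) (fun _ => C (q ^ 14 * u ^ 2)) := by
  have h1 := (hasSym_repY_pow (q := q) (κ := κ) (τ := τ) 2).smul (q ^ 14 * u ^ 2)
  have hT : HasSym 0 (Φ (casT q κ x y z)) (fun _ => X) := by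
    rw [H.map_casT]; exact hasSym_algebraMap X
  have h2 := ((hT.smul (kA q u)).succ).succ
  have h3 := (((hasSym_one (F := F)).smul (kA q u * kG q κ u)).succ).succ
  have h4 := (((hasSym_repX (q := q) (τ := τ)).smul (q ^ 13 * (q ^ 2 + 1) * u)).succ).succ
  have h := ((h2.add h3).add h1).add h4
  simp only [kFull, kHat, kShape_00, map_add, map_smul, map_mul, map_one, H.map_y, H.map_x,
    kCoef_t₀, kCoef_a₁, kCoef_b₁, kCoef_c₁]
  rw [pow_two (repY q κ τ)] at h
  refine HasSym.congr h ?_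
  funext m
  simp

/-- Intertwiners have degree at most two. Subtracting `f(T) K(u)` with the same symbol in the first
diagonal entry lowers the degree to one, and an intertwiner of that degree is scalar. -/
theorem exists_eq_aeval_mul_kFull (H : IsRep q κ τ x y z Φ) {u : F} (hu : u ≠ 0)
    (hu1 : u ^ 2 - 1 ≠ 0) (hK : K * onsM1 q y = onsM1 q y * K)
    (hK' : K * onsM0 q u⁻¹ u x = onsM0 q u u⁻¹ x * K) :
    ∃ f : F[X], K = Matrix.scalar (Fin 3) (aeval (casT q κ x y z) f) * kFull q κ u x y z := by
  have hu' := inv_ne_zero hu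
  have hmem := H.intertwiner_mem_filt_two hK hK' hu' hu hu hu'
  have hkM1 := H.rel.kHat_mul_onsM1 H.q_ne u (kA q u) (kA q u * kG q κ u)
  have hkM0 := H.rel.kFull_mul_onsM0 H.q_ne hu hu1
  choose P Q hs using fun i j => H.hasSym_of_mem_filt (hmem i j)
  have hev := H.sym_even hs hK
  have hc : q ^ 14 * u ^ 2 ≠ 0 := mul_ne_zero (pow_ne_zero _ H.q_ne) (pow_ne_zero _ hu)
  obtain ⟨f, hf⟩ : ∃ f : F[X], f * C (q ^ 14 * u ^ 2) = symPQ q τ (P 0 0) (Q 0 0) 0 :=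
    ⟨symPQ q τ (P 0 0) (Q 0 0) 0 * C (q ^ 14 * u ^ 2)⁻¹, by
      rw [mul_assoc, ← C_mul, inv_mul_cancel₀ hc, C_1, mul_one]⟩
  set S := Matrix.scalar (Fin 3) (aeval (casT q κ x y z) f) with hS
  set D := K - S * kFull q κ u x y z with hD
  have hDM1 : D * onsM1 q y = onsM1 q y * D := by
    rw [hD, sub_mul, mul_sub, hK, mul_assoc, show kFull q κ u x y z * onsM1 q y = _ from hkM1,
      ← mul_assoc, ← mul_assoc, (H.scalar_commute f _).eq]
    rfl
  have hDM0 : D * onsM0 q u⁻¹ u x = onsM0 q u u⁻¹ x * D := by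
    rw [hD, sub_mul, mul_sub, hK', mul_assoc, hkM0, ← mul_assoc, ← mul_assoc,
      (H.scalar_commute f _).eq]
  have hDmem := H.intertwiner_mem_filt_two hDM1 hDM0 hu' hu hu hu'
  have h00 : HasSym 2 (Φ (D 0 0)) 0 := by
    have e : D 0 0 = K 0 0 - aeval (casT q κ x y z) f * kFull q κ u x y z 0 0 := by
      simp [hD, hS, Matrix.sub_apply, Matrix.mul_apply, Fin.sum_univ_three]
    rw [e, map_sub, map_mul, H.map_aeval_casT]
    have h1 := (hasSym_algebraMap f).mul (H.hasSym_kFull_00 u)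
    rw [zero_add] at h1
    refine ((hs 0 0).sub h1).congr ?_
    funext m
    rw [Pi.sub_apply, (hev m).1, hf, sub_self]; rfl
  have hD1 := H.intertwiner_mem_filt_pred hDM1 hDM0 hu' hu hu hu' hDmem (Or.inr (Or.inl h00))
  obtain ⟨g, hg⟩ := H.intertwiner_eq_scalar hDM1 hDM0 hu' hu hu hu' hD1
  have e02 := congrFun (congrFun hDM0 0) 2
  rw [hg] at e02
  simp [Matrix.mul_apply, Fin.sum_univ_three, onsM0] at e02
  -- A scalar matrix `g` intertwines the parameters `u` and `u⁻¹` only if `(u⁻¹ - u) g = 0`, and `u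
  -- ^ 2 ≠ 1`.
  have hg0 : g = 0 := by
    have h1 := congrArg Φ e02
    rw [map_smul, map_smul, H.map_aeval_casT] at h1
    have h2 := congrFun (LinearMap.congr_fun h1 (fun _ => 1)) 0
    simp only [LinearMap.smul_apply, Pi.smul_apply, Module.algebraMap_end_apply, smul_eq_mul,
      mul_one, smul_eq_C_mul] at h2
    have h3 : C (q ^ 6 * (q ^ 8 - 1) * (u⁻¹ - u)) * g = 0 := by
      simp only [C_mul, C_sub] at h2 ⊢
      linear_combination h2
    refine (mul_eq_zero.1 h3).resolve_left (C_ne_zero.2 (mul_ne_zero (mul_ne_zero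
      (pow_ne_zero 6 H.q_ne) H.pow_eight_ne_one) fun e => hu1 ?_))
    field_simp at e
    linear_combination -e
  refine ⟨f, sub_eq_zero.1 ?_⟩
  rw [← hD, hg, hg0, map_zero, map_zero]

/-- The product minus the candidate scalar intertwines a representation with itself and has
vanishing last diagonal entry. So it has degree at most one, is scalar, and is zero. -/
theorem kFull_mul_kFull_inv (H : IsRep q κ τ x y z Φ) {u : F} (hu : u ≠ 0)
    (hu1 : u ^ 2 - 1 ≠ 0) : kFull q κ u x y z * kFull q κ u⁻¹ x y z
      = Matrix.scalar (Fin 3) (aeval (casT q κ x y z) (chiPoly q κ u)) := by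
  have hu' := inv_ne_zero hu
  have hu1' : u⁻¹ ^ 2 - 1 ≠ 0 := by
    intro e; apply hu1; field_simp at e; linear_combination -e
  have hkM1 := fun v => H.rel.kHat_mul_onsM1 H.q_ne v (kA q v) (kA q v * kG q κ v)
  have hkM1' : ∀ v, kFull q κ v x y z * onsM1 q y = onsM1 q y * kFull q κ v x y z := hkM1
  have hkM0 := H.rel.kFull_mul_onsM0 H.q_ne hu hu1
  have hkM0' := H.rel.kFull_mul_onsM0 H.q_ne hu' hu1'
  rw [inv_inv] at hkM0'
  set S := Matrix.scalar (Fin 3) (aeval (casT q κ x y z) (chiPoly q κ u)) with hS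
  set D := kFull q κ u x y z * kFull q κ u⁻¹ x y z - S with hD
  have hDM1 : D * onsM1 q y = onsM1 q y * D := by
    rw [hD, sub_mul, mul_sub, mul_assoc, hkM1', ← mul_assoc, hkM1', ← mul_assoc,
      (H.scalar_commute _ _).eq]
  have hDM0 : D * onsM0 q u u⁻¹ x = onsM0 q u u⁻¹ x * D := by
    rw [hD, sub_mul, mul_sub, mul_assoc, hkM0', ← mul_assoc, hkM0, ← mul_assoc,
      (H.scalar_commute _ _).eq]
  have hDmem := H.intertwiner_mem_filt_two hDM1 hDM0 hu hu' hu hu'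
  have hD22 : D 2 2 = 0 := by
    rw [hD, Matrix.sub_apply, H.rel.kFull_mul_kFull_inv_22 H.q_ne hu hu1]
    simp [hS, chiPoly, Algebra.smul_def, pow_two]
  have h22 : HasSym 2 (Φ (D 2 2)) 0 := by
    rw [hD22, map_zero]; exact HasSym.zero 2
  have hD1 := H.intertwiner_mem_filt_pred hDM1 hDM0 hu hu' hu hu' hDmem (Or.inr (Or.inr h22))
  obtain ⟨g, hg⟩ := H.intertwiner_eq_scalar hDM1 hDM0 hu hu' hu hu' hD1
  refine sub_eq_zero.1 ?_
  rw [← hD, hg]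
  rw [hg] at hD22
  have : aeval (casT q κ x y z) g = 0 := by simpa using hD22
  rw [this, map_zero]

theorem kA_ne_zero (hq0 : q ≠ 0) {u : F} (hu : u ≠ 0) (hu1 : u ^ 2 - 1 ≠ 0) : kA q u ≠ 0 :=
  div_ne_zero (mul_ne_zero (pow_ne_zero _ hq0) (pow_ne_zero _ hu)) hu1

theorem chiPoly_ne_zero (hq0 : q ≠ 0) {u : F} (hu : u ≠ 0) (hu1 : u ^ 2 - 1 ≠ 0) :
    chiPoly q κ u ≠ 0 := by
  have hu1' : u⁻¹ ^ 2 - 1 ≠ 0 := by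
    intro e; apply hu1; field_simp at e; linear_combination -e
  intro e
  have := congrArg (fun p => coeff p 2) e
  simp only [chiPoly, coeff_add, coeff_C_mul, coeff_X_pow, coeff_X, coeff_C, coeff_zero] at this
  norm_num at this
  exact this.elim (kA_ne_zero hq0 hu hu1) (kA_ne_zero hq0 (inv_ne_zero hu) hu1')

/-- The polynomial `chiPoly` is symmetric under `u ↦ u⁻¹`. -/
theorem kFull_inv_mul_kFull (H : IsRep q κ τ x y z Φ) {u : F} (hu : u ≠ 0)
    (hu1 : u ^ 2 - 1 ≠ 0) : kFull q κ u⁻¹ x y z * kFull q κ u x y z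
      = Matrix.scalar (Fin 3) (aeval (casT q κ x y z) (chiPoly q κ u)) := by
  have hu1' : u⁻¹ ^ 2 - 1 ≠ 0 := by
    intro e; apply hu1; field_simp at e; linear_combination -e
  have h1 := H.kFull_mul_kFull_inv (inv_ne_zero hu) hu1'
  rw [inv_inv] at h1
  have e : chiPoly q κ u⁻¹ = chiPoly q κ u := by
    simp only [chiPoly, chiCoef, inv_inv]
    congr 3 <;> ring
  rw [h1, e]

end IsRep

/-! ### Elements of low degree -/

/-- The coefficients of `f` are bounded by the weight in which `X` has weight `2` and the function
supported at `m` has weight `m`. -/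
def HasWt (e : ℤ) (f : ℤ → F[X]) : Prop :=
  ∀ (m : ℤ) (i : ℕ), (f m).coeff i ≠ 0 → 2 * (i : ℤ) + m ≤ e

theorem HasWt.add {e : ℤ} {f g : ℤ → F[X]} (hf : HasWt e f) (hg : HasWt e g) :
    HasWt e (f + g) := by
  intro m i h
  by_cases h1 : (f m).coeff i = 0
  · refine hg m i fun h2 => h ?_
    simp [h1, h2]
  · exact hf m i h1

theorem HasWt.smul {e : ℤ} {f : ℤ → F[X]} (hf : HasWt e f) (c : F) :
    HasWt e (c • f) := by
  intro m i h
  refine hf m i fun h2 => h ?_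
  simp [h2]

theorem HasWt.mono {e e' : ℤ} {f : ℤ → F[X]} (hf : HasWt e f) (h : e ≤ e') :
    HasWt e' f := fun m i hi => (hf m i hi).trans h

theorem HasWt.repX {e : ℤ} {f : ℤ → F[X]} (hf : HasWt e f) :
    HasWt e (repX q τ f) := by
  intro m i h
  rw [repX_apply, coeff_C_mul] at h
  exact hf m i (right_ne_zero_of_mul h)

/-- Lowering loses one unit of position but may gain one factor `X` of weight two, a net gain of at
most one, the same as for raising. -/
theorem coeff_repF_mul_ne_zero {e : ℤ} {f : ℤ → F[X]} (hf : HasWt e f) {m : ℤ} {i : ℕ}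
    (h : (repF q κ τ (m + 1) * f (m + 1)).coeff i ≠ 0) : 2 * (i : ℤ) + m ≤ e + 1 := by
  rw [repF, mul_assoc, coeff_C_mul] at h
  have h := right_ne_zero_of_mul h
  rw [sub_mul, coeff_sub, coeff_C_mul] at h
  by_cases h1 : (f (m + 1)).coeff i = 0
  · rw [h1, mul_zero, sub_zero] at h
    cases i with
    | zero => simp at h
    | succ i =>
      rw [coeff_X_mul] at h
      have := hf _ _ h
      push_cast; omega
  · have := hf _ _ h1
    omega

theorem HasWt.repY {e : ℤ} {f : ℤ → F[X]} (hf : HasWt e f) :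
    HasWt (e + 1) (repY q κ τ f) := by
  intro m i h
  rw [repY_apply, coeff_add] at h
  by_cases h1 : (f (m - 1)).coeff i = 0
  · rw [h1, zero_add] at h
    exact coeff_repF_mul_ne_zero hf h
  · have := hf _ _ h1
    omega

theorem HasWt.repZ {e : ℤ} {f : ℤ → F[X]} (hf : HasWt e f) :
    HasWt (e + 1) (repZ q κ τ f) := by
  intro m i h
  rw [repZ_apply, coeff_sub, mul_assoc, coeff_C_mul, coeff_C_mul] at h
  by_cases h1 : (f (m - 1)).coeff i = 0
  · rw [h1, mul_zero, zero_sub, neg_ne_zero] at h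
    exact coeff_repF_mul_ne_zero hf (right_ne_zero_of_mul h)
  · have := hf _ _ h1
    omega

namespace IsRep

theorem hasWt_monomial (H : IsRep q κ τ x y z Φ) {e : ℤ} {f : ℤ → F[X]} (hf : HasWt e f)
    (i j k : ℕ) : HasWt (e + j + k) (Φ (x ^ i * y ^ j * z ^ k) f) := by
  have hz : HasWt (e + k) (Φ (z ^ k) f) := by
    induction k with
    | zero => simpa using hf
    | succ k ih =>
      rw [pow_succ', map_mul, Module.End.mul_apply, H.map_z]
      exact ih.repZ.mono (by push_cast; omega)
  have hy : HasWt (e + j + k) (Φ (y ^ j * z ^ k) f) := by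
    induction j with
    | zero => simpa using hz
    | succ j ih =>
      rw [pow_succ', mul_assoc, map_mul, Module.End.mul_apply, H.map_y]
      exact ih.repY.mono (by push_cast; omega)
  rw [mul_assoc]
  induction i with
  | zero => simpa using hy
  | succ i ih =>
    rw [pow_succ', mul_assoc, map_mul, Module.End.mul_apply, H.map_x]
    exact ih.repX

/-- Applied to the function concentrated at `0`, monomials of degree below four produce weight at
most `3`. The middle diagonal entry of `K(u)` contains the Casimir element with nonzero coefficient,
so the product reaches weight `2 (deg f + 1)` at position `0`. -/
theorem aeval_const_of_mem_span (H : IsRep q κ τ x y z Φ) {u : F} (hu : u ≠ 0)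
    (hu1 : u ^ 2 - 1 ≠ 0) {f : F[X]}
    (hf : aeval (casT q κ x y z) f * kFull q κ u x y z 1 1 ∈ Submodule.span F
      {w : A | ∃ i j k : ℕ, i + j + k < 4 ∧ w = x ^ i * y ^ j * z ^ k}) : ∃ c, f = C c := by
  have key : ∀ a ∈ Submodule.span F
      {w : A | ∃ i j k : ℕ, i + j + k < 4 ∧ w = x ^ i * y ^ j * z ^ k},
      HasWt 3 (Φ a (Pi.single 0 1)) := by
    have h1 : HasWt (F := F) 0 (Pi.single 0 1) := by
      intro m i h
      by_cases hm : m = 0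
      · subst hm
        by_cases hi : i = 0
        · simp [hi]
        · simp [coeff_one, hi] at h
      · simp [Pi.single_eq_of_ne hm] at h
    intro a ha
    refine Submodule.span_induction ?_ ?_ ?_ ?_ ha
    · rintro w ⟨i, j, k, hijk, rfl⟩
      exact (H.hasWt_monomial h1 i j k).mono (by omega)
    · intro m i h
      simp at h
    · intro a b _ _ ha hb
      rw [map_add]; exact ha.add hb
    · intro c a _ ha
      rw [map_smul]; exact ha.smul c
  have h := key _ hf
  have e : Φ (aeval (casT q κ x y z) f * kFull q κ u x y z 1 1) (Pi.single 0 1) 0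
      = f * (C (kA q u) * X + C ((kCoef q κ u (kA q u) (kA q u * kG q κ u)).a₂
        + (kCoef q κ u (kA q u) (kA q u * kG q κ u)).c₂ * repE q τ 0)) := by
    simp only [kFull, kHat, kShape_11, map_mul, map_add, map_smul, map_one, H.map_aeval_casT,
      H.map_casT, H.map_x, Module.End.mul_apply, LinearMap.add_apply, LinearMap.smul_apply,
      Pi.add_apply, Pi.smul_apply, Module.algebraMap_end_apply, Module.End.one_apply, repX_apply,
      Pi.single_eq_same, smul_eq_mul, smul_eq_C_mul, C_add, C_mul, kCoef_t₀, mul_one]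
    ring
  by_cases hf0 : f = 0
  · exact ⟨0, by rw [hf0, C_0]⟩
  refine ⟨f.coeff 0, eq_C_of_natDegree_eq_zero ?_⟩
  have hkA := kA_ne_zero H.q_ne hu hu1
  have hl := leadingCoeff_linear (R := F) (b := (kCoef q κ u (kA q u) (kA q u * kG q κ u)).a₂
        + (kCoef q κ u (kA q u) (kA q u * kG q κ u)).c₂ * repE q τ 0) hkA
  have hd := natDegree_linear (R := F) (b := (kCoef q κ u (kA q u) (kA q u * kG q κ u)).a₂
        + (kCoef q κ u (kA q u) (kA q u * kG q κ u)).c₂ * repE q τ 0) hkA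
  have h1 := h 0 (f.natDegree + 1)
  rw [e, ← hd, coeff_mul_degree_add_degree, hl] at h1
  have := h1 (mul_ne_zero (leadingCoeff_ne_zero.2 hf0) hkA)
  rw [hd] at this
  push_cast at this
  omega

end IsRep
end
end DynK

end

/-! ### The Izergin-Korepin matrix as an intertwiner. -/

open scoped Kronecker
noncomputable section

namespace DynK

open Matrix

section
variable {F : Type*} [Field F]

/-- The matrix on the tensor square whose rows are given as matrices. -/
def ofRows (R : Fin 3 → Fin 3 → Matrix (Fin 3) (Fin 3) F) :
    Matrix (Fin 3 × Fin 3) (Fin 3 × Fin 3) F := of fun p r => R p.1 p.2 r.1 r.2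

theorem ofRows_apply (R : Fin 3 → Fin 3 → Matrix (Fin 3) (Fin 3) F) (i j k l : Fin 3) :
    ofRows R (i, j) (k, l) = R i j k l := rfl

/-- The Izergin-Korepin matrix `q ^ 5 * a * b * R₁₂(a / b)`. -/
def rMat (q a b : F) : Matrix (Fin 3 × Fin 3) (Fin 3 × Fin 3) F := ofRows (rEnt q a b)

/-- The matrix `q ^ 5 * a * b * R₂₁(a / b)`. -/
def rFlip (q a b : F) : Matrix (Fin 3 × Fin 3) (Fin 3 × Fin 3) F :=
  (rMat q a b).submatrix Prod.swap Prod.swap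

/-- The scalar part of `onsM1`. -/
def ons1 (q : F) : Matrix (Fin 3) (Fin 3) F :=
  !![0, q ^ 7 * (q ^ 4 - 1), 0;
     q ^ 7 * (q ^ 4 - 1), 0, q ^ 6 * (q ^ 4 - 1);
     0, q ^ 6 * (q ^ 4 - 1), 0]

/-- The scalar part of `onsM0`. -/
def ons0 (q a b : F) : Matrix (Fin 3) (Fin 3) F :=
  !![0, 0, q ^ 6 * (q ^ 8 - 1) * a; 0, 0, 0; q ^ 6 * (q ^ 8 - 1) * b, 0, 0]

/-- The image of `k₁ ^ 2`, rescaled. -/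
def wt1 (q : F) : Matrix (Fin 3) (Fin 3) F := diagonal ![q ^ 4, q ^ 2, 1]

/-- The image of `k₀ ^ 2`, rescaled. -/
def wt0 (q : F) : Matrix (Fin 3) (Fin 3) F := diagonal ![1, q ^ 4, q ^ 8]

/-- The matrix with the given entries. -/
def mk3 (a b c d e f g h i : F) : Matrix (Fin 3) (Fin 3) F := !![a, b, c; d, e, f; g, h, i]

theorem mk3_congr {a b c d e f g h i a' b' c' d' e' f' g' h' i' : F} (ha : a = a') (hb : b = b')
    (hc : c = c') (hd : d = d') (he : e = e') (hf : f = f') (hg : g = g') (hh : h = h')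
    (hi : i = i') : mk3 a b c d e f g h i = mk3 a' b' c' d' e' f' g' h' i' := by
  subst_vars; rfl

theorem mk3_add (a b c d e f g h i a' b' c' d' e' f' g' h' i' : F) :
    mk3 a b c d e f g h i + mk3 a' b' c' d' e' f' g' h' i'
      = mk3 (a + a') (b + b') (c + c') (d + d') (e + e') (f + f') (g + g') (h + h') (i + i') := by
  simp [mk3]

theorem mk3_smul (s a b c d e f g h i : F) : s • mk3 a b c d e f g h i
    = mk3 (s * a) (s * b) (s * c) (s * d) (s * e) (s * f) (s * g) (s * h) (s * i) := by
  simp [mk3]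

variable (q : F)

/-- The effect of the tensor `m ⊗ 1 + D ⊗ m'` on a row vector, written as a matrix. -/
theorem of_mul_kronecker_apply (R : Fin 3 → Fin 3 → Matrix (Fin 3) (Fin 3) F)
    (m D m' : Matrix (Fin 3) (Fin 3) F) (i j k l : Fin 3) :
    (ofRows R * (m ⊗ₖ (1 : Matrix (Fin 3) (Fin 3) F) + D ⊗ₖ m')) (i, j) (k, l)
      = (mᵀ * R i j + Dᵀ * R i j * m') k l := by
  simp only [Matrix.mul_apply, Matrix.add_apply, Fintype.sum_prod_type, mul_add,
    Finset.sum_add_distrib, kroneckerMap_apply, ofRows_apply, transpose_apply, one_apply, Finset.sum_mul]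
  congr 1
  · simp [mul_comm]
  · rw [Finset.sum_comm]
    exact Finset.sum_congr rfl fun _ _ => Finset.sum_congr rfl fun _ _ => by ring

theorem kronecker_mul_of_apply (R : Fin 3 → Fin 3 → Matrix (Fin 3) (Fin 3) F)
    (m m' : Matrix (Fin 3) (Fin 3) F) (d : Fin 3 → F) (i j k l : Fin 3) :
    (((1 : Matrix (Fin 3) (Fin 3) F) ⊗ₖ m' + m ⊗ₖ diagonal d) * ofRows R) (i, j) (k, l)
      = (m' j 0 • R i 0 + m' j 1 • R i 1 + m' j 2 • R i 2
        + (m i 0 * d j) • R 0 j + (m i 1 * d j) • R 1 j + (m i 2 * d j) • R 2 j) k l := by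
  simp only [Matrix.mul_apply, Matrix.add_apply, Fintype.sum_prod_type, add_mul,
    Finset.sum_add_distrib, kroneckerMap_apply, ofRows_apply, one_apply, diagonal_apply]
  simp [Fin.sum_univ_three]
  ring

theorem ons1_act (a b c d e f g h i : F) :
    (q ^ 2 • ons1 q)ᵀ * mk3 a b c d e f g h i + (wt1 q)ᵀ * mk3 a b c d e f g h i * ons1 q
      = (q ^ 6 * (q ^ 4 - 1)) • mk3 (q ^ 3 * d + q ^ 5 * b) (q ^ 3 * e + q ^ 4 * (q * a + c))
          (q ^ 3 * f + q ^ 4 * b) (q ^ 2 * (q * a + g) + q ^ 3 * e)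
          (q ^ 2 * (q * b + h) + q ^ 2 * (q * d + f)) (q ^ 2 * (q * c + i) + q ^ 2 * e)
          (q ^ 2 * d + q * h) (q ^ 2 * e + (q * g + i)) (q ^ 2 * f + h) := by
  ext k l
  fin_cases k <;> fin_cases l <;>
  (simp [Matrix.mul_apply, Fin.sum_univ_three, ons1, wt1, mk3]; ring)

theorem ons0_act (s t s' t' a b c d e f g h i : F) :
    (q ^ 4 • ons0 q s t)ᵀ * mk3 a b c d e f g h i + (wt0 q)ᵀ * mk3 a b c d e f g h i * ons0 q s' t'
      = (q ^ 6 * (q ^ 8 - 1)) • mk3 (q ^ 4 * t * g + c * t') (q ^ 4 * t * h)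
          (q ^ 4 * t * i + a * s') (q ^ 4 * f * t') 0 (q ^ 4 * d * s')
          (q ^ 4 * s * a + q ^ 8 * i * t') (q ^ 4 * s * b) (q ^ 4 * s * c + q ^ 8 * g * s') := by
  ext k l
  fin_cases k <;> fin_cases l <;>
  (simp [Matrix.mul_apply, Fin.sum_univ_three, ons0, wt0, mk3]; try ring)

variable (a b : F)

theorem rEnt_00 : rEnt q a b 0 0 = mk3 (rA q a b) 0 0 0 0 0 0 0 0 := rfl
theorem rEnt_01 : rEnt q a b 0 1 = mk3 0 (rB q a b) 0 (b * rG q a b) 0 0 0 0 0 := rfl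
theorem rEnt_02 : rEnt q a b 0 2
    = mk3 0 0 (rD q a b) 0 (-b * rE q a b) 0 (b * rP q a b) 0 0 := rfl
theorem rEnt_10 : rEnt q a b 1 0 = mk3 0 (a * rG q a b) 0 (rB q a b) 0 0 0 0 0 := rfl
theorem rEnt_11 : rEnt q a b 1 1
    = mk3 0 0 (q ^ 4 * a * rE q a b) 0 (rH q a b) 0 (-b * rE q a b) 0 0 := rfl
theorem rEnt_12 : rEnt q a b 1 2 = mk3 0 0 0 0 0 (rB q a b) 0 (b * rG q a b) 0 := rfl
theorem rEnt_20 : rEnt q a b 2 0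
    = mk3 0 0 (a * rS q a b) 0 (q ^ 4 * a * rE q a b) 0 (rD q a b) 0 0 := rfl
theorem rEnt_21 : rEnt q a b 2 1 = mk3 0 0 0 0 0 (a * rG q a b) 0 (rB q a b) 0 := rfl
theorem rEnt_22 : rEnt q a b 2 2 = mk3 0 0 0 0 0 0 0 0 (rA q a b) := rfl

variable {a b}

-- Each row of `R` is treated as a 3 by 3 matrix, on which the tensor product acts by left and right
-- multiplication. The factor `q ^ 2` is the one by which `wt1` is rescaled from the image of `k₁ ^
-- 2`.
set_option maxHeartbeats 1000000 in
theorem rMat_mul_ons1 (a b : F) :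
    rMat q a b * ((q ^ 2 • ons1 q) ⊗ₖ 1 + wt1 q ⊗ₖ ons1 q)
      = (1 ⊗ₖ (q ^ 2 • ons1 q) + ons1 q ⊗ₖ wt1 q) * rMat q a b := by
  ext ⟨i, j⟩ ⟨k, l⟩
  rw [rMat, of_mul_kronecker_apply, wt1, kronecker_mul_of_apply, ← wt1]
  refine congrFun (congrFun ?_ k) l
  fin_cases i <;> fin_cases j <;>
  (simp only [Fin.mk_zero, Fin.mk_one, Fin.reduceFinMk, Fin.zero_eta, rEnt_00, rEnt_01, rEnt_02,
    rEnt_10, rEnt_11, rEnt_12, rEnt_20, rEnt_21, rEnt_22, ons1_act]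
   simp only [ons1, Matrix.smul_apply, smul_eq_mul, of_apply, cons_val', cons_val_zero, cons_val_one, cons_val, mk3_smul, mk3_add]
   apply mk3_congr <;> (try simp only [rA, rB, rG, rD, rE, rP, rS, rH]) <;> ring)

-- The factor `q ^ 4` plays the same role for `wt0` and `k₀ ^ 2`.
set_option maxHeartbeats 1000000 in
theorem rMat_mul_ons0 (ha : a ≠ 0) (hb : b ≠ 0) :
    rMat q a b * ((q ^ 4 • ons0 q a⁻¹ a) ⊗ₖ 1 + wt0 q ⊗ₖ ons0 q b⁻¹ b)
      = (1 ⊗ₖ (q ^ 4 • ons0 q b⁻¹ b) + ons0 q a⁻¹ a ⊗ₖ wt0 q) * rMat q a b := by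
  ext ⟨i, j⟩ ⟨k, l⟩
  rw [rMat, of_mul_kronecker_apply, wt0, kronecker_mul_of_apply, ← wt0]
  refine congrFun (congrFun ?_ k) l
  fin_cases i <;> fin_cases j <;>
  (simp only [Fin.mk_zero, Fin.mk_one, Fin.reduceFinMk, Fin.zero_eta, rEnt_00, rEnt_01, rEnt_02,
    rEnt_10, rEnt_11, rEnt_12, rEnt_20, rEnt_21, rEnt_22, ons0_act]
   simp only [ons0, Matrix.smul_apply, smul_eq_mul, of_apply, cons_val', cons_val_zero, cons_val_one, cons_val, mk3_smul, mk3_add]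
   apply mk3_congr <;> (try simp only [rA, rB, rG, rD, rE, rP, rS, rH]) <;> (try field_simp) <;> ring)

/-- Weight conservation: an entry of `R` vanishes unless `i + j = k + l`, and `d ⊗ d` depends only
on that sum. -/
theorem rMat_mul_diagonal (a b s t : F) (d : Fin 3 → F) (hd : d = ![s, s * t, s * t ^ 2]) :
    rMat q a b * (diagonal d ⊗ₖ diagonal d) = (diagonal d ⊗ₖ diagonal d) * rMat q a b := by
  have e : ∀ i : Fin 3, d i = s * t ^ (i : ℕ) := by
    subst hd; intro i; fin_cases i <;> simp
  rw [diagonal_kronecker_diagonal]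
  ext ⟨i, j⟩ ⟨k, l⟩
  rw [mul_diagonal, diagonal_mul]
  by_cases h : (i : ℕ) + j = k + l
  · rw [mul_comm]
    congr 1
    simp only [e]
    rw [mul_mul_mul_comm, ← pow_add, ← h, pow_add, mul_mul_mul_comm]
  · have : rMat q a b (i, j) (k, l) = 0 := by
      revert h
      fin_cases i <;> fin_cases j <;> fin_cases k <;> fin_cases l <;> intro h <;>
      first | rfl | exact absurd rfl h
    rw [this, zero_mul, mul_zero]

theorem rMat_smul (c a b : F) : rMat q (c * a) (c * b) = c ^ 2 • rMat q a b := by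
  ext ⟨i, j⟩ ⟨k, l⟩
  rw [rMat, rMat, Matrix.smul_apply, ofRows_apply, ofRows_apply, ← Matrix.smul_apply]
  refine congrFun (congrFun ?_ k) l
  fin_cases i <;> fin_cases j <;>
  (simp only [Fin.mk_zero, Fin.mk_one, Fin.reduceFinMk, Fin.zero_eta, rEnt_00, rEnt_01, rEnt_02,
    rEnt_10, rEnt_11, rEnt_12, rEnt_20, rEnt_21, rEnt_22, mk3_smul]
   apply mk3_congr <;> (try simp only [rA, rB, rG, rD, rE, rP, rS, rH]) <;> ring)

end

section
variable {F : Type*} [Field F] {A : Type*} [Ring A] [Algebra F A]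

/-- Over a noncommutative ring the mixed product rule needs the inner factors to commute; below, one
of them is always scalar. -/
theorem kronecker_mul_kronecker {l m : Type*} [Fintype l] [Fintype m]
    (X X' : Matrix l l A) (Y Y' : Matrix m m A) (h : ∀ i j k n, Commute (Y i j) (X' k n)) :
    (X ⊗ₖ Y) * (X' ⊗ₖ Y') = (X * X') ⊗ₖ (Y * Y') := by
  ext ⟨i, j⟩ ⟨k, n⟩
  simp only [Matrix.mul_apply, kroneckerMap_apply, Fintype.sum_prod_type, Finset.sum_mul_sum]
  refine Finset.sum_congr rfl fun a _ => Finset.sum_congr rfl fun b _ => ?_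
  rw [mul_assoc, mul_assoc, ← mul_assoc (Y j b), (h j b a k).eq, mul_assoc]

end
end DynK

end

/-! ### The reflection equation as an equation between intertwiners. -/

open scoped Kronecker
noncomputable section

namespace DynK

open Matrix

section
variable {F : Type*} [Field F] {A : Type*} [Ring A] [Algebra F A]

/-- The image of the coaction in the tensor product of two three-dimensional representations. -/
def tensL (t : F) (d m n : Matrix (Fin 3) (Fin 3) F) (a : A) :
    Matrix (Fin 3 × Fin 3) (Fin 3 × Fin 3) A :=
  ((t • m) ⊗ₖ (1 : Matrix (Fin 3) (Fin 3) F) + d ⊗ₖ n).map (algebraMap F A)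
    + (d ⊗ₖ d).map (algebraMap F A) * scalar (Fin 3 × Fin 3) a

/-- The image of the opposite coaction. -/
def tensR (t : F) (d m n : Matrix (Fin 3) (Fin 3) F) (a : A) :
    Matrix (Fin 3 × Fin 3) (Fin 3 × Fin 3) A :=
  ((1 : Matrix (Fin 3) (Fin 3) F) ⊗ₖ (t • n) + m ⊗ₖ d).map (algebraMap F A)
    + (d ⊗ₖ d).map (algebraMap F A) * scalar (Fin 3 × Fin 3) a

variable {t : F} {d m n m' n' : Matrix (Fin 3) (Fin 3) F} {a : A}

/-- In this form the algebra acts through the second tensor factor only, so `1 ⊗ L` passes through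
whenever `L` is an intertwiner. -/
theorem tensL_eq : tensL t d m n a
    = (t • m).map (algebraMap F A) ⊗ₖ (1 : Matrix (Fin 3) (Fin 3) A)
      + d.map (algebraMap F A)
        ⊗ₖ (n.map (algebraMap F A) + d.map (algebraMap F A) * scalar (Fin 3) a) := by
  ext ⟨i, j⟩ ⟨k, l⟩
  simp [tensL, kroneckerMap_apply, one_apply, mul_diagonal, mul_add, mul_assoc, add_assoc,
    apply_ite (algebraMap F A)]

/-- In the opposite order the algebra acts through the first factor, which is what `K ⊗ 1` needs. -/
theorem tensR_eq : tensR t d m n a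
    = (1 : Matrix (Fin 3) (Fin 3) A) ⊗ₖ (t • n).map (algebraMap F A)
      + (m.map (algebraMap F A) + d.map (algebraMap F A) * scalar (Fin 3) a)
        ⊗ₖ d.map (algebraMap F A) := by
  ext ⟨i, j⟩ ⟨k, l⟩
  have e := Algebra.commutes (d j l) a
  simp [tensR, kroneckerMap_apply, one_apply, mul_diagonal, add_mul, mul_assoc, add_assoc,
    apply_ite (algebraMap F A), e]

theorem map_mul_scalar_commute (R D : Matrix (Fin 3 × Fin 3) (Fin 3 × Fin 3) F)
    (h : R * D = D * R) (a : A) :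
    R.map (algebraMap F A) * (D.map (algebraMap F A) * scalar _ a)
      = D.map (algebraMap F A) * scalar _ a * R.map (algebraMap F A) := by
  have e : scalar (Fin 3 × Fin 3) a * R.map (algebraMap F A)
      = R.map (algebraMap F A) * scalar _ a := by
    ext p r
    simp [diagonal_mul, mul_diagonal, Algebra.commutes]
  rw [mul_assoc, e, ← mul_assoc, ← mul_assoc, ← Matrix.map_mul, ← Matrix.map_mul, h]

theorem map_mul_tensL {R : Matrix (Fin 3 × Fin 3) (Fin 3 × Fin 3) F}
    (h : R * ((t • m) ⊗ₖ 1 + d ⊗ₖ n) = (1 ⊗ₖ (t • n) + m ⊗ₖ d) * R)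
    (hd : R * (d ⊗ₖ d) = (d ⊗ₖ d) * R) :
    R.map (algebraMap F A) * tensL t d m n a = tensR t d m n a * R.map (algebraMap F A) := by
  rw [tensL, tensR, mul_add, add_mul, map_mul_scalar_commute _ _ hd, ← Matrix.map_mul,
    ← Matrix.map_mul, h]

theorem map_mul_tensR {R : Matrix (Fin 3 × Fin 3) (Fin 3 × Fin 3) F}
    (h : R * (1 ⊗ₖ (t • n) + m ⊗ₖ d) = ((t • m) ⊗ₖ 1 + d ⊗ₖ n) * R)
    (hd : R * (d ⊗ₖ d) = (d ⊗ₖ d) * R) :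
    R.map (algebraMap F A) * tensR t d m n a = tensL t d m n a * R.map (algebraMap F A) := by
  rw [tensL, tensR, mul_add, add_mul, map_mul_scalar_commute _ _ hd, ← Matrix.map_mul,
    ← Matrix.map_mul, h]

theorem commute_map (L : Matrix (Fin 3) (Fin 3) A) (M : Matrix (Fin 3) (Fin 3) F) (i j k n : Fin 3) :
    Commute (L i j) (M.map (algebraMap F A) k n) := (Algebra.commutes (M k n) (L i j)).symm

theorem commute_one (L : Matrix (Fin 3) (Fin 3) A) (i j k n : Fin 3) :
    Commute (L i j) ((1 : Matrix (Fin 3) (Fin 3) A) k n) := by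
  rw [one_apply]; split_ifs
  exacts [Commute.one_right _, Commute.zero_right _]

theorem inSecond_mul_tensL {L : Matrix (Fin 3) (Fin 3) A}
    (h : L * (n.map (algebraMap F A) + d.map (algebraMap F A) * scalar (Fin 3) a)
      = (n'.map (algebraMap F A) + d.map (algebraMap F A) * scalar (Fin 3) a) * L) :
    inSecond L * tensL t d m n a = tensL t d m n' a * inSecond L := by
  rw [tensL_eq, tensL_eq, inSecond, mul_add, add_mul,
    kronecker_mul_kronecker _ _ _ _ (commute_map _ _),
    kronecker_mul_kronecker _ _ _ _ (commute_map _ _),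
    kronecker_mul_kronecker _ _ _ _ (commute_one _),
    kronecker_mul_kronecker _ _ _ _ (commute_one _), h,
    one_mul, mul_one, one_mul, mul_one, one_mul, mul_one]

theorem inFirst_mul_tensR {K : Matrix (Fin 3) (Fin 3) A}
    (h : K * (m.map (algebraMap F A) + d.map (algebraMap F A) * scalar (Fin 3) a)
      = (m'.map (algebraMap F A) + d.map (algebraMap F A) * scalar (Fin 3) a) * K) :
    inFirst K * tensR t d m n a = tensR t d m' n a * inFirst K := by
  rw [tensR_eq, tensR_eq, inFirst, mul_add, add_mul,
    kronecker_mul_kronecker _ _ _ _ (commute_one _),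
    kronecker_mul_kronecker _ _ _ _ fun i j k l => (commute_one _ k l i j).symm,
    kronecker_mul_kronecker _ _ _ _ fun i j k l => (commute_map K (t • n) k l i j).symm,
    kronecker_mul_kronecker _ _ _ _ fun i j k l => (commute_map K d k l i j).symm, h,
    one_mul, mul_one, one_mul, mul_one, one_mul, mul_one]

/-- The difference of the two sides of the reflection equation. -/
def reflDiff (q u v : F) (K L : Matrix (Fin 3) (Fin 3) A) :
    Matrix (Fin 3 × Fin 3) (Fin 3 × Fin 3) A :=
  (rFlip q u v).map (algebraMap F A) * inFirst K * (rMat q (u * v) 1).map (algebraMap F A)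
      * inSecond L
    - inSecond L * (rFlip q (u * v) 1).map (algebraMap F A) * inFirst K
      * (rMat q u v).map (algebraMap F A)

theorem submatrix_swap_kronecker (X Y : Matrix (Fin 3) (Fin 3) F) :
    (X ⊗ₖ Y).submatrix Prod.swap Prod.swap = Y ⊗ₖ X := by
  ext ⟨i, j⟩ ⟨k, l⟩
  simp [mul_comm]

/-- Conjugation by the flip of the two factors exchanges the coaction with its opposite, so `R₂₁`
intertwines in the other direction. -/
theorem swap_intertwine {R : Matrix (Fin 3 × Fin 3) (Fin 3 × Fin 3) F}
    (h : R * ((t • m) ⊗ₖ 1 + d ⊗ₖ n) = (1 ⊗ₖ (t • n) + m ⊗ₖ d) * R) :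
    R.submatrix Prod.swap Prod.swap * (1 ⊗ₖ (t • m) + n ⊗ₖ d)
      = ((t • n) ⊗ₖ 1 + d ⊗ₖ m) * R.submatrix Prod.swap Prod.swap := by
  have := congrArg (fun M => M.submatrix (Equiv.prodComm (Fin 3) (Fin 3))
    (Equiv.prodComm (Fin 3) (Fin 3))) h
  simp only [← submatrix_mul_equiv _ _ _ (Equiv.prodComm (Fin 3) (Fin 3))] at this
  simpa [submatrix_add, submatrix_swap_kronecker] using this

theorem swap_commute {R : Matrix (Fin 3 × Fin 3) (Fin 3 × Fin 3) F}
    (hd : R * (d ⊗ₖ d) = (d ⊗ₖ d) * R) :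
    R.submatrix Prod.swap Prod.swap * (d ⊗ₖ d) = (d ⊗ₖ d) * R.submatrix Prod.swap Prod.swap := by
  have := congrArg (fun M => M.submatrix (Equiv.prodComm (Fin 3) (Fin 3))
    (Equiv.prodComm (Fin 3) (Fin 3))) hd
  simp only [← submatrix_mul_equiv _ _ _ (Equiv.prodComm (Fin 3) (Fin 3))] at this
  simpa [submatrix_swap_kronecker] using this

/-- The two sides of the reflection equation intertwine the same representations. -/
theorem reflDiff_mul_tensL {q u v : F} {K L : Matrix (Fin 3) (Fin 3) A}
    {m₁ m₂ n₁ n₂ : Matrix (Fin 3) (Fin 3) F}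
    (hK : K * (m₁.map (algebraMap F A) + d.map (algebraMap F A) * scalar (Fin 3) a)
      = (n₁.map (algebraMap F A) + d.map (algebraMap F A) * scalar (Fin 3) a) * K)
    (hL : L * (m₂.map (algebraMap F A) + d.map (algebraMap F A) * scalar (Fin 3) a)
      = (n₂.map (algebraMap F A) + d.map (algebraMap F A) * scalar (Fin 3) a) * L)
    (hd : ∀ a b, rMat q a b * (d ⊗ₖ d) = (d ⊗ₖ d) * rMat q a b)
    (h₁ : rMat q (u * v) 1 * ((t • m₁) ⊗ₖ 1 + d ⊗ₖ n₂)
      = (1 ⊗ₖ (t • n₂) + m₁ ⊗ₖ d) * rMat q (u * v) 1)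
    (h₂ : rMat q u v * ((t • n₂) ⊗ₖ 1 + d ⊗ₖ n₁) = (1 ⊗ₖ (t • n₁) + n₂ ⊗ₖ d) * rMat q u v)
    (h₃ : rMat q u v * ((t • m₁) ⊗ₖ 1 + d ⊗ₖ m₂) = (1 ⊗ₖ (t • m₂) + m₁ ⊗ₖ d) * rMat q u v)
    (h₄ : rMat q (u * v) 1 * ((t • m₂) ⊗ₖ 1 + d ⊗ₖ n₁)
      = (1 ⊗ₖ (t • n₁) + m₂ ⊗ₖ d) * rMat q (u * v) 1) :
    reflDiff q u v K L * tensL t d m₁ m₂ a = tensL t d n₁ n₂ a * reflDiff q u v K L := by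
  have e₁ := map_mul_tensL (a := a) h₁ (hd _ _)
  have e₂ := map_mul_tensR (a := a) (swap_intertwine h₂) (swap_commute (hd _ _))
  have e₃ := map_mul_tensL (a := a) h₃ (hd _ _)
  have e₄ := map_mul_tensR (a := a) (swap_intertwine h₄) (swap_commute (hd _ _))
  have k₁ := inSecond_mul_tensL (t := t) (m := m₁) hL
  have k₂ := inSecond_mul_tensL (t := t) (m := n₁) hL
  have k₃ := inFirst_mul_tensR (t := t) (n := n₂) hK
  have k₄ := inFirst_mul_tensR (t := t) (n := m₂) hK
  rw [reflDiff, sub_mul, mul_sub]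
  congr 1
  · rw [mul_assoc, k₁, ← mul_assoc, mul_assoc _ _ (tensL t d m₁ n₂ a), e₁, ← mul_assoc,
      mul_assoc _ _ (tensR t d m₁ n₂ a), k₃, ← mul_assoc, rFlip, e₂]
    simp only [mul_assoc]
  · rw [mul_assoc, e₃, ← mul_assoc, mul_assoc _ _ (tensR t d m₁ m₂ a), k₄, ← mul_assoc,
      mul_assoc _ _ (tensR t d n₁ m₂ a), rFlip, e₄, ← mul_assoc, k₂]
    simp only [mul_assoc]

/-- The scalar vectors in the kernel of `E`, written as matrices. -/
def kerMat (F : Type*) [Field F] [Algebra F A] (E : Matrix (Fin 3 × Fin 3) (Fin 3 × Fin 3) A) :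
    Submodule F (Matrix (Fin 3) (Fin 3) F) where
  carrier := {M | E *ᵥ (fun p => algebraMap F A (M p.1 p.2)) = 0}
  zero_mem' := by
    change E *ᵥ _ = 0
    convert mulVec_zero E using 2
    ext p; simp
  add_mem' := by
    intro M N hM hN
    change E *ᵥ _ = 0
    rw [← add_zero (0 : Fin 3 × Fin 3 → A)]
    nth_rewrite 1 [← (hM : E *ᵥ _ = 0)]
    rw [← (hN : E *ᵥ _ = 0), ← mulVec_add]
    congr 1; ext p; simp
  smul_mem' := by
    intro c M hM
    change E *ᵥ _ = 0
    rw [← smul_zero c, ← (hM : E *ᵥ _ = 0), ← mulVec_smul]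
    congr 1; ext p; simp [Algebra.smul_def]

variable {E E' : Matrix (Fin 3 × Fin 3) (Fin 3 × Fin 3) A}

theorem mem_kerMat {M : Matrix (Fin 3) (Fin 3) F} :
    M ∈ kerMat F E ↔ E *ᵥ (fun p => algebraMap F A (M p.1 p.2)) = 0 := Iff.rfl

theorem kronecker_mulVec (X Y M : Matrix (Fin 3) (Fin 3) F) :
    (X ⊗ₖ Y) *ᵥ (fun p => M p.1 p.2) = fun p => (X * M * Yᵀ) p.1 p.2 := by
  ext ⟨i, j⟩
  simp only [mulVec, dotProduct, Matrix.mul_apply, Fintype.sum_prod_type, kroneckerMap_apply,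
    transpose_apply, Finset.sum_mul]
  rw [Finset.sum_comm]
  exact Finset.sum_congr rfl fun _ _ => Finset.sum_congr rfl fun _ _ => by ring

theorem map_mulVec_map (X : Matrix (Fin 3 × Fin 3) (Fin 3 × Fin 3) F) (ψ : Fin 3 × Fin 3 → F) :
    X.map (algebraMap F A) *ᵥ (fun p => algebraMap F A (ψ p))
      = fun p => algebraMap F A ((X *ᵥ ψ) p) := by
  ext p
  simp [mulVec, dotProduct, map_sum]

/-- Acting on a weight vector, the part containing `a` only multiplies by `c` and by `a` on the
right, which stays in the kernel. So the scalar part alone preserves the kernel. -/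
theorem kerMat_step (hE : E * tensL t d m n a = E' * E) {M : Matrix (Fin 3) (Fin 3) F}
    (hM : M ∈ kerMat F E) {c : F} (hc : d * M * dᵀ = c • M) :
    t • m * M + d * M * nᵀ ∈ kerMat F E := by
  rw [mem_kerMat] at hM ⊢
  have h1 : E *ᵥ (tensL t d m n a *ᵥ fun p => algebraMap F A (M p.1 p.2)) = 0 := by
    rw [mulVec_mulVec, hE, ← mulVec_mulVec, hM, mulVec_zero]
  have h2 : tensL t d m n a *ᵥ (fun p => algebraMap F A (M p.1 p.2))
      = (fun p => algebraMap F A ((t • m * M + d * M * nᵀ) p.1 p.2))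
        + c • fun p => algebraMap F A (M p.1 p.2) * a := by
    rw [tensL, add_mulVec, map_mulVec_map, add_mulVec, kronecker_mulVec, kronecker_mulVec,
      transpose_one, mul_one, ← mulVec_mulVec]
    have e : scalar (Fin 3 × Fin 3) a *ᵥ (fun p => algebraMap F A (M p.1 p.2))
        = fun p => algebraMap F A (M p.1 p.2) * a := by
      ext p; simp [mulVec_diagonal, Algebra.commutes]
    have e' : (d ⊗ₖ d).map (algebraMap F A) *ᵥ (fun p => algebraMap F A (M p.1 p.2) * a)
        = fun p => ((d ⊗ₖ d).map (algebraMap F A) *ᵥ fun p => algebraMap F A (M p.1 p.2)) p * a := by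
      ext p; simp only [mulVec, dotProduct, Finset.sum_mul, mul_assoc]
    rw [e, e', map_mulVec_map, kronecker_mulVec, hc]
    ext p
    simp [Algebra.smul_def, mul_assoc]
  have h3 : E *ᵥ (fun p => algebraMap F A (M p.1 p.2) * a) = 0 := by
    ext p
    have := congrFun hM p
    simp only [mulVec, dotProduct, Pi.zero_apply] at this ⊢
    simp only [← mul_assoc, ← Finset.sum_mul, this, zero_mul]
  rwa [h2, mulVec_add, mulVec_smul, h3, smul_zero, add_zero] at h1

theorem eq_zero_of_kerMat (h : ∀ i j, Matrix.single i j 1 ∈ kerMat F E) : E = 0 := by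
  ext p ⟨i, j⟩
  have := congrFun (mem_kerMat.1 (h i j)) p
  simpa [mulVec, dotProduct, Fintype.sum_prod_type, Matrix.single_apply, ite_and,
    apply_ite (algebraMap F A)] using this

end
end DynK

end

/-! ### Cyclicity of `v₃ ⊗ v₃` for generic spectral parameters. -/

open scoped Kronecker
noncomputable section

namespace DynK

open Matrix

section
variable {F : Type*} [Field F] {q : F}

theorem ons1_transpose : (ons1 q)ᵀ = ons1 q := by
  ext i j; fin_cases i <;> fin_cases j <;> rfl

theorem ons0_transpose (s t : F) : (ons0 q s t)ᵀ = ons0 q t s := by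
  ext i j; fin_cases i <;> fin_cases j <;> rfl

theorem wt1_transpose : (wt1 q)ᵀ = wt1 q := diagonal_transpose _
theorem wt0_transpose : (wt0 q)ᵀ = wt0 q := diagonal_transpose _

theorem wt1_conj (a b c d e f g h i : F) : wt1 q * mk3 a b c d e f g h i * (wt1 q)ᵀ
    = mk3 (q ^ 8 * a) (q ^ 6 * b) (q ^ 4 * c) (q ^ 6 * d) (q ^ 4 * e) (q ^ 2 * f) (q ^ 4 * g)
      (q ^ 2 * h) i := by
  ext k l
  fin_cases k <;> fin_cases l <;> simp [wt1, mk3] <;> ring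

theorem wt0_conj (a b c d e f g h i : F) : wt0 q * mk3 a b c d e f g h i * (wt0 q)ᵀ
    = mk3 a (q ^ 4 * b) (q ^ 8 * c) (q ^ 4 * d) (q ^ 8 * e) (q ^ 12 * f) (q ^ 8 * g)
      (q ^ 12 * h) (q ^ 16 * i) := by
  ext k l
  fin_cases k <;> fin_cases l <;> simp [wt0, mk3] <;> ring

variable {A : Type*} [Ring A] [Algebra F A] {x y : A}
  {E E₁ E₀ : Matrix (Fin 3 × Fin 3) (Fin 3 × Fin 3) A}

theorem kerMat_step_ons1 (hq0 : q ≠ 0) (hq4 : q ^ 4 - 1 ≠ 0)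
    (hE : E * tensL (q ^ 2) (wt1 q) (ons1 q) (ons1 q) y = E₁ * E) {a b c d e f g h i : F}
    (hM : mk3 a b c d e f g h i ∈ kerMat F E) (k : ℕ)
    (hk : mk3 (q ^ 8 * a) (q ^ 6 * b) (q ^ 4 * c) (q ^ 6 * d) (q ^ 4 * e) (q ^ 2 * f) (q ^ 4 * g)
      (q ^ 2 * h) i = q ^ k • mk3 a b c d e f g h i) :
    mk3 (q ^ 3 * d + q ^ 5 * b) (q ^ 3 * e + q ^ 4 * (q * a + c))
          (q ^ 3 * f + q ^ 4 * b) (q ^ 2 * (q * a + g) + q ^ 3 * e)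
          (q ^ 2 * (q * b + h) + q ^ 2 * (q * d + f)) (q ^ 2 * (q * c + i) + q ^ 2 * e)
          (q ^ 2 * d + q * h) (q ^ 2 * e + (q * g + i)) (q ^ 2 * f + h) ∈ kerMat F E := by
  have := kerMat_step hE hM ((wt1_conj ..).trans hk)
  have e := ons1_act q a b c d e f g h i
  rw [transpose_smul, ons1_transpose, wt1_transpose] at e
  rw [ons1_transpose, e] at this
  exact (Submodule.smul_mem_iff _ (mul_ne_zero (pow_ne_zero _ hq0) hq4)).1 this

theorem kerMat_step_ons0 (hq0 : q ≠ 0) (hq8 : q ^ 8 - 1 ≠ 0) {s t s' t' : F}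
    (hE : E * tensL (q ^ 4) (wt0 q) (ons0 q s t) (ons0 q s' t') x = E₀ * E)
    {a b c d e f g h i : F} (hM : mk3 a b c d e f g h i ∈ kerMat F E) (k : ℕ)
    (hk : mk3 a (q ^ 4 * b) (q ^ 8 * c) (q ^ 4 * d) (q ^ 8 * e) (q ^ 12 * f) (q ^ 8 * g)
      (q ^ 12 * h) (q ^ 16 * i) = q ^ k • mk3 a b c d e f g h i) :
    mk3 (q ^ 4 * s * g + c * s') (q ^ 4 * s * h)
          (q ^ 4 * s * i + a * t') (q ^ 4 * f * s') 0 (q ^ 4 * d * t')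
          (q ^ 4 * t * a + q ^ 8 * i * s') (q ^ 4 * t * b) (q ^ 4 * t * c + q ^ 8 * g * t')
      ∈ kerMat F E := by
  have := kerMat_step hE hM ((wt0_conj ..).trans hk)
  have e := ons0_act q t s t' s' a b c d e f g h i
  rw [transpose_smul, ons0_transpose, wt0_transpose] at e
  rw [ons0_transpose, e] at this
  exact (Submodule.smul_mem_iff _ (mul_ne_zero (pow_ne_zero _ hq0) hq8)).1 this

/-- The vector `v₃ ⊗ v₃` lies in the kernel, and the two steps generate all nine basis vectors from
it. The excluded values `v = q ^ 4 u` and `v = -q ^ 6 u` are those for which the vectors obtained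
below fail to be independent. -/
theorem eq_zero_of_col_eq_zero (hq0 : q ≠ 0) (hq4 : q ^ 4 - 1 ≠ 0) (hq8 : q ^ 8 - 1 ≠ 0)
    (hq3 : q ^ 4 + q ^ 2 + 1 ≠ 0) {u v : F} (hu : u ≠ 0) (hv : v ≠ 0)
    (h1 : v - q ^ 4 * u ≠ 0) (h2 : v + q ^ 6 * u ≠ 0)
    (hE₁ : E * tensL (q ^ 2) (wt1 q) (ons1 q) (ons1 q) y = E₁ * E)
    (hE₀ : E * tensL (q ^ 4) (wt0 q) (ons0 q u⁻¹ u) (ons0 q v⁻¹ v) x = E₀ * E)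
    (h : ∀ i j, E (i, j) (2, 2) = 0) : E = 0 := by
  have s1 := @kerMat_step_ons1 F _ q A _ _ y E E₁ hq0 hq4 hE₁
  have s0 := @kerMat_step_ons0 F _ q A _ _ x E E₀ hq0 hq8 _ _ _ _ hE₀
  have h33 : (mk3 0 0 0 0 0 0 0 0 1 : Matrix _ _ F) ∈ kerMat F E := by
    rw [mem_kerMat]
    ext ⟨i, j⟩
    simp [mulVec, dotProduct, Fintype.sum_prod_type, Fin.sum_univ_three, mk3, h i j]
  have w0 : (mk3 0 0 0 0 0 (q ^ 2) 0 1 0 : Matrix _ _ F) ∈ kerMat F E := by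
    convert s1 h33 0 ?_ using 1
    · apply mk3_congr <;> ring
    · rw [mk3_smul]; apply mk3_congr <;> ring
  have w1 : (mk3 0 0 (q ^ 4) 0 (q ^ 3 + q) 0 1 0 0 : Matrix _ _ F) ∈ kerMat F E := by
    have := (kerMat F E).sub_mem (s1 w0 2 (by rw [mk3_smul]; apply mk3_congr <;> ring))
      ((kerMat F E).smul_mem (q ^ 4 + 1) h33)
    rw [← Submodule.smul_mem_iff _ hq0]
    rw [sub_eq_add_neg, ← neg_smul, mk3_smul, mk3_add] at this
    convert this using 1
    rw [mk3_smul]; apply mk3_congr <;> ring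
  -- The step for `ons0` jumps directly from weight `0` to weight `4` and brings in the spectral
  -- parameters.
  have d : (mk3 0 0 v 0 0 0 (q ^ 4 * u) 0 0 : Matrix _ _ F) ∈ kerMat F E := by
    have := (kerMat F E).smul_mem (u * v)
      (s0 h33 16 (by rw [mk3_smul]; apply mk3_congr <;> ring))
    rw [← Submodule.smul_mem_iff _ (pow_ne_zero 4 hq0)]
    convert this using 1
    rw [mk3_smul, mk3_smul]; apply mk3_congr <;> field_simp <;> ring
  have b1 : (mk3 0 v 0 (q ^ 2 * u) 0 0 0 0 0 : Matrix _ _ F) ∈ kerMat F E := by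
    have := (kerMat F E).smul_mem (u * v)
      (s0 w0 12 (by rw [mk3_smul]; apply mk3_congr <;> ring))
    rw [← Submodule.smul_mem_iff _ (pow_ne_zero 4 hq0)]
    convert this using 1
    rw [mk3_smul, mk3_smul]; apply mk3_congr <;> field_simp <;> ring
  -- Going down from `d` gives the vectors of weights `6` and `2` mixed; `b1` removes the former,
  -- and together with `w0` this leaves a single basis vector.
  have h23 : (mk3 0 0 0 0 0 1 0 0 0 : Matrix _ _ F) ∈ kerMat F E := by
    have := (kerMat F E).add_mem ((kerMat F E).add_mem
      (s1 d 4 (by rw [mk3_smul]; apply mk3_congr <;> ring))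
      ((kerMat F E).smul_mem (-q ^ 4) b1)) ((kerMat F E).smul_mem (-(q ^ 5 * u)) w0)
    rw [← Submodule.smul_mem_iff _ (mul_ne_zero (pow_ne_zero 3 hq0) h1)]
    rw [mk3_smul, mk3_smul, mk3_add, mk3_add] at this
    convert this using 1
    rw [mk3_smul]; apply mk3_congr <;> ring
  have h32 : (mk3 0 0 0 0 0 0 0 1 0 : Matrix _ _ F) ∈ kerMat F E := by
    have := (kerMat F E).add_mem w0 ((kerMat F E).smul_mem (-q ^ 2) h23)
    rw [mk3_smul, mk3_add] at this
    convert this using 1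
    apply mk3_congr <;> ring
  -- A second vector of weight `6`, independent of `b1` because `v ≠ q ^ 4 u`.
  have b2 : (mk3 0 (q ^ 2) 0 1 0 0 0 0 0 : Matrix _ _ F) ∈ kerMat F E := by
    have := (kerMat F E).add_mem ((kerMat F E).add_mem
      (s1 w1 4 (by rw [mk3_smul]; apply mk3_congr <;> ring))
      ((kerMat F E).smul_mem (-(q ^ 7 + q ^ 5 + q ^ 3)) h23))
      ((kerMat F E).smul_mem (-(q ^ 5 + q ^ 3 + q)) h32)
    rw [← Submodule.smul_mem_iff _ (mul_ne_zero (pow_ne_zero 2 hq0) hq3)]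
    rw [mk3_smul, mk3_smul, mk3_add, mk3_add] at this
    convert this using 1
    rw [mk3_smul]; apply mk3_congr <;> ring
  have h12 : (mk3 0 1 0 0 0 0 0 0 0 : Matrix _ _ F) ∈ kerMat F E := by
    have := (kerMat F E).add_mem b1 ((kerMat F E).smul_mem (-(q ^ 2 * u)) b2)
    rw [← Submodule.smul_mem_iff _ h1]
    rw [mk3_smul, mk3_add] at this
    convert this using 1
    rw [mk3_smul]; apply mk3_congr <;> ring
  have h21 : (mk3 0 0 0 1 0 0 0 0 0 : Matrix _ _ F) ∈ kerMat F E := by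
    have := (kerMat F E).add_mem b2 ((kerMat F E).smul_mem (-q ^ 2) h12)
    rw [mk3_smul, mk3_add] at this
    convert this using 1
    apply mk3_congr <;> ring
  have f1 : (mk3 0 0 0 0 q 0 1 0 0 : Matrix _ _ F) ∈ kerMat F E := by
    have := (kerMat F E).add_mem (s1 h32 2 (by rw [mk3_smul]; apply mk3_congr <;> ring))
      ((kerMat F E).smul_mem (-1) h33)
    rw [← Submodule.smul_mem_iff _ hq0]
    rw [mk3_smul, mk3_add] at this
    convert this using 1
    rw [mk3_smul]; apply mk3_congr <;> ring
  have f2 : (mk3 0 0 q 0 1 0 0 0 0 : Matrix _ _ F) ∈ kerMat F E := by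
    have := (kerMat F E).add_mem (s1 h23 2 (by rw [mk3_smul]; apply mk3_congr <;> ring))
      ((kerMat F E).smul_mem (-q ^ 2) h33)
    rw [← Submodule.smul_mem_iff _ (pow_ne_zero 2 hq0)]
    rw [mk3_smul, mk3_add] at this
    convert this using 1
    rw [mk3_smul]; apply mk3_congr <;> ring
  -- The three vectors `f1`, `f2`, `d` of weight `4` are independent precisely when `v + q ^ 6 u ≠
  -- 0`.
  have h22 : (mk3 0 0 0 0 1 0 0 0 0 : Matrix _ _ F) ∈ kerMat F E := by
    have := (kerMat F E).add_mem ((kerMat F E).add_mem ((kerMat F E).smul_mem v f2)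
      ((kerMat F E).smul_mem (q ^ 5 * u) f1)) ((kerMat F E).smul_mem (-q) d)
    rw [← Submodule.smul_mem_iff _ h2]
    rw [mk3_smul, mk3_smul, mk3_smul, mk3_add, mk3_add] at this
    convert this using 1
    rw [mk3_smul]; apply mk3_congr <;> ring
  have h31 : (mk3 0 0 0 0 0 0 1 0 0 : Matrix _ _ F) ∈ kerMat F E := by
    have := (kerMat F E).add_mem f1 ((kerMat F E).smul_mem (-q) h22)
    rw [mk3_smul, mk3_add] at this
    convert this using 1
    apply mk3_congr <;> ring
  have h13 : (mk3 0 0 1 0 0 0 0 0 0 : Matrix _ _ F) ∈ kerMat F E := by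
    have := (kerMat F E).add_mem f2 ((kerMat F E).smul_mem (-1) h22)
    rw [← Submodule.smul_mem_iff _ hq0]
    rw [mk3_smul, mk3_add] at this
    convert this using 1
    rw [mk3_smul]; apply mk3_congr <;> ring
  have h11 : (mk3 1 0 0 0 0 0 0 0 0 : Matrix _ _ F) ∈ kerMat F E := by
    have := (kerMat F E).add_mem ((kerMat F E).add_mem
      (s1 h12 6 (by rw [mk3_smul]; apply mk3_congr <;> ring))
      ((kerMat F E).smul_mem (-q ^ 3) h22)) ((kerMat F E).smul_mem (-q ^ 4) h13)
    rw [← Submodule.smul_mem_iff _ (pow_ne_zero 5 hq0)]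
    rw [mk3_smul, mk3_smul, mk3_add, mk3_add] at this
    convert this using 1
    rw [mk3_smul]; apply mk3_congr <;> ring
  refine eq_zero_of_kerMat (F := F) fun i j => ?_
  have e : ∀ M : Matrix (Fin 3) (Fin 3) F, M ∈ kerMat F E → Matrix.single i j 1 = M →
      Matrix.single i j 1 ∈ kerMat F E := fun M hM he => he ▸ hM
  fin_cases i <;> fin_cases j
  · exact e _ h11 (by ext k l; fin_cases k <;> fin_cases l <;> simp [mk3, single])
  · exact e _ h12 (by ext k l; fin_cases k <;> fin_cases l <;> simp [mk3, single])
  · exact e _ h13 (by ext k l; fin_cases k <;> fin_cases l <;> simp [mk3, single])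
  · exact e _ h21 (by ext k l; fin_cases k <;> fin_cases l <;> simp [mk3, single])
  · exact e _ h22 (by ext k l; fin_cases k <;> fin_cases l <;> simp [mk3, single])
  · exact e _ h23 (by ext k l; fin_cases k <;> fin_cases l <;> simp [mk3, single])
  · exact e _ h31 (by ext k l; fin_cases k <;> fin_cases l <;> simp [mk3, single])
  · exact e _ h32 (by ext k l; fin_cases k <;> fin_cases l <;> simp [mk3, single])
  · exact e _ h33 (by ext k l; fin_cases k <;> fin_cases l <;> simp [mk3, single])

end
end DynK

end

/-! ### Polynomial dependence on the spectral parameter. -/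

open scoped Kronecker
noncomputable section

namespace DynK

open Matrix Polynomial

section
variable {F : Type*} [Field F] {A : Type*} [Ring A] [Algebra F A]

/-! ### Polynomial functions with coefficients in a noncommutative algebra -/

/-- Evaluation of a polynomial at a scalar. -/
def evalAt (u : F) : A[X] →ₐ[F] A :=
  eval₂AlgHom (AlgHom.id F A) (algebraMap F A u) fun a => (Algebra.commutes u a).symm

theorem evalAt_apply (u : F) (p : A[X]) :
    evalAt u p = eval₂ (RingHom.id A) (algebraMap F A u) p := rfl

/-- The functions of one central parameter that are given by a polynomial. -/
def polyFun (F A : Type*) [Field F] [Ring A] [Algebra F A] : Subalgebra F (F → A) :=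
  (AlgHom.pi (fun u : F => (evalAt u : A[X] →ₐ[F] A))).range

theorem mem_polyFun {f : F → A} : f ∈ polyFun F A ↔ ∃ p : A[X], ∀ u, f u = evalAt u p := by
  rw [polyFun, AlgHom.mem_range]
  exact exists_congr fun p => ⟨fun h u => (congrFun h u).symm, fun h => funext fun u => (h u).symm⟩

theorem const_mem_polyFun (a : A) : (fun _ => a) ∈ polyFun F A :=
  mem_polyFun.2 ⟨C a, fun u => by simp [evalAt_apply]⟩

theorem algebraMap_mem_polyFun : (fun u => algebraMap F A u) ∈ polyFun F A :=
  mem_polyFun.2 ⟨X, fun u => by simp [evalAt_apply]⟩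

theorem id_mem_polyFun : (fun u : F => u) ∈ polyFun F F := algebraMap_mem_polyFun

theorem add_mem_polyFun {f g : F → A} (hf : f ∈ polyFun F A) (hg : g ∈ polyFun F A) :
    (fun u => f u + g u) ∈ polyFun F A := add_mem hf hg

theorem sub_mem_polyFun {f g : F → A} (hf : f ∈ polyFun F A) (hg : g ∈ polyFun F A) :
    (fun u => f u - g u) ∈ polyFun F A := sub_mem hf hg

theorem neg_mem_polyFun {f : F → A} (hf : f ∈ polyFun F A) :
    (fun u => -f u) ∈ polyFun F A := neg_mem hf

theorem mul_mem_polyFun {f g : F → A} (hf : f ∈ polyFun F A) (hg : g ∈ polyFun F A) :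
    (fun u => f u * g u) ∈ polyFun F A := mul_mem hf hg

theorem pow_mem_polyFun {f : F → A} (hf : f ∈ polyFun F A) (n : ℕ) :
    (fun u => f u ^ n) ∈ polyFun F A := pow_mem hf n

theorem sum_mem_polyFun {ι : Type*} {s : Finset ι} {f : ι → F → A}
    (hf : ∀ i, f i ∈ polyFun F A) : (fun u => ∑ i ∈ s, f i u) ∈ polyFun F A := by
  have : (fun u => ∑ i ∈ s, f i u) = ∑ i ∈ s, f i := by ext u; simp
  rw [this]; exact sum_mem fun i _ => hf i

theorem map_mem_polyFun {c : F → F} (hc : c ∈ polyFun F F) :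
    (fun u => algebraMap F A (c u)) ∈ polyFun F A := by
  obtain ⟨p, hp⟩ := mem_polyFun.1 hc
  refine mem_polyFun.2 ⟨p.map (algebraMap F A), fun u => ?_⟩
  rw [hp, evalAt_apply, evalAt_apply, eval₂_map, hom_eval₂]
  rfl

theorem smul_mem_polyFun {c : F → F} (hc : c ∈ polyFun F F) {f : F → A} (hf : f ∈ polyFun F A) :
    (fun u => c u • f u) ∈ polyFun F A := by
  simp only [Algebra.smul_def]
  exact mul_mem_polyFun (map_mem_polyFun hc) hf

/-- Linear functionals separate the points of `A` and turn the function into an ordinary polynomial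
over an infinite field, which has infinitely many roots. -/
theorem eq_zero_of_polyFun [Infinite F] {f : F → A} (hf : f ∈ polyFun F A) {S : Set F}
    (hS : S.Finite) (h : ∀ u ∉ S, f u = 0) : f = 0 := by
  obtain ⟨p, hp⟩ := mem_polyFun.1 hf
  ext u
  refine (Module.forall_dual_apply_eq_zero_iff F _).1 fun φ => ?_
  have e : ∀ u, φ (f u)
      = (∑ i ∈ Finset.range (p.natDegree + 1), C (φ (p.coeff i)) * X ^ i).eval u := by
    intro u
    simp only [hp, evalAt_apply, eval₂_eq_sum_range, map_sum, eval_finsetSum,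
      eval_mul, eval_C, eval_pow, eval_X]
    refine Finset.sum_congr rfl fun i _ => ?_
    rw [← map_pow, ← Algebra.commutes, ← Algebra.smul_def, map_smul, smul_eq_mul, mul_comm]
    rfl
  have h0 : (∑ i ∈ Finset.range (p.natDegree + 1), C (φ (p.coeff i)) * X ^ i) = 0 := by
    refine eq_zero_of_infinite_isRoot _ (hS.infinite_compl.mono fun u hu => ?_)
    change eval u _ = 0
    rw [← e, h u hu, map_zero]
  rw [e, h0, eval_zero]

/-- The entries of the matrix are polynomial functions. -/
def PolyMat {m n : Type*} (M : F → Matrix m n A) : Prop :=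
  ∀ i j, (fun u => M u i j) ∈ polyFun F A

section
variable {l m n : Type*}

theorem PolyMat.mul [Fintype m] {M : F → Matrix l m A} {N : F → Matrix m n A} (hM : PolyMat M)
    (hN : PolyMat N) : PolyMat fun u => M u * N u := fun i j => by
  simp only [Matrix.mul_apply]
  exact sum_mem_polyFun fun k => mul_mem_polyFun (hM i k) (hN k j)

theorem PolyMat.sub {M N : F → Matrix l m A} (hM : PolyMat M)
    (hN : PolyMat N) : PolyMat fun u => M u - N u := fun i j => sub_mem_polyFun (hM i j) (hN i j)

theorem PolyMat.add {M N : F → Matrix l m A} (hM : PolyMat M)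
    (hN : PolyMat N) : PolyMat fun u => M u + N u := fun i j => add_mem_polyFun (hM i j) (hN i j)

theorem PolyMat.smul {c : F → F} (hc : c ∈ polyFun F F) {M : F → Matrix l m A}
    (hM : PolyMat M) : PolyMat fun u => c u • M u := fun i j => smul_mem_polyFun hc (hM i j)

theorem PolyMat.const (M : Matrix l m A) : PolyMat fun _ : F => M := fun i j =>
  const_mem_polyFun (M i j)

theorem PolyMat.map {M : F → Matrix l m F} (hM : PolyMat M) :
    PolyMat fun u => (M u).map (algebraMap F A) := fun i j => map_mem_polyFun (hM i j)

theorem PolyMat.inFirst {M : F → Matrix (Fin 3) (Fin 3) A} (hM : PolyMat M) :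
    PolyMat fun u => inFirst (M u) := fun i j =>
  mul_mem_polyFun (hM i.1 j.1) (const_mem_polyFun _)

end

variable (q v : F) {a b : F → F}

theorem polyMat_mk3 {a b c d e f g h i : F → F} (ha : a ∈ polyFun F F) (hb : b ∈ polyFun F F)
    (hc : c ∈ polyFun F F) (hd : d ∈ polyFun F F) (he : e ∈ polyFun F F) (hf : f ∈ polyFun F F)
    (hg : g ∈ polyFun F F) (hh : h ∈ polyFun F F) (hi : i ∈ polyFun F F) :
    PolyMat fun u => mk3 (a u) (b u) (c u) (d u) (e u) (f u) (g u) (h u) (i u) := by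
  intro k l
  fin_cases k <;> fin_cases l <;> assumption

theorem polyMat_rMat (ha : a ∈ polyFun F F) (hb : b ∈ polyFun F F) :
    PolyMat fun u => rMat q (a u) (b u) := by
  rintro ⟨i, j⟩ ⟨k, l⟩
  simp only [rMat, ofRows_apply]
  have : PolyMat fun u => rEnt q (a u) (b u) i j := by
    fin_cases i <;> fin_cases j <;>
    (simp only [Fin.mk_zero, Fin.mk_one, Fin.reduceFinMk, Fin.zero_eta, rEnt_00, rEnt_01, rEnt_02,
        rEnt_10, rEnt_11, rEnt_12, rEnt_20, rEnt_21, rEnt_22, rA, rB, rG, rD, rE, rP, rS, rH]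
     apply polyMat_mk3) <;>
    repeat' first
      | exact ha
      | exact hb
      | exact const_mem_polyFun _
      | apply add_mem_polyFun
      | apply sub_mem_polyFun
      | apply neg_mem_polyFun
      | apply mul_mem_polyFun
      | apply pow_mem_polyFun
  exact this k l

theorem polyMat_rFlip (ha : a ∈ polyFun F F) (hb : b ∈ polyFun F F) :
    PolyMat fun u => rFlip q (a u) (b u) := fun p r => polyMat_rMat q ha hb p.swap r.swap

theorem polyMat_reflDiff {K : F → Matrix (Fin 3) (Fin 3) A} (hK : PolyMat K)
    (L : Matrix (Fin 3) (Fin 3) A) : PolyMat fun u => reflDiff q u v (K u) L := by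
  have h1 := id_mem_polyFun (F := F)
  have h2 := const_mem_polyFun (F := F) (A := F)
  have h3 : (fun u => u * v) ∈ polyFun F F := mul_mem_polyFun h1 (h2 v)
  exact ((((polyMat_rFlip q h1 (h2 v)).map.mul hK.inFirst).mul
    (polyMat_rMat q h3 (h2 1)).map).mul (PolyMat.const _)).sub
    ((((PolyMat.const _).mul (polyMat_rFlip q h3 (h2 1)).map).mul hK.inFirst).mul
      (polyMat_rMat q h1 (h2 v)).map)

end
end DynK

end

/-! ### Proof of the reflection equation for the rescaled matrix. -/

open scoped Kronecker
noncomputable section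

namespace DynK

open Matrix Polynomial

section
variable {F : Type*} [Field F] {A : Type*} [Ring A] [Algebra F A]

theorem onsM1_eq (q : F) (y : A) : onsM1 q y
    = (ons1 q).map (algebraMap F A) + (wt1 q).map (algebraMap F A) * scalar (Fin 3) y := by
  ext i j
  fin_cases i <;> fin_cases j <;>
    simp [onsM1, ons1, wt1, Algebra.smul_def, mul_diagonal]

theorem onsM0_eq (q s t : F) (x : A) : onsM0 q s t x
    = (ons0 q s t).map (algebraMap F A) + (wt0 q).map (algebraMap F A) * scalar (Fin 3) x := by
  ext i j
  fin_cases i <;> fin_cases j <;>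
    simp [onsM0, ons0, wt0, Algebra.smul_def, mul_diagonal]

theorem rMat_mul_wt1 {q : F} (hq : q ≠ 0) (a b : F) :
    rMat q a b * (wt1 q ⊗ₖ wt1 q) = (wt1 q ⊗ₖ wt1 q) * rMat q a b := by
  refine rMat_mul_diagonal q a b (q ^ 4) (q⁻¹ ^ 2) _ ?_
  congr 2
  · field_simp
  · field_simp

theorem rMat_mul_wt0 (q a b : F) :
    rMat q a b * (wt0 q ⊗ₖ wt0 q) = (wt0 q ⊗ₖ wt0 q) * rMat q a b := by
  refine rMat_mul_diagonal q a b 1 (q ^ 4) _ ?_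
  congr 2
  · ring
  · ring_nf

variable {q : F}

/-- The matrix depends on its two arguments only through their ratio, up to a scalar. So `rMat q (u
* v) 1` can be read with arguments `u, v⁻¹` or `v, u⁻¹`. -/
theorem rMat_scale_mul_ons0 (c : F) {a b : F} (ha : a ≠ 0) (hb : b ≠ 0) :
    rMat q (c * a) (c * b) * ((q ^ 4 • ons0 q a⁻¹ a) ⊗ₖ 1 + wt0 q ⊗ₖ ons0 q b⁻¹ b)
      = (1 ⊗ₖ (q ^ 4 • ons0 q b⁻¹ b) + ons0 q a⁻¹ a ⊗ₖ wt0 q) * rMat q (c * a) (c * b) := by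
  rw [rMat_smul, smul_mul_assoc, rMat_mul_ons0 _ ha hb, mul_smul_comm]

section
variable {a b c d e f g h i : F}
theorem mk3_00 : mk3 a b c d e f g h i 0 0 = a := rfl
theorem mk3_01 : mk3 a b c d e f g h i 0 1 = b := rfl
theorem mk3_02 : mk3 a b c d e f g h i 0 2 = c := rfl
theorem mk3_10 : mk3 a b c d e f g h i 1 0 = d := rfl
theorem mk3_11 : mk3 a b c d e f g h i 1 1 = e := rfl
theorem mk3_12 : mk3 a b c d e f g h i 1 2 = f := rfl
theorem mk3_20 : mk3 a b c d e f g h i 2 0 = g := rfl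
theorem mk3_21 : mk3 a b c d e f g h i 2 1 = h := rfl
theorem mk3_22 : mk3 a b c d e f g h i 2 2 = i := rfl
end

theorem map_rMat_mul_apply (a b : F) (X : Matrix (Fin 3 × Fin 3) (Fin 3 × Fin 3) A) (i j : Fin 3)
    (r : Fin 3 × Fin 3) : ((rMat q a b).map (algebraMap F A) * X) (i, j) r
      = ∑ k, ∑ l, rEnt q a b i j k l • X (k, l) r := by
  simp [Matrix.mul_apply, Fintype.sum_prod_type, rMat, ofRows_apply, Algebra.smul_def]

theorem map_rFlip_mul_apply (a b : F) (X : Matrix (Fin 3 × Fin 3) (Fin 3 × Fin 3) A) (i j : Fin 3)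
    (r : Fin 3 × Fin 3) : ((rFlip q a b).map (algebraMap F A) * X) (i, j) r
      = ∑ k, ∑ l, rEnt q a b j i l k • X (k, l) r := by
  simp [Matrix.mul_apply, Fintype.sum_prod_type, rFlip, rMat, ofRows_apply, Algebra.smul_def]

theorem inFirst_mul_apply (K : Matrix (Fin 3) (Fin 3) A)
    (X : Matrix (Fin 3 × Fin 3) (Fin 3 × Fin 3) A) (i j : Fin 3) (r : Fin 3 × Fin 3) :
    (inFirst K * X) (i, j) r = ∑ k, K i k * X (k, j) r := by
  simp [Matrix.mul_apply, Fintype.sum_prod_type, inFirst, one_apply]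

theorem inSecond_mul_apply (L : Matrix (Fin 3) (Fin 3) A)
    (X : Matrix (Fin 3 × Fin 3) (Fin 3 × Fin 3) A) (i j : Fin 3) (r : Fin 3 × Fin 3) :
    (inSecond L * X) (i, j) r = ∑ k, L j k * X (i, k) r := by
  simp [Matrix.mul_apply, Fintype.sum_prod_type, inSecond, one_apply]

theorem map_rMat_apply_22 (a b : F) (i j : Fin 3) :
    (rMat q a b).map (algebraMap F A) (i, j) (2, 2) = rEnt q a b i j 2 2 • 1 := by
  simp [rMat, ofRows_apply, Algebra.smul_def]

variable {κ : F} {x y z : A}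

theorem kHat_eq_kFull (u : F) :
    kHat q κ u (kA q u) (kA q u * kG q κ u) x y z = kFull q κ u x y z := rfl

theorem kA_mul {u : F} (hu : u ^ 2 - 1 ≠ 0) : kA q u * (u ^ 2 - 1) = q ^ 6 * u ^ 2 := by
  rw [kA, div_mul_cancel₀ _ hu]

/-- The entries of the column `(2, 2)` of `K₁ R'₂₁(w) L₂`. -/
def colX (q w : F) (K L : Matrix (Fin 3) (Fin 3) A) (i j : Fin 3) : A :=
  ∑ k, K i k * ∑ l, rEnt q w 1 k j 2 l • L l 2

theorem rEnt_apply_22 (a b : F) (i j : Fin 3) :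
    rEnt q a b i j 2 2 = if i = 2 then if j = 2 then rA q a b else 0 else 0 := by
  fin_cases i <;> fin_cases j <;> rfl

/-- The vector `v₃ ⊗ v₃` is an eigenvector of `R` with eigenvalue `rA`, so the last factor of the
second product becomes a scalar. -/
theorem reflDiff_apply_22 (u v : F) (K L : Matrix (Fin 3) (Fin 3) A) (i j : Fin 3) :
    reflDiff q u v K L (i, j) (2, 2)
      = (∑ k, ∑ l, rEnt q u v j i l k • colX q (u * v) K L k l)
        - rA q u v • colX q (u * v) L K j i := by
  rw [reflDiff, Matrix.sub_apply]
  congr 1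
  · simp only [mul_assoc, map_rFlip_mul_apply, inFirst_mul_apply, map_rMat_mul_apply, colX]
    refine Finset.sum_congr rfl fun k _ => Finset.sum_congr rfl fun l _ => ?_
    congr 1
    refine Finset.sum_congr rfl fun m _ => ?_
    congr 1
    rw [Finset.sum_comm]
    refine Finset.sum_congr rfl fun n _ => ?_
    simp only [inSecond, kroneckerMap_apply, one_apply, ite_mul, one_mul, zero_mul, smul_ite,
      smul_zero, Finset.sum_ite_eq', Finset.mem_univ, if_true]
  · simp only [mul_assoc, map_rFlip_mul_apply, inFirst_mul_apply, inSecond_mul_apply,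
      map_rMat_apply_22, rEnt_apply_22, ite_smul, zero_smul, mul_ite, mul_zero, colX,
      Finset.sum_ite_eq', Finset.mem_univ, if_true, smul_ite, smul_zero, Finset.smul_sum,
      mul_smul_comm, mul_one]
    refine Finset.sum_congr rfl fun k _ => ?_
    rw [Finset.mul_sum, Finset.mul_sum, Finset.smul_sum]
    refine Finset.sum_congr rfl fun m _ => ?_
    rw [mul_smul_comm, mul_smul_comm, mul_smul_comm, smul_comm]

section
variable {u v : F} {K L : Matrix (Fin 3) (Fin 3) A}

/-- Unitarity of `R`: applying `R` with exchanged arguments to the column gives, up to sign and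
`rA`, the column for exchanged `(u, K)` and `(v, L)`. The three `swap` identities are the rows of
this relation that recover the entries below the diagonal from those above. -/
theorem reflDiff_swap_01 : rB q v u • reflDiff q u v K L (1, 0) (2, 2)
    = -(rA q u v • reflDiff q v u L K (0, 1) (2, 2))
      - (v * rG q v u) • reflDiff q u v K L (0, 1) (2, 2) := by
  simp only [reflDiff_apply_22, Fin.sum_univ_three, mul_comm v u, rEnt_10, rEnt_01, mk3_00, mk3_01,
    mk3_02, mk3_10, mk3_11, mk3_12, mk3_20, mk3_21, mk3_22, zero_smul, add_zero, zero_add]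
  match_scalars <;> simp only [rA, rB, rG] <;> ring

theorem reflDiff_swap_12 : rB q v u • reflDiff q u v K L (2, 1) (2, 2)
    = -(rA q u v • reflDiff q v u L K (1, 2) (2, 2))
      - (v * rG q v u) • reflDiff q u v K L (1, 2) (2, 2) := by
  simp only [reflDiff_apply_22, Fin.sum_univ_three, mul_comm v u, rEnt_21, rEnt_12, mk3_00, mk3_01,
    mk3_02, mk3_10, mk3_11, mk3_12, mk3_20, mk3_21, mk3_22, zero_smul, add_zero, zero_add]
  match_scalars <;> simp only [rA, rB, rG] <;> ring

theorem reflDiff_swap_02 : rD q v u • reflDiff q u v K L (2, 0) (2, 2)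
    = -(rA q u v • reflDiff q v u L K (0, 2) (2, 2))
      - (q ^ 4 * v * rE q v u) • reflDiff q u v K L (1, 1) (2, 2)
      - (v * rS q v u) • reflDiff q u v K L (0, 2) (2, 2) := by
  simp only [reflDiff_apply_22, Fin.sum_univ_three, mul_comm v u, rEnt_20, rEnt_11, rEnt_02, mk3_00,
    mk3_01, mk3_02, mk3_10, mk3_11, mk3_12, mk3_20, mk3_21, mk3_22, zero_smul, add_zero, zero_add]
  match_scalars <;> simp only [rA, rD, rE, rS, rP, rH] <;> ring

end

set_option maxHeartbeats 1000000 in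
theorem NormRel.reflDiff_upper (H : NormRel q κ x y z) (hq : q ≠ 0) {u v : F}
    (hu : u ^ 2 - 1 ≠ 0) (hv : v ^ 2 - 1 ≠ 0) {i j : Fin 3} (hij : i ≤ j) :
    reflDiff q u v (kFull q κ u x y z) (kFull q κ v x y z) (i, j) (2, 2) = 0 := by
  have h00 := H.refl_col_00 hq u v (kA q u) (kA q v) (kA q u * kG q κ u) (kA q v * kG q κ v)
  have h01 := H.refl_col_01 hq u v (kA q u) (kA q v) (kA q u * kG q κ u) (kA q v * kG q κ v)
  have h22 := H.refl_col_22 hq u v (kA q u) (kA q v) (kA q u * kG q κ u) (kA q v * kG q κ v)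
  have h02 := H.refl_col_02 hq u v (kA q u) (kA q v) (kG q κ u) (kG q κ v)
  have h11 := H.refl_col_11 hq u v (kA q u) (kA q v) (kG q κ u) (kG q κ v)
  have h12 := H.refl_col_12 hq u v (kA q u) (kA q v) (kG q κ u) (kG q κ v)
  -- At the actual values of the central summands the correction terms cancel in pairs.
  simp only [kA_mul hu, kA_mul hv, add_sub_cancel_right] at h02 h11 h12
  simp only [kHat_eq_kFull, smul_add, mul_smul_comm, smul_smul] at h00 h01 h02 h11 h12 h22
  generalize kFull q κ u x y z = K at *
  generalize kFull q κ v x y z = L at *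
  rw [reflDiff_apply_22, sub_eq_zero]
  -- In the two extreme entries the common factor `rA q u v` had been left out.
  have g00 := congrArg (rA q u v • ·) h00
  have g22 := congrArg (rA q u v • ·) h22
  simp only [smul_add, smul_smul] at g00 g22
  fin_cases i <;> fin_cases j <;> first | exact absurd hij (by decide) | skip
  all_goals simp only [Fin.mk_zero, Fin.mk_one, Fin.reduceFinMk, Fin.zero_eta, colX,
    Fin.sum_univ_three, rEnt_00, rEnt_01, rEnt_02,
    rEnt_10, rEnt_11, rEnt_12, rEnt_20, rEnt_21, rEnt_22, mk3_00, mk3_01, mk3_02, mk3_10, mk3_11,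
    mk3_12, mk3_20, mk3_21, mk3_22, zero_smul, smul_zero, mul_zero, add_zero, zero_add, smul_add,
    mul_add, mul_smul_comm, smul_smul]
  · refine Eq.trans ?_ (g00.trans ?_) <;> match_scalars <;> ring
  · refine Eq.trans ?_ (h01.trans ?_) <;> match_scalars <;> ring
  · refine Eq.trans ?_ (h02.trans ?_) <;> match_scalars <;> ring
  · refine Eq.trans ?_ (h11.trans ?_) <;> match_scalars <;> ring
  · refine Eq.trans ?_ (h12.trans ?_) <;> match_scalars <;> ring
  · refine Eq.trans ?_ (g22.trans ?_) <;> match_scalars <;> ring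

theorem NormRel.reflDiff_col (H : NormRel q κ x y z) (hq : q ≠ 0) {u v : F} (hu : u ^ 2 - 1 ≠ 0)
    (hv : v ^ 2 - 1 ≠ 0) (h1 : v - u ≠ 0) (h2 : q ^ 6 * v + u ≠ 0) (h3 : q ^ 2 * v + u ≠ 0)
    (i j : Fin 3) :
    reflDiff q u v (kFull q κ u x y z) (kFull q κ v x y z) (i, j) (2, 2) = 0 := by
  have hB : rB q v u ≠ 0 := mul_ne_zero (mul_ne_zero (pow_ne_zero _ hq) h2) h1
  have hD : rD q v u ≠ 0 := mul_ne_zero (mul_ne_zero (pow_ne_zero _ hq) h3) h1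
  rcases le_or_gt i j with hij | hij
  · exact H.reflDiff_upper hq hu hv hij
  · fin_cases i <;> fin_cases j <;> first | exact absurd hij (by decide) | skip
    · refine (smul_eq_zero_iff_right hB).1 (reflDiff_swap_01.trans ?_)
      rw [H.reflDiff_upper hq hu hv (by decide), H.reflDiff_upper hq hv hu (by decide), smul_zero,
        smul_zero, neg_zero, sub_zero]
    · refine (smul_eq_zero_iff_right hD).1 (reflDiff_swap_02.trans ?_)
      rw [H.reflDiff_upper hq hu hv (by decide), H.reflDiff_upper hq hu hv (by decide),
        H.reflDiff_upper hq hv hu (by decide), smul_zero, smul_zero, smul_zero, neg_zero, sub_zero,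
        sub_zero]
    · refine (smul_eq_zero_iff_right hB).1 (reflDiff_swap_12.trans ?_)
      rw [H.reflDiff_upper hq hu hv (by decide), H.reflDiff_upper hq hv hu (by decide), smul_zero,
        smul_zero, neg_zero, sub_zero]

/-- The rescaled `K`-matrix, multiplied by the denominator `u ^ 2 - 1`. -/
def kPol (q κ u : F) (x y z : A) : Matrix (Fin 3) (Fin 3) A :=
  (u ^ 2 - 1) • kHat q κ u 0 0 x y z
    + (q ^ 6 * u ^ 2) • scalar (Fin 3) (casT q κ x y z + kG q κ u • 1)

theorem smul_kFull {u : F} (hu : u ^ 2 - 1 ≠ 0) :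
    (u ^ 2 - 1) • kFull q κ u x y z = kPol q κ u x y z := by
  have e : q ^ 6 * u ^ 2 = (u ^ 2 - 1) * kA q u := by
    rw [kA, mul_div_cancel₀ _ hu]
  rw [kPol, e, mul_smul, ← smul_add, kFull]
  congr 1
  ext i j
  fin_cases i <;> fin_cases j <;>
  (simp only [Fin.mk_zero, Fin.mk_one, Fin.reduceFinMk, Fin.zero_eta, Matrix.add_apply,
    Matrix.smul_apply, kHat, kShape_00, kShape_01, kShape_02, kShape_10, kShape_11, kShape_12,
    kShape_20, kShape_21, kShape_22, scalar_apply, diagonal_apply, kCoef]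
   simp
   try (match_scalars <;> ring))

theorem polyMat_kPol : PolyMat fun u => kPol q κ u x y z := by
  have h1 : (fun u : F => u ^ 2 - 1) ∈ polyFun F F :=
    sub_mem_polyFun (pow_mem_polyFun id_mem_polyFun 2) (const_mem_polyFun 1)
  have h2 : (fun u : F => q ^ 6 * u ^ 2) ∈ polyFun F F :=
    mul_mem_polyFun (const_mem_polyFun _) (pow_mem_polyFun id_mem_polyFun 2)
  refine (PolyMat.smul h1 fun i j => ?_).add (PolyMat.smul h2 fun i j => ?_)
  · fin_cases i <;> fin_cases j <;>
    simp only [Fin.mk_zero, Fin.mk_one, Fin.reduceFinMk, Fin.zero_eta, kHat, kShape_00,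
      kShape_01, kShape_02, kShape_10, kShape_11, kShape_12, kShape_20, kShape_21, kShape_22,
      kCoef] <;>
    repeat' first
      | with_reducible exact const_mem_polyFun _
      | with_reducible exact id_mem_polyFun
      | with_reducible apply add_mem_polyFun
      | with_reducible apply sub_mem_polyFun
      | with_reducible apply neg_mem_polyFun
      | with_reducible apply mul_mem_polyFun
      | with_reducible apply pow_mem_polyFun
      | with_reducible apply smul_mem_polyFun
  · simp only [scalar_apply, diagonal_apply, kG]
    split_ifs <;>
    repeat' first
      | with_reducible exact const_mem_polyFun _
      | with_reducible exact id_mem_polyFun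
      | with_reducible apply add_mem_polyFun
      | with_reducible apply sub_mem_polyFun
      | with_reducible apply neg_mem_polyFun
      | with_reducible apply mul_mem_polyFun
      | with_reducible apply pow_mem_polyFun
      | with_reducible apply smul_mem_polyFun

theorem reflDiff_smul (c u v : F) (K L : Matrix (Fin 3) (Fin 3) A) :
    reflDiff q u v (c • K) L = c • reflDiff q u v K L := by
  have : inFirst (c • K) = c • inFirst K := smul_kronecker _ _ _
  simp only [reflDiff, this, smul_sub, smul_mul_assoc, mul_smul_comm]

/-- The reflection equation for the rescaled `K`-matrix. -/
theorem NormRel.reflDiff_kFull [Infinite F] (H : NormRel q κ x y z) (hq : q ≠ 0)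
    (hq4 : q ^ 4 - 1 ≠ 0) (hq8 : q ^ 8 - 1 ≠ 0)
    (hq3 : q ^ 4 + q ^ 2 + 1 ≠ 0) {u v : F} (hu1 : u ^ 2 - 1 ≠ 0)
    (hv : v ≠ 0) (hv1 : v ^ 2 - 1 ≠ 0) :
    reflDiff q u v (kFull q κ u x y z) (kFull q κ v x y z) = 0 := by
  -- First for generic `u`: two excluded values come from cyclicity, the other three from dividing
  -- by the entries `rB` and `rD`.
  have key : ∀ u : F, u ≠ 0 → u ^ 2 - 1 ≠ 0 → v - q ^ 4 * u ≠ 0 → v + q ^ 6 * u ≠ 0 →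
      v - u ≠ 0 → q ^ 6 * v + u ≠ 0 → q ^ 2 * v + u ≠ 0 → reflDiff q u v (kFull q κ u x y z) (kFull q κ v x y z) = 0 := by
    intro u hu hu1 h1 h2 h3 h4 h5
    have hK₁ := fun w => H.kHat_mul_onsM1 hq w (kA q w) (kA q w * kG q κ w)
    have hK₀ := H.kFull_mul_onsM0 hq hu hu1
    have hL₀ := H.kFull_mul_onsM0 hq hv hv1
    simp only [kHat_eq_kFull, onsM1_eq] at hK₁
    rw [onsM0_eq, onsM0_eq] at hK₀ hL₀
    have r := rMat_mul_ons1 q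
    refine eq_zero_of_col_eq_zero hq hq4 hq8 hq3 hu hv h1 h2
      (reflDiff_mul_tensL (hK₁ u) (hK₁ v) (rMat_mul_wt1 hq) (r _ _) (r _ _) (r _ _) (r _ _))
      (reflDiff_mul_tensL hK₀ hL₀ (rMat_mul_wt0 q) ?_ ?_ ?_ ?_)
      (H.reflDiff_col hq hu1 hv1 h3 h4 h5)
    · have := rMat_scale_mul_ons0 (q := q) v hu (inv_ne_zero hv)
      rwa [inv_inv, mul_inv_cancel₀ hv, mul_comm v u] at this
    · have := rMat_scale_mul_ons0 (q := q) (u * v) (inv_ne_zero hv) (inv_ne_zero hu)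
      rwa [inv_inv, inv_inv, mul_inv_cancel_right₀ hv, mul_comm u v,
        mul_inv_cancel_right₀ hu] at this
    · have := rMat_scale_mul_ons0 (q := q) 1 hu hv
      rwa [one_mul, one_mul] at this
    · have := rMat_scale_mul_ons0 (q := q) u hv (inv_ne_zero hu)
      rwa [inv_inv, mul_inv_cancel₀ hu] at this
  have hP : ∀ p r, (fun u => reflDiff q u v (kPol q κ u x y z) (kFull q κ v x y z) p r) = 0 := by
    intro p r
    -- The finite exceptional set consists of the values of `u` excluded in `key`, with `v` fixed.
    refine eq_zero_of_polyFun (polyMat_reflDiff q v polyMat_kPol _ p r)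
      (S := {0, 1, -1, v / q ^ 4, -v / q ^ 6, v, -(q ^ 6 * v), -(q ^ 2 * v)}) (by simp) fun w hw => ?_
    simp only [Set.mem_insert_iff, Set.mem_singleton_iff, not_or] at hw
    obtain ⟨w0, w1, w2, w3, w4, w5, w6, w7⟩ := hw
    have hw1 : w ^ 2 - 1 ≠ 0 := fun e => by
      rcases mul_eq_zero.1 (show (w - 1) * (w + 1) = 0 by linear_combination e) with e | e
      · exact w1 (by linear_combination e)
      · exact w2 (by linear_combination e)
    rw [← smul_kFull hw1, reflDiff_smul, key w w0 hw1 (fun e => w3 ?_) (fun e => w4 ?_)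
      (fun e => w5 ?_) (fun e => w6 ?_) (fun e => w7 ?_), smul_zero]
    · rfl
    · rw [eq_div_iff (pow_ne_zero 4 hq)]; linear_combination -e
    · rw [eq_div_iff (pow_ne_zero 6 hq)]; linear_combination e
    · linear_combination -e
    · linear_combination e
    · linear_combination e
  refine (smul_eq_zero_iff_right hu1).1 ?_
  rw [← reflDiff_smul, smul_kFull hu1]
  ext p r
  exact congrFun (hP p r) u

end
end DynK

end

/-! ### Passage from the original parameters to the rescaled ones. -/

open scoped TensorProduct Kronecker Matrix
noncomputable section

namespace DynK

/-- The scalar relating `W₀` to its rescaled version. -/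
def wX (q α : ℂ) : ℂ := α / (q ^ 2 * (q ^ 8 - 1))

/-- The scalar relating `W₁` to its rescaled version. -/
def wY (q γ : ℂ) : ℂ := γ / (q ^ 5 * (q ^ 4 - 1))

/-- The scalar relating `W₂` to its rescaled version. -/
def wZ (q α γ : ℂ) : ℂ := α * γ / (q ^ 7 * (q ^ 4 - 1))

/-- The rescaled version of the parameter `C`. -/
def kap (q α γ C : ℂ) : ℂ := C / (wY q γ * wZ q α γ * (q ^ 8 - 1) * (q ^ 2 + 1))

/-- The rescaled generator `W₀`. -/
def gX (q α μ μ' C : ℂ) : AWA22 q μ μ' C := (wX q α)⁻¹ • AW.W 0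

/-- The rescaled generator `W₁`. -/
def gY (q γ μ μ' C : ℂ) : AWA22 q μ μ' C := (wY q γ)⁻¹ • AW.W 1

/-- The rescaled generator `W₂`. -/
def gZ (q α γ μ μ' C : ℂ) : AWA22 q μ μ' C := (wZ q α γ)⁻¹ • AW.W 2

/-- The scalar relating the `K`-matrix to its rescaled version. -/
def theta (q r α γ u : ℂ) : ℂ := r ^ 7 * α * wY q γ / (q ^ 19 * (q ^ 2 + 1) * u)

/-- The relations between the parameters, with `γ = c₁ s₁`. -/
structure Params (q r α β γ μ μ' : ℂ) : Prop where
  sq_r : r ^ 2 = q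
  q_ne : q ≠ 0
  q_pow : ∀ n : ℕ, 0 < n → q ^ n ≠ 1
  α_ne : α ≠ 0
  γ_ne : γ ≠ 0
  β_mul : β * γ * (q + q⁻¹) * (q ^ 2 + q ^ (-2 : ℤ)) = r ^ 9
  μ_eq : μ = α ^ 2
  μ_eq' : μ' * q = γ ^ 2 * (q + q⁻¹) * (q ^ 2 + q ^ (-2 : ℤ)) ^ 2

namespace Params

variable {q r α β γ μ μ' C : ℂ}

section
variable (P : Params q r α β γ μ μ')
include P

theorem pow_sub_ne {n : ℕ} (hn : 0 < n) : q ^ n - 1 ≠ 0 := sub_ne_zero.2 (P.q_pow n hn)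

theorem sq_add_ne : q ^ 2 + 1 ≠ 0 := fun e =>
  P.pow_sub_ne (n := 4) (by norm_num) (by linear_combination (q ^ 2 - 1) * e)

theorem fourth_add_ne : q ^ 4 + 1 ≠ 0 := fun e =>
  P.pow_sub_ne (n := 8) (by norm_num) (by linear_combination (q ^ 4 - 1) * e)

theorem r_ne : r ≠ 0 := fun e => P.q_ne (by rw [← P.sq_r, e]; ring)

theorem wX_ne : wX q α ≠ 0 :=
  div_ne_zero P.α_ne (mul_ne_zero (pow_ne_zero _ P.q_ne) (P.pow_sub_ne (by norm_num)))

theorem wY_ne : wY q γ ≠ 0 :=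
  div_ne_zero P.γ_ne (mul_ne_zero (pow_ne_zero _ P.q_ne) (P.pow_sub_ne (by norm_num)))

theorem wZ_ne : wZ q α γ ≠ 0 :=
  div_ne_zero (mul_ne_zero P.α_ne P.γ_ne)
    (mul_ne_zero (pow_ne_zero _ P.q_ne) (P.pow_sub_ne (by norm_num)))

theorem μ_eq_div : μ' = γ ^ 2 * (q ^ 2 + 1) * (q ^ 4 + 1) ^ 2 / q ^ 6 := by
  have h := P.μ_eq'
  have hq := P.q_ne
  have z2 : q ^ (-2 : ℤ) = (q ^ 2)⁻¹ := by rw [zpow_neg]; norm_cast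
  rw [z2] at h
  field_simp at h ⊢
  linear_combination h

theorem β_eq_div : β = r ^ 9 * q ^ 3 / (γ * (q ^ 2 + 1) * (q ^ 4 + 1)) := by
  have h := P.β_mul
  have hq := P.q_ne
  have hγ := P.γ_ne
  have h2 := P.sq_add_ne
  have h4 := P.fourth_add_ne
  have z2 : q ^ (-2 : ℤ) = (q ^ 2)⁻¹ := by rw [zpow_neg]; norm_cast
  rw [z2] at h
  field_simp at h ⊢
  linear_combination h

end

section
variable (P : Params q r α β γ μ μ')
include P

theorem W0_eq : (AW.W 0 : AWA22 q μ μ' C) = wX q α • gX q α μ μ' C :=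
  (smul_inv_smul₀ P.wX_ne _).symm

theorem W1_eq : (AW.W 1 : AWA22 q μ μ' C) = wY q γ • gY q γ μ μ' C :=
  (smul_inv_smul₀ P.wY_ne _).symm

theorem W2_eq : (AW.W 2 : AWA22 q μ μ' C) = wZ q α γ • gZ q α γ μ μ' C :=
  (smul_inv_smul₀ P.wZ_ne _).symm

theorem normRel : NormRel q (kap q α γ C) (gX q α μ μ' C) (gY q γ μ μ' C)
    (gZ q α γ μ μ' C) := by
  have h0 := P.wX_ne
  have h1 := P.wY_ne
  have h2 := P.wZ_ne
  have hq := P.q_ne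
  have hα := P.α_ne
  have hγ := P.γ_ne
  have h4 : q ^ 4 - 1 ≠ 0 := P.pow_sub_ne (by norm_num)
  have h8 : q ^ 8 - 1 ≠ 0 := P.pow_sub_ne (by norm_num)
  have hp := P.sq_add_ne
  have z4 : q ^ (-4 : ℤ) = (q ^ 4)⁻¹ := by rw [zpow_neg]; norm_cast
  have r01 : qbr (q ^ 4) (AW.W 0 : AWA22 q μ μ' C) (AW.W 1) = _ := AW.rel01
  have r12 : qbr (q ^ 4) (AW.W 1 : AWA22 q μ μ' C) (AW.W 2) = _ := AW.rel12
  have r20 : qbr (q ^ 4) (AW.W 2 : AWA22 q μ μ' C) (AW.W 0) = _ := AW.rel20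
  rw [P.W0_eq, P.W1_eq, P.W2_eq, qbr] at r01 r12 r20
  generalize gX q α μ μ' C = x at *
  generalize gY q γ μ μ' C = y at *
  generalize gZ q α γ μ μ' C = z at *
  simp only [smul_mul_assoc, mul_smul_comm, smul_smul, zero_smul, zero_add, add_zero] at r01 r12 r20
  refine ⟨?_, ?_, ?_⟩
  · have e := congrArg (fun w => (wX q α * wY q γ * q ^ 4 / (wX q α * wY q γ)) • (x * y)
      - (q ^ 4 / (wX q α * wY q γ)) • w) r01
    simp only [smul_sub, smul_smul] at e
    refine Eq.trans ?_ (e.trans ?_)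
    · match_scalars <;> field_simp <;> ring
    · match_scalars <;> simp only [wX, wY, wZ] <;> field_simp
  · have e := congrArg (fun w => (q ^ 4) • (z * x)
      - (q ^ 4 / (wX q α * wZ q α γ)) • w) r20
    simp only [smul_sub, smul_smul] at e
    refine Eq.trans ?_ (e.trans ?_)
    · match_scalars <;> field_simp <;> ring
    · match_scalars <;> simp only [wX, wY, wZ, z4, P.μ_eq] <;> field_simp <;> ring
  · have e := congrArg (fun w => (q ^ 4) • (y * z)
      - (q ^ 4 / (wY q γ * wZ q α γ)) • w) r12
    simp only [smul_sub, smul_add, smul_smul] at e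
    refine Eq.trans ?_ (e.trans ?_)
    · match_scalars <;> field_simp <;> ring
    · match_scalars <;> simp only [kap, wX, wY, wZ, z4, P.μ_eq_div] <;> field_simp <;> ring

theorem casQ_eq : casQ q μ μ' C = (wZ q α γ ^ 2 / q ^ 4) • casT q (kap q α γ C)
    (gX q α μ μ' C) (gY q γ μ μ' C) (gZ q α γ μ μ' C) := by
  have hq := P.q_ne
  have hα := P.α_ne
  have hγ := P.γ_ne
  have h4 : q ^ 4 - 1 ≠ 0 := P.pow_sub_ne (by norm_num)
  have h8 : q ^ 8 - 1 ≠ 0 := P.pow_sub_ne (by norm_num)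
  have hp := P.sq_add_ne
  have z4 : q ^ (-4 : ℤ) = (q ^ 4)⁻¹ := by rw [zpow_neg]; norm_cast
  rw [casQ, AW.casimir, P.W0_eq, P.W1_eq, P.W2_eq, casT]
  simp only [smul_mul_assoc, mul_smul_comm, smul_smul, zero_smul, pow_two (_ • _), mul_assoc,
    add_zero, zero_mul]
  match_scalars <;> simp only [kap, wX, wY, wZ, z4, P.μ_eq_div, P.μ_eq] <;> field_simp <;> ring

theorem theta_ne {u : ℂ} (hu : u ≠ 0) : theta q r α γ u ≠ 0 :=
  div_ne_zero (mul_ne_zero (mul_ne_zero (pow_ne_zero _ P.r_ne) P.α_ne) P.wY_ne)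
    (mul_ne_zero (mul_ne_zero (pow_ne_zero _ P.q_ne) P.sq_add_ne) hu)

-- The scalar `theta` is read off from the coefficient of `y` in the entry in row one and column
-- two.
set_option maxHeartbeats 4000000 in
theorem kMatrix_eq {u : ℂ} (hu : u ≠ 0) (hu1 : u ^ 2 - 1 ≠ 0) :
    kMatrix q r α β μ μ' C u = theta q r α γ u • kFull q (kap q α γ C) u
      (gX q α μ μ' C) (gY q γ μ μ' C) (gZ q α γ μ μ' C) := by
  have h := P.normRel (C := C)
  have hr := P.r_ne
  have hα := P.α_ne
  have hγ := P.γ_ne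
  have h4 : q ^ 4 - 1 ≠ 0 := P.pow_sub_ne (by norm_num)
  have h8 : q ^ 8 - 1 ≠ 0 := P.pow_sub_ne (by norm_num)
  have hp := P.sq_add_ne
  have hp4 := P.fourth_add_ne
  have z2 : q ^ (-2 : ℤ) = (q ^ 2)⁻¹ := by rw [zpow_neg]; norm_cast
  have z3 : q ^ (-3 : ℤ) = (q ^ 3)⁻¹ := by rw [zpow_neg]; norm_cast
  have z4 : q ^ (-4 : ℤ) = (q ^ 4)⁻¹ := by rw [zpow_neg]; norm_cast
  have z7 : r ^ (-7 : ℤ) = (r ^ 7)⁻¹ := by rw [zpow_neg]; norm_cast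
  have hβ := P.β_eq_div
  have hk : q + q⁻¹ = (q ^ 2 + 1) / q := by have := P.q_ne; field_simp
  have hk2 : q ^ 2 + (q ^ 2)⁻¹ = (q ^ 4 + 1) / q ^ 2 := by have := P.q_ne; field_simp
  have hg : q ^ 4 - (q ^ 4)⁻¹ = (q ^ 8 - 1) / q ^ 4 := by have := P.q_ne; field_simp
  have hu' : u - u⁻¹ = (u ^ 2 - 1) / u := by field_simp
  have hsq := P.sq_r
  have hq := P.q_ne
  have h8r : r ^ 16 - 1 ≠ 0 := by convert h8 using 2; rw [← hsq]; ring
  have h4r : r ^ 8 - 1 ≠ 0 := by convert h4 using 2; rw [← hsq]; ring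
  have hpr : r ^ 4 + 1 ≠ 0 := by convert hp using 2; rw [← hsq]; ring
  have hp4r : r ^ 8 + 1 ≠ 0 := by convert hp4 using 2; rw [← hsq]; ring
  have hβ0 : β ≠ 0 := by
    rw [hβ]
    exact div_ne_zero (mul_ne_zero (pow_ne_zero _ hr) (pow_ne_zero _ hq))
      (mul_ne_zero (mul_ne_zero hγ hp) hp4)
  ext i j
  fin_cases i <;> fin_cases j <;>
  (simp only [Fin.mk_zero, Fin.mk_one, Fin.reduceFinMk, Fin.zero_eta, kMatrix, kOne, kTwo,
      Matrix.add_apply, Matrix.smul_apply, Matrix.of_apply, Matrix.cons_val', Matrix.cons_val_zero,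
      Matrix.cons_val_one, Matrix.cons_val, kFull, kHat, kShape_00, kShape_01, kShape_02,
      kShape_10, kShape_11, kShape_12, kShape_20, kShape_21, kShape_22,
      h₁, h₂, h₃, hCas, hOff, P.casQ_eq, P.W0_eq, P.W1_eq, qbr, Algebra.algebraMap_eq_smul_one,
      pow_two (_ • _)]
   generalize gX q α μ μ' C = x at *
   generalize gY q γ μ μ' C = y at *
   generalize gZ q α γ μ μ' C = z at *
   simp only [mul_sub, sub_mul, smul_add, smul_sub,
    smul_mul_assoc, mul_smul_comm, smul_smul, mul_assoc]
   simp only [mul_sub, sub_mul, smul_add, smul_sub, mul_add, add_mul,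
    smul_mul_assoc, mul_smul_comm, smul_smul, mul_assoc, h.yx, h.xz, h.zy,
    h.yx_assoc, h.xz_assoc, h.zy_assoc, NormRel.x_mul_yz q (kap q α γ C) x y z, h.y_mul_zx hq, h.z_mul_xy hq]
   generalize casT q (kap q α γ C) x y z = T
   -- Writing `q` as `r ^ 2` makes every coefficient a rational function, including the half-integer
   -- powers of `q`.
   subst hsq
   match_scalars <;> simp only [kCoef, kA, kG, theta, kap, wX, wY, wZ, z2, z3, z4, z7, hk, hk2, hg, hu',
     hβ] <;> field_simp <;> ring)

end
end Params
end DynK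

end

/-! ### The representation of the Askey-Wilson algebra and the images of the coaction. -/

open scoped TensorProduct Kronecker Matrix
noncomputable section

namespace DynK

open Polynomial

namespace Params

variable {q r α β γ μ μ' C : ℂ} (P : Params q r α β γ μ μ')
include P

/-- The converse of `normRel`: it lets the operators on functions define a homomorphism from the
presented algebra. -/
theorem relations_of_normRel {B : Type*} [Ring B] [Algebra ℂ B] {x y z : B}
    (h : NormRel q (kap q α γ C) x y z) ⦃a b : FreeAlgebra ℂ (Fin 3)⦄
    (hab : AWRel 1 0 (-(q ^ (-4 : ℤ) * μ')) C (-(q ^ (-4 : ℤ) * μ)) 0 (q ^ 4) a b) :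
    FreeAlgebra.lift ℂ ![wX q α • x, wY q γ • y, wZ q α γ • z] a
      = FreeAlgebra.lift ℂ ![wX q α • x, wY q γ • y, wZ q α γ • z] b := by
  have hq := P.q_ne
  have hα := P.α_ne
  have hγ := P.γ_ne
  have h4 : q ^ 4 - 1 ≠ 0 := P.pow_sub_ne (by norm_num)
  have h8 : q ^ 8 - 1 ≠ 0 := P.pow_sub_ne (by norm_num)
  have hp := P.sq_add_ne
  have z4 : q ^ (-4 : ℤ) = (q ^ 4)⁻¹ := by rw [zpow_neg]; norm_cast
  cases hab with
  | rel01 =>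
    simp only [map_qbr, map_smul, FreeAlgebra.lift_ι_apply, Matrix.cons_val_zero,
      Matrix.cons_val_one, Matrix.cons_val]
    simp only [qbr, smul_mul_assoc, mul_smul_comm, h.yx, smul_sub]
    match_scalars <;> simp only [wX, wY, wZ] <;> field_simp <;> ring
  | rel12 =>
    simp only [map_qbr, map_smul, map_add, map_one, FreeAlgebra.lift_ι_apply, Matrix.cons_val_zero,
      Matrix.cons_val_one, Matrix.cons_val]
    simp only [qbr, smul_mul_assoc, mul_smul_comm, h.zy, smul_sub,
      smul_add]
    match_scalars <;> simp only [kap, wX, wY, wZ, z4, P.μ_eq_div] <;> field_simp <;> ring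
  | rel20 =>
    simp only [map_qbr, map_smul, map_add, map_one, FreeAlgebra.lift_ι_apply, Matrix.cons_val_zero,
      Matrix.cons_val_one, Matrix.cons_val]
    simp only [qbr, smul_mul_assoc, mul_smul_comm, h.xz, smul_sub,
      smul_add]
    match_scalars <;> (try simp only [wX, wY, wZ, z4, P.μ_eq]) <;> (try field_simp) <;> (try ring)

theorem adjoin_eq_top : Algebra.adjoin ℂ {gX q α μ μ' C, gY q γ μ μ' C, gZ q α γ μ μ' C} = ⊤ := by
  set S := Algebra.adjoin ℂ {gX q α μ μ' C, gY q γ μ μ' C, gZ q α γ μ μ' C} with hS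
  have hx : gX q α μ μ' C ∈ S := Algebra.subset_adjoin (by simp)
  have hy : gY q γ μ μ' C ∈ S := Algebra.subset_adjoin (by simp)
  have hz : gZ q α γ μ μ' C ∈ S := Algebra.subset_adjoin (by simp)
  have hW : ∀ i, (AW.W i : AWA22 q μ μ' C) ∈ S := by
    intro i
    fin_cases i
    · rw [Fin.zero_eta, P.W0_eq]; exact S.smul_mem hx _
    · rw [Fin.mk_one, P.W1_eq]; exact S.smul_mem hy _
    · change AW.W 2 ∈ S; rw [P.W2_eq]; exact S.smul_mem hz _
  refine eq_top_iff.2 fun a _ => ?_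
  obtain ⟨f, rfl⟩ : ∃ f, RingQuot.mkAlgHom ℂ
      (AWRel 1 0 (-(q ^ (-4 : ℤ) * μ')) C (-(q ^ (-4 : ℤ) * μ)) 0 (q ^ 4)) f = a :=
    RingQuot.mkAlgHom_surjective _ _ a
  induction f using FreeAlgebra.induction with
  | grade0 c => rw [AlgHom.commutes]; exact S.algebraMap_mem c
  | grade1 i => exact hW i
  | mul a b ha hb => rw [map_mul]; exact S.mul_mem (ha trivial) (hb trivial)
  | add a b ha hb => rw [map_add]; exact S.add_mem (ha trivial) (hb trivial)

theorem exists_isRep (C : ℂ) : ∃ (τ : ℂ) (Φ : AWA22 q μ μ' C →ₐ[ℂ] Module.End ℂ[X] (ℤ → ℂ[X])),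
    IsRep q (kap q α γ C) τ (gX q α μ μ' C) (gY q γ μ μ' C) (gZ q α γ μ μ' C) Φ := by
  -- The symmetric choice of the spectral variable needs a square root of `-q ^ 4`.
  have hτ : (Complex.I * q ^ 2) ^ 2 = -q ^ 4 := by
    rw [mul_pow, Complex.I_sq]; ring
  have h := normRel_rep (κ := kap q α γ C) P.q_ne P.q_pow hτ
  let Φ : AWA22 q μ μ' C →ₐ[ℂ] Module.End ℂ[X] (ℤ → ℂ[X]) :=
    RingQuot.liftAlgHom ℂ ⟨FreeAlgebra.lift ℂ _, P.relations_of_normRel h⟩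
  have hΦ : ∀ i, Φ (AW.W i) = ![wX q α • repX q _, wY q γ • repY q _ _, wZ q α γ • repZ q _ _] i :=
    fun i => (RingQuot.liftAlgHom_mkAlgHom_apply _ _ _ _).trans (FreeAlgebra.lift_ι_apply _ _)
  refine ⟨_, Φ, P.normRel, P.q_ne, P.q_pow, hτ, ?_, ?_, ?_, P.adjoin_eq_top⟩
  · rw [gX, map_smul, hΦ]; exact inv_smul_smul₀ P.wX_ne _
  · rw [gY, map_smul, hΦ]; exact inv_smul_smul₀ P.wY_ne _
  · rw [gZ, map_smul, hΦ]; exact inv_smul_smul₀ P.wZ_ne _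

end Params

section
variable {q c₀ c₀' c₁ c₁' s₀ s₁ u : ℂ} {r α β C : ℂ}

/-- The parameters of the main theorem satisfy the relations that the proof uses. -/
theorem params_of_roots (hq0 : q ≠ 0) (hq : ∀ n : ℕ, 0 < n → q ^ n ≠ 1) (hr : r ^ 2 = q)
    (hc₀ : c₀ ≠ 0) (hc₀' : c₀' ≠ 0) (hc₁ : c₁ ≠ 0) (hs₁0 : s₁ ≠ 0)
    (hα : α ^ 2 = c₀ * c₀') (hs₁ : s₁ ^ 2 * c₁ = q * (q + q⁻¹) * c₁')
    (hroot₁ : β * c₁ * s₁ * (q + q⁻¹) * (q ^ 2 + q ^ (-2 : ℤ)) = r ^ 9) :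
    Params q r α β (c₁ * s₁) (c₀ * c₀') (muBar q c₁ c₁') where
  sq_r := hr
  q_ne := hq0
  q_pow := hq
  α_ne := fun e => mul_ne_zero hc₀ hc₀' (by rw [← hα, e]; ring)
  γ_ne := mul_ne_zero hc₁ hs₁0
  β_mul := by rw [← hroot₁]; ring
  μ_eq := hα.symm
  μ_eq' := by
    rw [muBar]
    linear_combination -(q + q⁻¹) * (q ^ 2 + q ^ (-2 : ℤ)) ^ 2 * c₁ * hs₁

variable (hq0 : q ≠ 0) (hq : ∀ n : ℕ, 0 < n → q ^ n ≠ 1)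
  (hq3 : q ^ 4 + 3 + q ^ (-4 : ℤ) ≠ 0) (hs₀0 : s₀ ≠ 0) (hs₁0 : s₁ ≠ 0) (hu : u ≠ 0)

theorem tensorRep_coaction_apply (i : Fin 2) (a b : Fin 3) :
    tensorRep (fundRep hq0 hq hs₀0 hs₁0 hu) (evalHom C hq0 hq3)
      (coaction q c₀ c₀' c₁ c₁' (FreeAlgebra.ι ℂ i)) a b
      = ((![c₀, c₁] i) • (repGen q s₀ s₁ u (.e i) * repGen q s₀ s₁ u (.k i))
          + (![c₀', c₁'] i) • (repGen q s₀ s₁ u (.f i) * repGen q s₀ s₁ u (.k i))) a b • 1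
        + (repGen q s₀ s₁ u (.k i) ^ 2) a b • (![AW.W 0, AW.W 1] i
          : AWA22 q (c₀ * c₀') (muBar q c₁ c₁') C) := by
  rw [coaction, FreeAlgebra.lift_ι_apply, map_add, Matrix.add_apply, tensorRep_tmul,
    tensorRep_tmul, evalHom_gen, map_add, map_smul, map_smul, map_mul, map_mul, map_pow,
    fundRep_gen, fundRep_gen, fundRep_gen, map_one]

/-- The normalization of `s₀` makes the two off-diagonal entries equal to `α u` and `α u⁻¹`. For the
other generator `s₁` does the same, with matching entries across the diagonal. -/
theorem tensorRep_coaction_zero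
    (P : Params q r α β (c₁ * s₁) (c₀ * c₀') (muBar q c₁ c₁'))
    (hs₀ : s₀ ^ 2 * c₀ = q ^ 4 * c₀') (hroot₀ : α * s₀ = q ^ 2 * c₀') :
    tensorRep (fundRep hq0 hq hs₀0 hs₁0 hu) (evalHom C hq0 hq3)
      (coaction q c₀ c₀' c₁ c₁' (FreeAlgebra.ι ℂ 0))
      = (α / (q ^ 6 * (q ^ 8 - 1))) • onsM0 q u⁻¹ u (gX q α (c₀ * c₀') (muBar q c₁ c₁') C) := by
  have h8 : q ^ 8 - 1 ≠ 0 := P.pow_sub_ne (by norm_num)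
  have hα := P.α_ne
  have z2 : q ^ (-2 : ℤ) = (q ^ 2)⁻¹ := by rw [zpow_neg]; norm_cast
  have e1 : c₀' = α * s₀ / q ^ 2 := by rw [hroot₀]; field_simp
  have e2 : c₀ = q ^ 2 * α / s₀ := by
    rw [eq_div_iff hs₀0]
    refine mul_right_cancel₀ hs₀0 ?_
    linear_combination hs₀ - q ^ 2 * hroot₀
  ext a b
  rw [tensorRep_coaction_apply]
  fin_cases a <;> fin_cases b <;>
  (simp [repGen, onsM0, P.W0_eq, z2, pow_two, smul_smul]
   try (match_scalars <;> (try simp only [e1, e2, wX]) <;> field_simp))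

theorem tensorRep_coaction_one
    (P : Params q r α β (c₁ * s₁) (c₀ * c₀') (muBar q c₁ c₁'))
    (hs₁ : s₁ ^ 2 * c₁ = q * (q + q⁻¹) * c₁') :
    tensorRep (fundRep hq0 hq hs₀0 hs₁0 hu) (evalHom C hq0 hq3)
      (coaction q c₀ c₀' c₁ c₁' (FreeAlgebra.ι ℂ 1))
      = (c₁ * s₁ / (q ^ 7 * (q ^ 4 - 1))) •
        onsM1 q (gY q (c₁ * s₁) (c₀ * c₀') (muBar q c₁ c₁') C) := by
  have h4 : q ^ 4 - 1 ≠ 0 := P.pow_sub_ne (by norm_num)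
  have hp := P.sq_add_ne
  have e1 : c₁' = s₁ ^ 2 * c₁ / (q ^ 2 + 1) := by
    rw [hs₁]; field_simp
  ext a b
  rw [tensorRep_coaction_apply]
  fin_cases a <;> fin_cases b <;>
  (simp [repGen, onsM1, P.W1_eq, pow_two, smul_smul]
   try (match_scalars <;> (try simp only [e1, wY]) <;> field_simp))

end

end DynK

end

/-! ### Identification of the Izergin-Korepin matrix. -/

open scoped TensorProduct Kronecker Matrix
noncomputable section

namespace DynK

open Polynomial Matrix

/-- The rows of the matrix `R^{(x)}`. -/
def spinRows (x : ℂ) : Fin 3 → Fin 3 → Matrix (Fin 3) (Fin 3) ℂ :=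
  let t : ℂ := x ^ 2 - x ^ (-2 : ℤ)
  ![![!![x ^ 2, 0, 0; 0, 0, 0; 0, 0, 0],
      !![0, 1, 0; t, 0, 0; 0, 0, 0],
      !![0, 0, x ^ (-2 : ℤ); 0, x⁻¹ * t, 0; x⁻¹ * t * (x - x⁻¹), 0, 0]],
    ![!![0, 0, 0; 1, 0, 0; 0, 0, 0],
      !![0, 0, 0; 0, 1, 0; x⁻¹ * t, 0, 0],
      !![0, 0, 0; 0, 0, 1; 0, t, 0]],
    ![!![0, 0, 0; 0, 0, 0; x ^ (-2 : ℤ), 0, 0],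
      !![0, 0, 0; 0, 0, 0; 0, 1, 0],
      !![0, 0, 0; 0, 0, 0; 0, 0, x ^ 2]]]

theorem finProdFinEquiv_three (i j : Fin 3) :
    finProdFinEquiv (i, j) = (![![0, 1, 2], ![3, 4, 5], ![6, 7, 8]] i j : Fin 9) := by
  revert i j; decide

theorem spinOneR_apply (x : ℂ) (i j k l : Fin 3) :
    spinOneR x (i, j) (k, l) = spinRows x i j k l := by
  rw [spinOneR, Matrix.submatrix_apply, finProdFinEquiv_three, finProdFinEquiv_three, spinRows]
  -- Hiding the complex numbers behind variables makes each of the 81 comparisons a purely syntactic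
  -- one.
  generalize x ^ 2 = a, x ^ (-2 : ℤ) = b, x⁻¹ = c
  generalize a - b = t, x - c = d
  generalize c * t = e
  generalize e * d = f
  generalize (0 : ℂ) = o
  generalize (1 : ℂ) = w
  fin_cases i <;> fin_cases j <;> fin_cases k <;> fin_cases l <;> rfl

theorem permP_apply (i j k l : Fin 3) :
    permP (i, j) (k, l) = if j = k ∧ i = l then 1 else 0 := by
  simp [permP, Matrix.one_apply]

theorem ikR_eq {q a b : ℂ} (hq : q ≠ 0) (ha : a ≠ 0) (hb : b ≠ 0) :
    ikR q (a / b) = (q ^ 5 * a * b)⁻¹ • rMat q a b := by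
  have z2 : ∀ x : ℂ, x ^ (-2 : ℤ) = (x ^ 2)⁻¹ := fun x => zpow_neg_coe_of_pos x two_pos
  have z3 : q ^ (-3 : ℤ) = (q ^ 3)⁻¹ := zpow_neg_coe_of_pos q three_pos
  have z5 : q ^ (-5 : ℤ) = (q ^ 5)⁻¹ := zpow_neg_coe_of_pos q (by norm_num : 0 < 5)
  ext ⟨i, j⟩ ⟨k, l⟩
  simp only [ikR, flip, Matrix.add_apply, Matrix.smul_apply, submatrix_apply, Prod.swap,
    spinOneR_apply, permP_apply, rMat, ofRows_apply, smul_eq_mul]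
  simp only [spinRows, rEnt, z2, z3, z5, inv_inv, inv_pow]
  fin_cases i <;> fin_cases j <;> fin_cases k <;> fin_cases l <;>
  simp only [Fin.mk_one, Fin.reduceFinMk, Fin.zero_eta, Matrix.of_apply,
    Matrix.cons_val', Matrix.cons_val_zero, Matrix.cons_val_one, Matrix.cons_val, mul_zero,
    add_zero, zero_add, Fin.reduceEq, Fin.isValue, zero_ne_one, one_ne_zero, and_false,
    if_true, if_false, mul_one, and_true]
  all_goals simp only [rA, rB, rG, rD, rE, rP, rS, rH]
  all_goals field_simp
  all_goals ring

theorem ikR'₁₂_eq (B : Type*) [Ring B] [Algebra ℂ B] {q a b : ℂ} (hq : q ≠ 0) (ha : a ≠ 0)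
    (hb : b ≠ 0) :
    ikR'₁₂ B q (a / b) = (q ^ 5 * a * b)⁻¹ • (rFlip q a b).map (algebraMap ℂ B) := by
  rw [ikR'₁₂, ikR_eq hq ha hb]
  ext p r
  simp only [flip, rFlip, submatrix_apply, Matrix.map_apply, Matrix.smul_apply, smul_eq_mul,
    map_mul (algebraMap ℂ B) (_⁻¹)]
  rw [Algebra.smul_def]

theorem ikR'₂₁_eq (B : Type*) [Ring B] [Algebra ℂ B] {q a b : ℂ} (hq : q ≠ 0) (ha : a ≠ 0)
    (hb : b ≠ 0) :
    ikR'₂₁ B q (a / b) = (q ^ 5 * a * b)⁻¹ • (rMat q a b).map (algebraMap ℂ B) := by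
  rw [ikR'₂₁, ikR_eq hq ha hb]
  ext p r
  simp only [flip, submatrix_apply, Prod.swap_swap, Matrix.map_apply, Matrix.smul_apply,
    smul_eq_mul, map_mul (algebraMap ℂ B) (_⁻¹)]
  rw [Algebra.smul_def]

end DynK

end

/-! ### Transfer of the results to the original matrix `K(u)`. -/

open scoped TensorProduct Kronecker Matrix
noncomputable section

namespace DynK

open Polynomial

/-- An intertwining relation of algebra homomorphisms holds as soon as it holds for the
generators. -/
theorem intertwines_iff {X M : Type*} [Ring M] [Algebra ℂ M] (φ ψ : FreeAlgebra ℂ X →ₐ[ℂ] M)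
    (K : M) : (∀ y, K * φ y = ψ y * K)
      ↔ ∀ i, K * φ (FreeAlgebra.ι ℂ i) = ψ (FreeAlgebra.ι ℂ i) * K := by
  refine ⟨fun h i => h _, fun h y => ?_⟩
  induction y using FreeAlgebra.induction with
  | grade0 c => rw [AlgHom.commutes, AlgHom.commutes, Algebra.commutes]
  | grade1 i => exact h i
  | mul a b ha hb =>
    rw [map_mul, map_mul, ← mul_assoc, ha, mul_assoc, hb, mul_assoc]
  | add a b ha hb => rw [map_add, map_add, mul_add, add_mul, ha, hb]

theorem smul_intertwines_iff {M : Type*} [Ring M] [Algebra ℂ M] {c : ℂ} (hc : c ≠ 0)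
    (K a b : M) : K * (c • a) = (c • b) * K ↔ K * a = b * K := by
  rw [mul_smul_comm, smul_mul_assoc, (smul_right_injective M hc).eq_iff]

theorem scalar_mul_eq_smul {A : Type*} [Ring A] (a : A) (M : Matrix (Fin 3) (Fin 3) A) :
    Matrix.scalar (Fin 3) a * M = a • M := by
  ext i j
  simp

theorem span_smul_monomials_le {A : Type*} [Ring A] [Algebra ℂ A] (a b c : ℂ)
    (x y z : A) :
    Submodule.span ℂ {w | ∃ i j k : ℕ, i + j + k < 4 ∧
        w = (a • x) ^ i * (b • y) ^ j * (c • z) ^ k}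
      ≤ Submodule.span ℂ {w | ∃ i j k : ℕ, i + j + k < 4 ∧ w = x ^ i * y ^ j * z ^ k} := by
  refine Submodule.span_le.2 ?_
  rintro w ⟨i, j, k, h, rfl⟩
  simp only [_root_.smul_pow, smul_mul_assoc, mul_smul_comm, smul_smul]
  exact Submodule.smul_mem _ _ (Submodule.subset_span ⟨i, j, k, h, rfl⟩)

section
variable {A : Type*} [Ring A] [Algebra ℂ A] {q κ u : ℂ} {x y z : A}

/-- Only the words `yx` and `yyx` are out of order, and reordering them stays within degree three.
The Casimir element itself has degree three. -/
theorem NormRel.kFull_mem_span (h : NormRel q κ x y z) (u : ℂ) (i j : Fin 3) :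
    kFull q κ u x y z i j ∈ Submodule.span ℂ
      {w | ∃ i j k : ℕ, i + j + k < 4 ∧ w = x ^ i * y ^ j * z ^ k} := by
  set S := Submodule.span ℂ {w | ∃ i j k : ℕ, i + j + k < 4 ∧ w = x ^ i * y ^ j * z ^ k}
  have hm : ∀ i j k : ℕ, i + j + k < 4 → x ^ i * y ^ j * z ^ k ∈ S :=
    fun i j k h => Submodule.subset_span ⟨i, j, k, h, rfl⟩
  have s1 : (1 : A) ∈ S := by simpa using hm 0 0 0 (by norm_num)
  have sx : x ∈ S := by simpa using hm 1 0 0 (by norm_num)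
  have sy : y ∈ S := by simpa using hm 0 1 0 (by norm_num)
  have sz : z ∈ S := by simpa using hm 0 0 1 (by norm_num)
  have sxx : x * x ∈ S := by simpa [pow_two] using hm 2 0 0 (by norm_num)
  have syy : y * y ∈ S := by simpa [pow_two] using hm 0 2 0 (by norm_num)
  have szz : z * z ∈ S := by simpa [pow_two] using hm 0 0 2 (by norm_num)
  have sxy : x * y ∈ S := by simpa using hm 1 1 0 (by norm_num)
  have syz : y * z ∈ S := by simpa using hm 0 1 1 (by norm_num)
  have sxyy : x * (y * y) ∈ S := by simpa [pow_two] using hm 1 2 0 (by norm_num)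
  have sxyz : x * (y * z) ∈ S := by simpa [mul_assoc] using hm 1 1 1 (by norm_num)
  have sT : casT q κ x y z ∈ S :=
    S.sub_mem (S.add_mem (S.sub_mem (S.add_mem sxyz syy) (S.smul_mem _ szz)) (S.smul_mem _ sxx))
      (S.smul_mem _ sx)
  have syx : y * x ∈ S := by
    rw [h.yx]; exact S.sub_mem (S.smul_mem _ sxy) (S.smul_mem _ sz)
  have szy : z * y ∈ S := by
    rw [h.zy]
    exact S.sub_mem (S.add_mem (S.smul_mem _ syz) (S.smul_mem _ sx)) (S.smul_mem _ s1)
  have syyx : y * (y * x) ∈ S := by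
    rw [h.yx, mul_sub, mul_smul_comm, mul_smul_comm, h.yx_assoc]
    exact S.sub_mem (S.smul_mem _ (S.sub_mem (S.smul_mem _ sxyy) (S.smul_mem _ szy)))
      (S.smul_mem _ syz)
  fin_cases i <;> fin_cases j <;>
  simp only [Fin.mk_zero, Fin.mk_one, Fin.reduceFinMk, kFull, kHat, kShape_00,
    kShape_01, kShape_02, kShape_10, kShape_11, kShape_12, kShape_20, kShape_21, kShape_22] <;>
  repeat' first
    | assumption
    | with_reducible apply S.add_mem
    | with_reducible apply S.smul_mem

end

section
variable {q r α β γ μ μ' C : ℂ}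

namespace Params
variable (P : Params q r α β γ μ μ')
include P

theorem lowDegree_eq : lowDegree q μ μ' C = Submodule.span ℂ {w | ∃ i j k : ℕ, i + j + k < 4 ∧
    w = gX q α μ μ' C ^ i * gY q γ μ μ' C ^ j * gZ q α γ μ μ' C ^ k} := by
  refine le_antisymm ?_ (span_smul_monomials_le _ _ _ _ _ _)
  rw [lowDegree, P.W0_eq, P.W1_eq, P.W2_eq]
  exact span_smul_monomials_le _ _ _ _ _ _

theorem kMatrix_mem_lowDegree {u : ℂ} (hu : u ≠ 0) (hu1 : u ^ 2 - 1 ≠ 0) (i j : Fin 3) :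
    kMatrix q r α β μ μ' C u i j ∈ lowDegree q μ μ' C := by
  rw [P.lowDegree_eq, P.kMatrix_eq hu hu1]
  exact Submodule.smul_mem _ _ (P.normRel.kFull_mem_span u i j)

/-- Polynomials in the rescaled Casimir element are polynomials in `Q`. -/
theorem aeval_casQ (f : ℂ[X]) : aeval (casQ q μ μ' C)
    (f.comp (Polynomial.C (wZ q α γ ^ 2 / q ^ 4)⁻¹ * X)) = aeval (casT q (kap q α γ C)
      (gX q α μ μ' C) (gY q γ μ μ' C) (gZ q α γ μ μ' C)) f := by
  rw [aeval_comp, map_mul, aeval_C, aeval_X, ← Algebra.smul_def, P.casQ_eq, inv_smul_smul₀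
    (div_ne_zero (pow_ne_zero _ P.wZ_ne) (pow_ne_zero _ P.q_ne))]

theorem casQ_mem_center : casQ q μ μ' C ∈ Subalgebra.center ℂ (AWA22 q μ μ' C) := by
  obtain ⟨τ, Φ, H⟩ := P.exists_isRep C
  rw [P.casQ_eq]
  refine Subalgebra.smul_mem _ (Subalgebra.mem_center_iff.2 fun w => ?_) _
  have := H.aeval_commute X w
  rw [aeval_X] at this
  exact this.eq.symm

theorem kMatrix_intertwines {u : ℂ} (hu : u ≠ 0) (hu1 : u ^ 2 - 1 ≠ 0) :
    kMatrix q r α β μ μ' C u * onsM0 q u⁻¹ u (gX q α μ μ' C)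
        = onsM0 q u u⁻¹ (gX q α μ μ' C) * kMatrix q r α β μ μ' C u ∧
      kMatrix q r α β μ μ' C u * onsM1 q (gY q γ μ μ' C)
        = onsM1 q (gY q γ μ μ' C) * kMatrix q r α β μ μ' C u := by
  have h := P.normRel (C := C)
  rw [P.kMatrix_eq hu hu1, smul_mul_assoc, mul_smul_comm, smul_mul_assoc, mul_smul_comm,
    h.kFull_mul_onsM0 P.q_ne hu hu1, kFull, h.kHat_mul_onsM1 P.q_ne]
  exact ⟨rfl, rfl⟩

/-- Every intertwiner is a polynomial in the Casimir element times `K(u)`; the degree condition then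
forces this polynomial to be constant. -/
theorem kMatrix_unique {u : ℂ} (hu : u ≠ 0) (hu1 : u ^ 2 - 1 ≠ 0)
    {K : Matrix (Fin 3) (Fin 3) (AWA22 q μ μ' C)}
    (h₁ : K * onsM1 q (gY q γ μ μ' C) = onsM1 q (gY q γ μ μ' C) * K)
    (h₀ : K * onsM0 q u⁻¹ u (gX q α μ μ' C) = onsM0 q u u⁻¹ (gX q α μ μ' C) * K) :
    ((∀ i j, K i j ∈ lowDegree q μ μ' C) → ∃ z : ℂ, K = z • kMatrix q r α β μ μ' C u) ∧
      ∃ f : ℂ[X], K = aeval (casQ q μ μ' C) f • kMatrix q r α β μ μ' C u := by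
  obtain ⟨τ, Φ, H⟩ := P.exists_isRep C
  obtain ⟨f, rfl⟩ := H.exists_eq_aeval_mul_kFull hu hu1 h₁ h₀
  have hθ := P.theta_ne hu
  have hk := (eq_inv_smul_iff₀ hθ).2 (P.kMatrix_eq (C := C) hu hu1).symm
  rw [scalar_mul_eq_smul]
  refine ⟨fun hl => ?_, (Polynomial.C (theta q r α γ u)⁻¹ * f).comp (Polynomial.C
    (wZ q α γ ^ 2 / q ^ 4)⁻¹ * X), ?_⟩
  -- The middle diagonal entry involves only the Casimir element, `1` and `x`, which makes its
  -- weight easy to read.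
  · have h11 := hl 1 1
    rw [P.lowDegree_eq] at h11
    obtain ⟨c, rfl⟩ := H.aeval_const_of_mem_span hu hu1 h11
    refine ⟨c * (theta q r α γ u)⁻¹, ?_⟩
    rw [aeval_C, hk, algebraMap_smul, smul_smul]
  · rw [P.aeval_casQ, hk, map_mul, aeval_C, mul_smul, algebraMap_smul, smul_comm]

theorem exists_kMatrix_mul_inv {u : ℂ} (hu : u ≠ 0) (hu1 : u ^ 2 - 1 ≠ 0) :
    ∃ χ : ℂ[X], aeval (casQ q μ μ' C) χ ≠ 0 ∧ IsRegular (aeval (casQ q μ μ' C) χ) ∧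
      kMatrix q r α β μ μ' C u * kMatrix q r α β μ μ' C u⁻¹ = aeval (casQ q μ μ' C) χ • 1 ∧
      kMatrix q r α β μ μ' C u⁻¹ * kMatrix q r α β μ μ' C u = aeval (casQ q μ μ' C) χ • 1 := by
  obtain ⟨τ, Φ, H⟩ := P.exists_isRep C
  have : Nontrivial (AWA22 q μ μ' C) := Φ.toRingHom.domain_nontrivial
  have hu' := inv_ne_zero hu
  have hu1' : u⁻¹ ^ 2 - 1 ≠ 0 := by
    intro e; apply hu1; field_simp at e; linear_combination -e
  have hχ : Polynomial.C (theta q r α γ u * theta q r α γ u⁻¹) * chiPoly q (kap q α γ C) u ≠ 0 :=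
    mul_ne_zero (C_ne_zero.2 (mul_ne_zero (P.theta_ne hu) (P.theta_ne hu')))
      (IsRep.chiPoly_ne_zero P.q_ne hu hu1)
  have hreg := H.isRegular_aeval hχ
  rw [← P.aeval_casQ] at hreg
  refine ⟨_, hreg.ne_zero, hreg, ?_, ?_⟩
  · rw [P.aeval_casQ, P.kMatrix_eq hu hu1, P.kMatrix_eq hu' hu1', smul_mul_assoc, mul_smul_comm,
      H.kFull_mul_kFull_inv hu hu1, map_mul, aeval_C, smul_smul,
      ← Algebra.smul_def, smul_assoc, ← scalar_mul_eq_smul, mul_one]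
  · rw [P.aeval_casQ, P.kMatrix_eq hu hu1, P.kMatrix_eq hu' hu1', smul_mul_assoc, mul_smul_comm,
      H.kFull_inv_mul_kFull hu hu1, map_mul, aeval_C, smul_smul,
      ← Algebra.smul_def, smul_assoc, ← scalar_mul_eq_smul, mul_one, mul_comm (theta q r α γ u)]

theorem reflection {u v : ℂ} (hu : u ≠ 0) (hv : v ≠ 0) (hu1 : u ^ 2 - 1 ≠ 0)
    (hv1 : v ^ 2 - 1 ≠ 0) :
    ikR'₁₂ _ q (u / v) * inFirst (kMatrix q r α β μ μ' C u) * ikR'₂₁ _ q (u * v)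
        * inSecond (kMatrix q r α β μ μ' C v)
      = inSecond (kMatrix q r α β μ μ' C v) * ikR'₁₂ _ q (u * v)
        * inFirst (kMatrix q r α β μ μ' C u) * ikR'₂₁ _ q (u / v) := by
  have h := P.normRel (C := C)
  have hq3 : q ^ 4 + q ^ 2 + 1 ≠ 0 := fun e =>
    P.pow_sub_ne (n := 6) (by norm_num) (by linear_combination (q ^ 2 - 1) * e)
  have key := sub_eq_zero.1 (h.reflDiff_kFull P.q_ne (P.pow_sub_ne (by norm_num))
    (P.pow_sub_ne (by norm_num)) hq3 hu1 hv hv1)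
  have s₁ : ∀ (c : ℂ) (M : Matrix (Fin 3) (Fin 3) (AWA22 q μ μ' C)),
      inFirst (c • M) = c • inFirst M := fun c M => Matrix.smul_kronecker _ _ _
  have s₂ : ∀ (c : ℂ) (M : Matrix (Fin 3) (Fin 3) (AWA22 q μ μ' C)),
      inSecond (c • M) = c • inSecond M := fun c M => Matrix.kronecker_smul _ _ _
  have huv := mul_ne_zero hu hv
  -- The argument `u * v` is read as the quotient `u * v / 1`.
  have e₁ := ikR'₁₂_eq (AWA22 q μ μ' C) P.q_ne huv one_ne_zero
  have e₂ := ikR'₂₁_eq (AWA22 q μ μ' C) P.q_ne huv one_ne_zero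
  rw [div_one] at e₁ e₂
  rw [e₁, e₂, ikR'₁₂_eq _ P.q_ne hu hv, ikR'₂₁_eq _ P.q_ne hu hv, P.kMatrix_eq hu hu1,
    P.kMatrix_eq hv hv1, s₁, s₂]
  simp only [smul_mul_assoc, mul_smul_comm, smul_smul]
  rw [key]
  congr 1
  ring

end Params
end

end DynK

end

/-! ### The main theorem. -/

theorem mainTheorem1 (q r : ℂ) (hq0 : q ≠ 0) (hq : ∀ n : ℕ, 0 < n → q ^ n ≠ 1) (hr : r ^ 2 = q)
    (hq3 : q ^ 4 + 3 + q ^ (-4 : ℤ) ≠ 0)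
    (c₀ c₀' c₁ c₁' : ℂ) (hc₀ : c₀ ≠ 0) (hc₀' : c₀' ≠ 0) (hc₁ : c₁ ≠ 0) (hc₁' : c₁' ≠ 0)
    (C α β s₀ s₁ : ℂ) (hs₀0 : s₀ ≠ 0) (hs₁0 : s₁ ≠ 0)
    (hα : α ^ 2 = c₀ * c₀') (hβ : β ^ 2 * (DynK.muBar q c₁ c₁' * (q + q⁻¹)) = q ^ 8)
    (hs₀ : s₀ ^ 2 * c₀ = q ^ 4 * c₀') (hs₁ : s₁ ^ 2 * c₁ = q * (q + q⁻¹) * c₁')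
    (hroot₀ : α * s₀ = q ^ 2 * c₀')
    (hroot₁ : β * c₁ * s₁ * (q + q⁻¹) * (q ^ 2 + q ^ (-2 : ℤ)) = r ^ 9) :
    let μ : ℂ := c₀ * c₀'
    let μ' : ℂ := DynK.muBar q c₁ c₁'
    let Q : DynK.AWA22 q μ μ' C := DynK.casQ q μ μ' C
    let K : ℂ → Matrix (Fin 3) (Fin 3) (DynK.AWA22 q μ μ' C) :=
      DynK.kMatrix q r α β μ μ' C
    -- `(π_u ⊗ Π) ∘ δ`
    let D : (u : ℂ) → u ≠ 0 →
        (FreeAlgebra ℂ (Fin 2) →ₐ[ℂ] Matrix (Fin 3) (Fin 3) (DynK.AWA22 q μ μ' C)) :=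
      fun _ hu => (DynK.tensorRep (DynK.fundRep hq0 hq hs₀0 hs₁0 hu)
        (DynK.evalHom C hq0 hq3)).comp (DynK.coaction q c₀ c₀' c₁ c₁')
    -- `Q` is central
    (Q ∈ Subalgebra.center ℂ (DynK.AWA22 q μ μ' C)) ∧
    (∀ (u : ℂ) (hu : u ≠ 0), u ^ 2 ≠ 1 →
      -- the entries of `K(u)` have degree below 4
      (∀ i j, K u i j ∈ DynK.lowDegree q μ μ' C) ∧
      -- the intertwiner equation
      (∀ y, K u * D u hu y = D u⁻¹ (inv_ne_zero hu) y * K u) ∧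
      -- uniqueness up to a scalar
      (∀ K' : Matrix (Fin 3) (Fin 3) (DynK.AWA22 q μ μ' C),
        (∀ y, K' * D u hu y = D u⁻¹ (inv_ne_zero hu) y * K') →
          ((∀ i j, K' i j ∈ DynK.lowDegree q μ μ' C) → ∃ z : ℂ, K' = z • K u) ∧
          ((∀ i j, K' i j ∈ DynK.lowDegreeQ q μ μ' C) →
            ∃ f : Polynomial ℂ, K' = Polynomial.aeval Q f • K u)) ∧
      -- `K(u)⁻¹` is proportional to `K(u⁻¹)`
      (∃ χ : Polynomial ℂ, Polynomial.aeval Q χ ≠ 0 ∧ IsRegular (Polynomial.aeval Q χ) ∧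
        K u * K u⁻¹ = Polynomial.aeval Q χ • 1 ∧ K u⁻¹ * K u = Polynomial.aeval Q χ • 1)) ∧
    -- the reflection equation
    (∀ u v : ℂ, u ≠ 0 → v ≠ 0 → u ^ 2 ≠ 1 → v ^ 2 ≠ 1 →
      DynK.ikR'₁₂ _ q (u / v) * DynK.inFirst (K u) * DynK.ikR'₂₁ _ q (u * v)
          * DynK.inSecond (K v)
        = DynK.inSecond (K v) * DynK.ikR'₁₂ _ q (u * v) * DynK.inFirst (K u)
          * DynK.ikR'₂₁ _ q (u / v)) := by 
  intro μ μ' Q K D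
  have P : DynK.Params q r α β (c₁ * s₁) μ μ' :=
    DynK.params_of_roots hq0 hq hr hc₀ hc₀' hc₁ hs₁0 hα hs₁ hroot₁
  have h1 : ∀ u : ℂ, u ^ 2 ≠ 1 → u ^ 2 - 1 ≠ 0 := fun u h => sub_ne_zero.2 h
  have n₀ : α / (q ^ 6 * (q ^ 8 - 1)) ≠ 0 :=
    div_ne_zero P.α_ne (mul_ne_zero (pow_ne_zero _ hq0) (P.pow_sub_ne (by norm_num)))
  have n₁ : c₁ * s₁ / (q ^ 7 * (q ^ 4 - 1)) ≠ 0 :=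
    div_ne_zero P.γ_ne (mul_ne_zero (pow_ne_zero _ hq0) (P.pow_sub_ne (by norm_num)))
  -- It suffices to intertwine the images of the two generators. The rescaling factors of these
  -- images do not depend on the spectral parameter, so they cancel between the two sides.
  have hD : ∀ (u : ℂ) (hu : u ≠ 0) (K' : Matrix (Fin 3) (Fin 3) (DynK.AWA22 q μ μ' C)),
      (∀ y, K' * D u hu y = D u⁻¹ (inv_ne_zero hu) y * K')
        ↔ K' * DynK.onsM0 q u⁻¹ u (DynK.gX q α μ μ' C)
            = DynK.onsM0 q u u⁻¹ (DynK.gX q α μ μ' C) * K' ∧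
          K' * DynK.onsM1 q (DynK.gY q (c₁ * s₁) μ μ' C)
            = DynK.onsM1 q (DynK.gY q (c₁ * s₁) μ μ' C) * K' := by
    intro u hu K'
    have e₀ := fun (u : ℂ) (hu : u ≠ 0) =>
      DynK.tensorRep_coaction_zero (C := C) hq0 hq hq3 hs₀0 hs₁0 hu P hs₀ hroot₀
    have e₁ := fun (u : ℂ) (hu : u ≠ 0) =>
      DynK.tensorRep_coaction_one (C := C) hq0 hq hq3 hs₀0 hs₁0 hu P hs₁
    rw [DynK.intertwines_iff, Fin.forall_fin_two]
    simp only [D, AlgHom.comp_apply, e₀, e₁, inv_inv]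
    rw [DynK.smul_intertwines_iff n₀, DynK.smul_intertwines_iff n₁]
  refine ⟨P.casQ_mem_center, fun u hu hu2 => ⟨P.kMatrix_mem_lowDegree hu (h1 u hu2),
    (hD u hu _).2 (P.kMatrix_intertwines hu (h1 u hu2)), fun K' hK' => ?_,
    P.exists_kMatrix_mul_inv hu (h1 u hu2)⟩, fun u v hu hv hu2 hv2 =>
    P.reflection hu hv (h1 u hu2) (h1 v hv2)⟩
  have h := (hD u hu K').1 hK'
  have hK := P.kMatrix_unique hu (h1 u hu2) h.2 h.1
  exact ⟨hK.1, fun _ => hK.2⟩
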